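/- Let $N\in\mathbb N$, let $A$ be an $N\times N$ matrix with non-negative integer entries and $B$ an $N\times N$ integer matrix. Let $E_A$ be the finite directed graph with vertices $1,\dots,N$ and edges $e_{i,j,n}$ ($0\le n<A_{i,j}$) from $s(e_{i,j,n})=i$ to $r(e_{i,j,n})=j$. For $m\in\mathbb Z$ write $mB_{i,j}+n=qA_{i,j}+t$ with $0\le t<A_{i,j}$, and put $\kappa_m(e_{i,j,n})=e_{i,j,t}$ and $\varphi(m,e_{i,j,n})=q$. Extend $\varphi$ and $\kappa$ to paths by $\varphi(m,\mu e)=\varphi(\varphi(m,\mu),e)$ and $\kappa_m(e_1e_2e_3\cdots)=\kappa_m(e_1)\,\kappa_{\varphi(m,e_1)}(e_2)\,\kappa_{\varphi(m,e_1e_2)}(e_3)\cdots$; this includes infinite paths. Let $E_A^\infty$ be the space of infinite paths, with the topology generated by the cylinder sets $Z(\nu)=\{\nu y\}$. The Katsura–Exel–Pardo groupoid $\mathcal G_{A,B}$ consists of the classes $[\mu,m,\nu;x]$ of quadruples, where $\mu,\nu$ are finite paths with $r(\mu)=r(\nu)$, $m\in\mathbb Z$ and $x\in Z(\nu)$, under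 the equivalence relation generated by $(\mu,m,\nu;\nu ez)\sim(\mu\kappa_m(e),\varphi(m,e),\nu e;\nu ez)$. Its unit space is $E_A^\infty$; source, range, product and inverse are $s([\mu,m,\nu;\nu y])=\nu y$, $r([\mu,m,\nu;\nu y])=\mu\kappa_m(y)$, $[\lambda,n,\mu;\mu\kappa_m(y)]\cdot[\mu,m,\nu;\nu y]=[\lambda,n+m,\nu;\nu y]$ and $[\mu,m,\nu;\nu y]^{-1}=[\nu,-m,\mu;\mu\kappa_m(y)]$; its topology is generated by the sets $Z(\mu,m,\nu)=\{[\mu,m,\nu;x]\mid x\in Z(\nu)\}$. Let $c:\mathcal G_{A,B}\to\mathbb Z$, $c([\mu,m,\nu;x])=|\mu|-|\nu|$, be the canonical cocycle and let $\mathcal H_{A,B}=\ker(c)$, a subgroupoid of $\mathcal G_{A,B}$ with the same unit space and with the subspace topology. Let $\mathcal G$ be an effective ample Hausdorff groupoid with compact unit space $\mathcal G^{(0)}$, where effective means that the interior of $\{g\mid s(g)=r(g)\}$ is $\mathcal G^{(0)}$. A full bisection is a compact open set $U\subseteq\mathcal G$ mapped bijectively onto $\mathcal G^{(0)}$ by $s$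 and by $r$; put $\pi_U=r\circ(s|_U)^{-1}$. The topological full group is $[[\mathcal G]]=\{\pi_U\mid U\text{ a full bisection}\}$. Let $\mathcal T(\mathcal G)$ be its subgroup generated by the transpositions, that is, by the elements $\pi_{\widehat V}$ with $\widehat V=V\sqcup V^{-1}\sqcup\big(\mathcal G^{(0)}\setminus(s(V)\cup r(V))\big)$, where $V$ is a compact open bisection with $s(V)\cap r(V)=\emptyset$. Let $H_1(\mathcal G)=\ker\delta_1/\operatorname{im}\delta_2$, where $\delta_1=s_*-r_*:C_c(\mathcal G,\mathbb Z)\to C_c(\mathcal G^{(0)},\mathbb Z)$ and $\delta_2:C_c(\mathcal G^{(2)},\mathbb Z)\to C_c(\mathcal G,\mathbb Z)$ is $\delta_2=(d_0)_*-(d_1)_*+(d_2)_*$ with $d_0(g,h)=h$, $d_1(g,h)=gh$, $d_2(g,h)=g$ and $f_*(k)(y)=\sum_{f(x)=y}k(x)$. The index map is $I:[[\mathcal G]]\to H_1(\mathcal G)$, $\pi_U\mapsto[1_U]$. The groupoid $\mathcal G$ has Property TR if $\mathcal T(\mathcal G)=\ker(I)$. **Proposition.** Assume that $A$ is essential (it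 has no zero rows and no zero columns) and that $\mathcal G_{A,B}$ is Hausdorff, effective and minimal (every orbit is dense in the unit space). Then $\mathcal H_{A,B}$ is an effective ample Hausdorff groupoid and has Property TR. -/

import Mathlib

section Pushforward

open Set Topology CompactlySupported

theorem pushforward_fiber_finite {Y Z : Type*} [TopologicalSpace Y] [TopologicalSpace Z]
    {f : Y → Z} (hf : IsLocalHomeomorph f) (h : C_c(Y, ℤ)) (z : Z) :
    ((f ⁻¹' {z}) ∩ Function.support h).Finite := by
  have hK : IsCompact (tsupport h) := h.hasCompactSupport
  choose e he hfe using hf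
  obtain ⟨t, ht⟩ := hK.elim_finite_subcover (fun y => (e y).source) (fun y => (e y).open_source)
    (fun y _ => mem_iUnion.2 ⟨y, he y⟩)
  refine (Set.Finite.biUnion t.finite_toSet (t := fun i => (e i).source ∩ f ⁻¹' {z})
    (fun i _ => Set.Subsingleton.finite ?_)).subset ?_
  · rintro a ⟨ha, ha'⟩ b ⟨hb, hb'⟩
    apply (e i).injOn ha hb
    rw [← hfe i]; exact ha'.trans hb'.symm
  · rintro a ⟨ha, ha'⟩
    have := ht (subset_tsupport _ ha')
    simp only [mem_iUnion] at this ⊢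
    obtain ⟨i, hi, hi'⟩ := this
    exact ⟨i, hi, hi', ha⟩

theorem pushforward_continuous {Y Z : Type*} [TopologicalSpace Y] [TopologicalSpace Z]
    [T2Space Y] [T2Space Z] {f : Y → Z} (hf : IsLocalHomeomorph f) (h : C_c(Y, ℤ)) :
    Continuous fun z => ∑ᶠ y ∈ f ⁻¹' {z}, h y := by
  classical
  rw [continuous_iff_continuousAt]
  intro z
  have hfin := pushforward_fiber_finite hf h z
  obtain ⟨V, hV, hVd⟩ := hfin.t2_separation
  choose e he hfe using id hf
  -- shrink the neighbourhoods so that `f` is injective and `h` is constant on each of them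
  let V' : Y → Set Y := fun y => V y ∩ (e y).source ∩ h ⁻¹' {h y}
  have hV'o : ∀ y, IsOpen (V' y) := fun y =>
    ((hV y).2.inter (e y).open_source).inter ((isOpen_discrete _).preimage (map_continuous h))
  have hV'm : ∀ y, y ∈ V' y := fun y => ⟨⟨(hV y).1, he y⟩, rfl⟩
  set F := hfin.toFinset with hF
  have hK : IsCompact (tsupport h \ ⋃ y ∈ F, V' y) :=
    h.hasCompactSupport.isCompact.diff (isOpen_biUnion fun y _ => hV'o y)
  have hW1 : ∀ᶠ w in 𝓝 z, w ∉ f '' (tsupport h \ ⋃ y ∈ F, V' y) := by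
    refine (hK.image hf.continuous).isClosed.isOpen_compl.mem_nhds ?_
    rintro ⟨y, ⟨hy, hy'⟩, hyz⟩
    have hcl : IsClosed (Function.support h) := by
      have : Function.support h = h ⁻¹' {0}ᶜ := rfl
      rw [this]
      exact (isClosed_discrete _).preimage (map_continuous h)
    have hys : y ∈ Function.support h := by rwa [tsupport, hcl.closure_eq] at hy
    exact hy' (mem_biUnion (x := y) (by simp [hF, hys, hyz]) (hV'm y))
  have hW2 : ∀ᶠ w in 𝓝 z, ∀ y ∈ F, w ∈ f '' V' y := by
    rw [Filter.eventually_all_finset]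
    intro y hy
    refine (hf.isOpenMap _ (hV'o y)).mem_nhds ⟨y, hV'm y, ?_⟩
    have : y ∈ f ⁻¹' {z} ∩ Function.support h := by simpa [hF] using hy
    exact this.1
  have hconst : ∀ᶠ w in 𝓝 z, ∑ᶠ y ∈ f ⁻¹' {w}, h y = ∑ y ∈ F, h y := by
    filter_upwards [hW1, hW2] with w h1 h2
    choose! g hg hgw using h2
    have hinj : Set.InjOn g F := by
      intro a ha b hb hab
      by_contra hne
      have ha' : a ∈ f ⁻¹' {z} ∩ Function.support h := by simpa [hF] using ha
      have hb' : b ∈ f ⁻¹' {z} ∩ Function.support h := by simpa [hF] using hb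
      exact Set.disjoint_left.1 (hVd ha' hb' hne) (hg a ha).1.1 (hab ▸ (hg b hb).1.1)
    have hsum : ∑ y ∈ F, h y = ∑ y ∈ F.image g, h y := by
      rw [Finset.sum_image hinj]
      exact Finset.sum_congr rfl fun y hy => ((hg y hy).2 : h (g y) = h y).symm
    rw [hsum]
    refine finsum_mem_eq_sum_of_inter_support_eq _ ?_
    ext y
    simp only [mem_inter_iff, mem_preimage, mem_singleton_iff, Finset.coe_image]
    constructor
    · rintro ⟨hy, hys⟩
      refine ⟨?_, hys⟩
      by_contra hcon
      refine h1 ⟨y, ⟨subset_tsupport _ hys, ?_⟩, hy⟩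
      simp only [mem_iUnion, not_exists]
      intro x hx hyx
      refine hcon ⟨x, hx, ?_⟩
      apply (e x).injOn (hg x hx).1.2 hyx.1.2
      rw [← hfe x, hgw x hx, hy]
    · rintro ⟨⟨x, hx, rfl⟩, hys⟩
      exact ⟨hgw x hx, hys⟩
  have : ∑ᶠ y ∈ f ⁻¹' {z}, h y = ∑ y ∈ F, h y := hconst.self_of_nhds
  simp only [ContinuousAt, this]
  exact tendsto_const_nhds.congr' (hconst.mono fun w hw => hw.symm)

/-- The map `f_* : C_c(Y, ℤ) → C_c(Z, ℤ)`, `f_*(h)(z) = ∑_{f(y) = z} h(y)`, induced by a local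
homeomorphism `f`; the sum has only finitely many nonzero terms. -/
noncomputable def pushforward {Y Z : Type*} [TopologicalSpace Y] [TopologicalSpace Z]
    [T2Space Y] [T2Space Z] (f : Y → Z) (hf : IsLocalHomeomorph f) : C_c(Y, ℤ) →+ C_c(Z, ℤ) where
  toFun h :=
    { toFun := fun z => ∑ᶠ y ∈ f ⁻¹' {z}, h y
      continuous_toFun := pushforward_continuous hf h
      hasCompactSupport' := by
        refine HasCompactSupport.intro (h.hasCompactSupport.isCompact.image hf.continuous) ?_
        intro z hz
        refine finsum_mem_eq_zero_of_forall_eq_zero fun y hy => ?_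
        by_contra hne
        exact hz ⟨y, subset_tsupport _ hne, hy⟩ }
  map_zero' := by ext z; simp
  map_add' h k := by
    ext z
    exact finsum_mem_add_distrib' (pushforward_fiber_finite hf h z)
      (pushforward_fiber_finite hf k z)

end Pushforward

/-- A groupoid with set of arrows `G` and unit space `X` (the unit space is identified with a set of
arrows through `unit`). The product `g h` is defined exactly when `s(g) = r(h)`. -/
structure AlgGroupoid (G X : Type*) where
  src : G → X
  rng : G → X
  unit : X → G
  inv : G → G
  mul : (g h : G) → src g = rng h → G
  src_unit : ∀ x, src (unit x) = x
  rng_unit : ∀ x, rng (unit x) = x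
  src_inv : ∀ g, src (inv g) = rng g
  rng_inv : ∀ g, rng (inv g) = src g
  src_mul : ∀ g h (p : src g = rng h), src (mul g h p) = src h
  rng_mul : ∀ g h (p : src g = rng h), rng (mul g h p) = rng g
  mul_assoc : ∀ g h k (p : src g = rng h) (q : src h = rng k),
    mul (mul g h p) k ((src_mul g h p).trans q) = mul g (mul h k q) (p.trans (rng_mul h k q).symm)
  unit_mul : ∀ g, mul (unit (rng g)) g (src_unit _) = g
  mul_unit : ∀ g, mul g (unit (src g)) (rng_unit _).symm = g
  inv_mul : ∀ g, mul (inv g) g (src_inv g) = unit (src g)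
  mul_inv : ∀ g, mul g (inv g) (rng_inv g).symm = unit (rng g)

namespace AlgGroupoid

section Basic

variable {G X : Type*} (𝒢 : AlgGroupoid G X)

/-- The space `𝒢⁽²⁾` of composable pairs, with the topology induced from `G × G`. -/
abbrev Comp : Type _ := {p : G × G // 𝒢.src p.1 = 𝒢.rng p.2}

/-- The product map `𝒢⁽²⁾ → 𝒢`. -/
def compMul (p : 𝒢.Comp) : G := 𝒢.mul p.1.1 p.1.2 p.2

theorem inv_inv (g : G) : 𝒢.inv (𝒢.inv g) = g := by
  have h1 := 𝒢.mul_assoc (𝒢.inv (𝒢.inv g)) (𝒢.inv g) g (𝒢.src_inv _) (𝒢.src_inv _)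
  have e1 : ∀ (a : G) (ha : a = 𝒢.unit (𝒢.rng g)) (p), 𝒢.mul a g p = g := by
    rintro a rfl p; exact 𝒢.unit_mul g
  have e2 : ∀ (a b : G) (ha : a = 𝒢.unit (𝒢.src b)) (p), 𝒢.mul b a p = b := by
    rintro a b rfl p; exact 𝒢.mul_unit b
  rw [e1 _ (by rw [𝒢.inv_mul, 𝒢.src_inv])] at h1
  rw [e2 _ _ (by rw [𝒢.inv_mul, 𝒢.src_inv, 𝒢.rng_inv])] at h1
  exact h1.symm

theorem inv_unit (x : X) : 𝒢.inv (𝒢.unit x) = 𝒢.unit x := by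
  have h1 := 𝒢.inv_mul (𝒢.unit x)
  have e2 : ∀ (a b : G) (ha : a = 𝒢.unit (𝒢.src b)) (p), 𝒢.mul b a p = b := by
    rintro a b rfl p; exact 𝒢.mul_unit b
  rw [e2 _ _ (by rw [𝒢.src_inv, 𝒢.rng_unit]), 𝒢.src_unit] at h1
  exact h1

theorem eq_of_mul_inv_eq_unit (g h : G) (hs : 𝒢.src g = 𝒢.src h) (x : X)
    (e : 𝒢.mul g (𝒢.inv h) (hs.trans (𝒢.rng_inv h).symm) = 𝒢.unit x) : g = h := by
  have h1 := 𝒢.mul_assoc g (𝒢.inv h) h (hs.trans (𝒢.rng_inv h).symm) (𝒢.src_inv h)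
  have hx : x = 𝒢.rng h := by
    have := congrArg 𝒢.src e
    rw [𝒢.src_mul, 𝒢.src_inv, 𝒢.src_unit] at this
    exact this.symm
  have e1 : ∀ (a : G) (ha : a = 𝒢.unit (𝒢.rng h)) (p), 𝒢.mul a h p = h := by
    rintro a rfl p; exact 𝒢.unit_mul h
  have e2 : ∀ (a : G) (ha : a = 𝒢.unit (𝒢.src g)) (p), 𝒢.mul g a p = g := by
    rintro a rfl p; exact 𝒢.mul_unit g
  rw [e1 _ (by rw [e, hx]), e2 _ (by rw [𝒢.inv_mul, hs])] at h1
  exact h1.symm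

end Basic

section Kernel

variable {G X : Type*} (𝒢 : AlgGroupoid G X)

/-- A groupoid homomorphism into the group `ℤ`. -/
structure IntHom where
  toFun : G → ℤ
  map_mul : ∀ g h (p : 𝒢.src g = 𝒢.rng h), toFun (𝒢.mul g h p) = toFun g + toFun h

theorem IntHom.map_unit {𝒢 : AlgGroupoid G X} (c : 𝒢.IntHom) (x : X) :
    c.toFun (𝒢.unit x) = 0 := by
  have h := c.map_mul (𝒢.unit x) (𝒢.unit x) ((𝒢.src_unit x).trans (𝒢.rng_unit x).symm)
  have h2 := 𝒢.inv_mul (𝒢.unit x)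
  simp only [inv_unit, 𝒢.src_unit] at h2
  rw [h2] at h
  omega

theorem IntHom.map_inv {𝒢 : AlgGroupoid G X} (c : 𝒢.IntHom) (g : G) :
    c.toFun (𝒢.inv g) = - c.toFun g := by
  have h := c.map_mul (𝒢.inv g) g (𝒢.src_inv g)
  rw [𝒢.inv_mul, c.map_unit] at h
  omega

/-- The kernel `{g | c(g) = 0}`, a subgroupoid with the same unit space. -/
def IntHom.kernel {𝒢 : AlgGroupoid G X} (c : 𝒢.IntHom) :
    AlgGroupoid {g : G // c.toFun g = 0} X where
  src g := 𝒢.src g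
  rng g := 𝒢.rng g
  unit x := ⟨𝒢.unit x, c.map_unit x⟩
  inv g := ⟨𝒢.inv g, by rw [c.map_inv, g.2, neg_zero]⟩
  mul g h p := ⟨𝒢.mul g h p, by rw [c.map_mul, g.2, h.2, add_zero]⟩
  src_unit x := 𝒢.src_unit x
  rng_unit x := 𝒢.rng_unit x
  src_inv g := 𝒢.src_inv g
  rng_inv g := 𝒢.rng_inv g
  src_mul g h p := 𝒢.src_mul g h p
  rng_mul g h p := 𝒢.rng_mul g h p
  mul_assoc g h k p q := Subtype.ext (𝒢.mul_assoc g h k p q)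
  unit_mul g := Subtype.ext (𝒢.unit_mul g)
  mul_unit g := Subtype.ext (𝒢.mul_unit g)
  inv_mul g := Subtype.ext (𝒢.inv_mul g)
  mul_inv g := Subtype.ext (𝒢.mul_inv g)

end Kernel

section Top

open Topology CompactlySupported

variable {G X : Type*} (𝒢 : AlgGroupoid G X) [TopologicalSpace G] [TopologicalSpace X]

/-- A topological groupoid is ample if it is étale (the source map is a local homeomorphism) and its
unit space is locally compact, Hausdorff and totally disconnected. The arrow space need not be
Hausdorff. As `unit` is continuous with continuous left inverse `src`, the topology of `X` is the
subspace topology of the units. -/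
structure IsAmple : Prop where
  continuous_mul : Continuous 𝒢.compMul
  continuous_inv : Continuous 𝒢.inv
  continuous_unit : Continuous 𝒢.unit
  isLocalHomeomorph_src : IsLocalHomeomorph 𝒢.src
  t2Space_unit : T2Space X
  locallyCompactSpace_unit : LocallyCompactSpace X
  totallyDisconnectedSpace_unit : TotallyDisconnectedSpace X

/-- The interior of the isotropy `{g | s(g) = r(g)}` is the unit space. -/
def IsEffective : Prop := interior {g : G | 𝒢.src g = 𝒢.rng g} = Set.range 𝒢.unit

/-- Every orbit is dense in the unit space. -/
def IsMinimal : Prop := ∀ x : X, Dense {y | ∃ g : G, 𝒢.src g = x ∧ 𝒢.rng g = y}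

variable {𝒢}

theorem IsAmple.isLocalHomeomorph_rng (h𝒢 : 𝒢.IsAmple) : IsLocalHomeomorph 𝒢.rng := by
  let i : G ≃ₜ G := ⟨⟨𝒢.inv, 𝒢.inv, 𝒢.inv_inv, 𝒢.inv_inv⟩, h𝒢.continuous_inv, h𝒢.continuous_inv⟩
  have : 𝒢.rng = 𝒢.src ∘ i := funext fun g => (𝒢.src_inv g).symm
  rw [this]
  exact h𝒢.isLocalHomeomorph_src.comp i.isLocalHomeomorph

theorem IsAmple.isLocalHomeomorph_snd (h𝒢 : 𝒢.IsAmple) :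
    IsLocalHomeomorph fun p : 𝒢.Comp => p.1.2 := by
  have hcont : Continuous fun p : 𝒢.Comp => p.1.2 := by fun_prop
  have hopen : IsOpenMap fun p : 𝒢.Comp => p.1.2 := by
    rintro _ ⟨O, hO, rfl⟩
    rw [isOpen_iff_mem_nhds]
    rintro _ ⟨⟨⟨g, h⟩, hp⟩, hmem, rfl⟩
    obtain ⟨A, B, hA, hB, hgA, hhB, hAB⟩ := isOpen_prod_iff.1 hO g h hmem
    have h1 : B ∩ 𝒢.rng ⁻¹' (𝒢.src '' A) ∈ 𝓝 h :=
      (hB.inter ((h𝒢.isLocalHomeomorph_src.isOpenMap _ hA).preimage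
        h𝒢.isLocalHomeomorph_rng.continuous)).mem_nhds ⟨hhB, g, hgA, hp⟩
    filter_upwards [h1]
    rintro k ⟨hk, a, ha, hak⟩
    exact ⟨⟨(a, k), hak⟩, hAB ⟨ha, hk⟩, rfl⟩
  rw [isLocalHomeomorph_iff_isOpenEmbedding_restrict]
  rintro ⟨⟨g, h⟩, hp⟩
  obtain ⟨e, he, hfe⟩ := h𝒢.isLocalHomeomorph_src g
  have hU : IsOpen {p : 𝒢.Comp | p.1.1 ∈ e.source} := e.open_source.preimage (by fun_prop)
  refine ⟨_, hU.mem_nhds he, IsOpenEmbedding.of_continuous_injective_isOpenMap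
    (hcont.comp continuous_subtype_val) ?_ (hopen.domRestrict hU)⟩
  rintro ⟨⟨⟨a, k⟩, ha⟩, ha'⟩ ⟨⟨⟨b, l⟩, hb⟩, hb'⟩ hkl
  simp only [Set.domRestrict_apply] at hkl
  subst hkl
  have : a = b := e.injOn ha' hb' (by rw [← hfe]; exact ha.trans hb.symm)
  subst this
  rfl

theorem IsAmple.isLocalHomeomorph_fst (h𝒢 : 𝒢.IsAmple) :
    IsLocalHomeomorph fun p : 𝒢.Comp => p.1.1 := by
  refine IsLocalHomeomorph.of_comp (g := 𝒢.src) ?_ h𝒢.isLocalHomeomorph_src (by fun_prop)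
  have : (𝒢.src ∘ fun p : 𝒢.Comp => p.1.1) = 𝒢.rng ∘ fun p : 𝒢.Comp => p.1.2 :=
    funext fun p => p.2
  rw [this]
  exact h𝒢.isLocalHomeomorph_rng.comp h𝒢.isLocalHomeomorph_snd

theorem IsAmple.isLocalHomeomorph_mul (h𝒢 : 𝒢.IsAmple) : IsLocalHomeomorph 𝒢.compMul := by
  refine IsLocalHomeomorph.of_comp (g := 𝒢.src) ?_ h𝒢.isLocalHomeomorph_src h𝒢.continuous_mul
  have : (𝒢.src ∘ 𝒢.compMul) = 𝒢.src ∘ fun p : 𝒢.Comp => p.1.2 :=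
    funext fun p => 𝒢.src_mul _ _ _
  rw [this]
  exact h𝒢.isLocalHomeomorph_src.comp h𝒢.isLocalHomeomorph_snd

/-- `δ₁ = s_* - r_* : C_c(𝒢, ℤ) → C_c(𝒢⁽⁰⁾, ℤ)`. -/
noncomputable def boundaryOne (h𝒢 : 𝒢.IsAmple) [T2Space G] : C_c(G, ℤ) →+ C_c(X, ℤ) :=
  haveI := h𝒢.t2Space_unit
  pushforward 𝒢.src h𝒢.isLocalHomeomorph_src - pushforward 𝒢.rng h𝒢.isLocalHomeomorph_rng

/-- `δ₂ = (d₀)_* - (d₁)_* + (d₂)_* : C_c(𝒢⁽²⁾, ℤ) → C_c(𝒢, ℤ)`, where `d₀(g, h) = h`,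
`d₁(g, h) = g h` and `d₂(g, h) = g`. -/
noncomputable def boundaryTwo (h𝒢 : 𝒢.IsAmple) [T2Space G] : C_c(𝒢.Comp, ℤ) →+ C_c(G, ℤ) :=
  pushforward (fun p : 𝒢.Comp => p.1.2) h𝒢.isLocalHomeomorph_snd
    - pushforward 𝒢.compMul h𝒢.isLocalHomeomorph_mul
    + pushforward (fun p : 𝒢.Comp => p.1.1) h𝒢.isLocalHomeomorph_fst

/-- The first homology group `H₁(𝒢) = ker δ₁ / im δ₂` of an ample Hausdorff groupoid. -/
abbrev H1 (h𝒢 : 𝒢.IsAmple) [T2Space G] : Type _ :=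
  (boundaryOne h𝒢).ker ⧸ ((boundaryTwo h𝒢).range).addSubgroupOf (boundaryOne h𝒢).ker

variable (𝒢)

/-- A full bisection: a compact open set of arrows that both the source map and the range map send
bijectively onto the unit space. (Compactness is automatic when the unit space is compact, and only
groupoids with compact unit space are considered.) -/
structure IsFullBisection (U : Set G) : Prop where
  isOpen : IsOpen U
  isCompact : IsCompact U
  src_bijOn : Set.BijOn 𝒢.src U Set.univ
  rng_bijOn : Set.BijOn 𝒢.rng U Set.univ

/-- The homeomorphism `α` maps `s(g)` to `r(g)` for all `g ∈ U`. When `U` is a full bisection this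
says that `α = π_U = r ∘ (s|_U)⁻¹`. -/
def Implements (U : Set G) (α : X ≃ₜ X) : Prop := ∀ g ∈ U, α (𝒢.src g) = 𝒢.rng g

/-- The topological full group `⟦𝒢⟧ = {π_U | U is a full bisection}`. -/
def fullGroup : Set (X ≃ₜ X) := {α | ∃ U, 𝒢.IsFullBisection U ∧ 𝒢.Implements U α}

/-- `V̂ = V ⊔ V⁻¹ ⊔ (𝒢⁽⁰⁾ \ (s(V) ∪ r(V)))`. -/
def hat (V : Set G) : Set G :=
  V ∪ 𝒢.inv '' V ∪ 𝒢.unit '' (𝒢.src '' V ∪ 𝒢.rng '' V)ᶜ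

/-- A transposition is a homeomorphism `π_{V̂}`, where `V` is a compact open bisection whose source and
range are disjoint. -/
def IsTransposition (τ : X ≃ₜ X) : Prop :=
  ∃ V : Set G, IsOpen V ∧ IsCompact V ∧ Set.InjOn 𝒢.src V ∧ Set.InjOn 𝒢.rng V ∧
    Disjoint (𝒢.src '' V) (𝒢.rng '' V) ∧ 𝒢.Implements (𝒢.hat V) τ

/-- The group `𝒯(𝒢)` generated by all transpositions. -/
def transpositionSubgroup : Subgroup (X ≃ₜ X) := Subgroup.closure {τ | 𝒢.IsTransposition τ}

variable {𝒢}

/-- The indicator function `1_U` of a full bisection. -/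
noncomputable def bisectionIndicator [T2Space G] {U : Set G} (hU : 𝒢.IsFullBisection U) :
    C_c(G, ℤ) where
  toFun := U.indicator 1
  continuous_toFun :=
    continuous_one.indicator (by
      rw [IsClopen.frontier_eq ⟨hU.isCompact.isClosed, hU.isOpen⟩]; simp)
  hasCompactSupport' := HasCompactSupport.intro hU.isCompact fun _ hx =>
    Set.indicator_of_notMem hx _

theorem pushforward_bisectionIndicator [T2Space G] [T2Space X] {U : Set G}
    (hU : 𝒢.IsFullBisection U) {f : G → X} (hf : IsLocalHomeomorph f)
    (hfU : Set.BijOn f U Set.univ) (x : X) :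
    pushforward f hf (bisectionIndicator hU) x = 1 := by
  obtain ⟨g, hg, hgx⟩ := hfU.surjOn (Set.mem_univ x)
  have h0 : bisectionIndicator hU g = 1 := Set.indicator_of_mem hg _
  change ∑ᶠ y ∈ f ⁻¹' {x}, bisectionIndicator hU y = 1
  have h1 : ∑ᶠ y ∈ f ⁻¹' {x}, bisectionIndicator hU y
      = ∑ᶠ y ∈ ({g} : Set G), bisectionIndicator hU y := by
    refine finsum_mem_inter_support_eq' _ _ _ fun y hy => ?_
    have hyU : y ∈ U := by
      by_contra hn
      exact hy (Set.indicator_of_notMem hn _)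
    simp only [Set.mem_preimage, Set.mem_singleton_iff]
    exact ⟨fun h => hfU.injOn hyU hg (h.trans hgx.symm), fun h => h ▸ hgx⟩
  rw [h1, finsum_mem_singleton, h0]

theorem bisectionIndicator_mem_ker (h𝒢 : 𝒢.IsAmple) [T2Space G] {U : Set G}
    (hU : 𝒢.IsFullBisection U) : bisectionIndicator hU ∈ (boundaryOne h𝒢).ker := by
  have := h𝒢.t2Space_unit
  rw [AddMonoidHom.mem_ker]
  ext x
  change pushforward 𝒢.src _ _ x - pushforward 𝒢.rng _ _ x = 0
  rw [pushforward_bisectionIndicator hU _ hU.src_bijOn,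
    pushforward_bisectionIndicator hU _ hU.rng_bijOn, sub_self]

/-- The class `[1_U] ∈ H₁(𝒢)` of a full bisection. -/
noncomputable def bisectionClass (h𝒢 : 𝒢.IsAmple) [T2Space G] {U : Set G}
    (hU : 𝒢.IsFullBisection U) : H1 h𝒢 :=
  QuotientAddGroup.mk ⟨bisectionIndicator hU, bisectionIndicator_mem_ker h𝒢 hU⟩

/-- The index map `I : ⟦𝒢⟧ → H₁(𝒢)`, `π_U ↦ [1_U]`. In an effective groupoid the full bisection `U` is
determined by `π_U`, so the choice made here is immaterial; see `indexMap_eq`. -/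
noncomputable def indexMap (h𝒢 : 𝒢.IsAmple) [T2Space G] (α : 𝒢.fullGroup) : H1 h𝒢 :=
  bisectionClass h𝒢 α.2.choose_spec.1

/-- In an effective ample groupoid, `π_U = π_V` implies `U = V`. -/
theorem IsFullBisection.eq_of_implements (h𝒢 : 𝒢.IsAmple) (he : 𝒢.IsEffective) {U V : Set G}
    (hU : 𝒢.IsFullBisection U) (hV : 𝒢.IsFullBisection V) {α : X ≃ₜ X}
    (hUα : 𝒢.Implements U α) (hVα : 𝒢.Implements V α) : U = V := by
  -- the set `U V⁻¹` is open and contained in the isotropy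
  let O : Set 𝒢.Comp := {p | p.1.1 ∈ U ∧ 𝒢.inv p.1.2 ∈ V}
  have hO : IsOpen O :=
    (hU.isOpen.preimage (by fun_prop)).inter
      (hV.isOpen.preimage (h𝒢.continuous_inv.comp (by fun_prop)))
  have hsub : 𝒢.compMul '' O ⊆ Set.range 𝒢.unit := by
    rw [← he]
    refine interior_maximal ?_ (h𝒢.isLocalHomeomorph_mul.isOpenMap _ hO)
    rintro _ ⟨⟨⟨g, h⟩, hp⟩, ⟨hg, hh⟩, rfl⟩
    have h1 := hUα g hg
    have h2 := hVα _ hh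
    rw [𝒢.src_inv, 𝒢.rng_inv] at h2
    simp only at hp
    simp only [compMul, Set.mem_ofPred_eq, 𝒢.src_mul, 𝒢.rng_mul]
    rw [← h1, ← h2, hp]
  have key : ∀ g ∈ U, ∀ h ∈ V, 𝒢.src g = 𝒢.src h → g = h := by
    intro g hg h hh hs
    obtain ⟨x, hx⟩ := hsub ⟨⟨(g, 𝒢.inv h), hs.trans (𝒢.rng_inv h).symm⟩,
      ⟨hg, by simpa [𝒢.inv_inv] using hh⟩, rfl⟩
    exact 𝒢.eq_of_mul_inv_eq_unit g h hs x hx.symm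
  ext g
  constructor
  · intro hg
    obtain ⟨h, hh, hs⟩ := hV.src_bijOn.surjOn (Set.mem_univ (𝒢.src g))
    exact key g hg h hh hs.symm ▸ hh
  · intro hg
    obtain ⟨h, hh, hs⟩ := hU.src_bijOn.surjOn (Set.mem_univ (𝒢.src g))
    exact key h hh g hg hs ▸ hh

/-- In an effective ample Hausdorff groupoid, `I(π_U) = [1_U]` for every full bisection `U`. -/
theorem indexMap_eq (h𝒢 : 𝒢.IsAmple) [T2Space G] (he : 𝒢.IsEffective) {U : Set G}
    (hU : 𝒢.IsFullBisection U) {α : X ≃ₜ X} (hα : 𝒢.Implements U α) :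
    indexMap h𝒢 ⟨α, U, hU, hα⟩ = bisectionClass h𝒢 hU := by
  have key : ∀ (V : Set G) (hV : 𝒢.IsFullBisection V), V = U →
      bisectionClass h𝒢 hV = bisectionClass h𝒢 hU := by
    rintro V hV rfl; rfl
  have hα' : α ∈ 𝒢.fullGroup := ⟨U, hU, hα⟩
  exact key _ _ (IsFullBisection.eq_of_implements h𝒢 he hα'.choose_spec.1 hU
    hα'.choose_spec.2 hα)

variable (𝒢)

/-- Property TR: the groupoid is an effective ample Hausdorff groupoid, and `𝒯(𝒢) = ker I`. -/
def HasPropertyTR : Prop :=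
  ∃ (h𝒢 : 𝒢.IsAmple) (_ : T2Space G), 𝒢.IsEffective ∧
    (𝒢.transpositionSubgroup : Set (X ≃ₜ X)) =
      {α | ∃ hα : α ∈ 𝒢.fullGroup, indexMap h𝒢 ⟨α, hα⟩ = 0}

end Top

end AlgGroupoid

namespace KatsuraExelPardo

section Construction

variable {N : ℕ}

/-- The edge `e_{i,j,n}`, `0 ≤ n < A_{i,j}`, of the graph `E_A`, with source `i` and range `j`. -/
@[ext]
structure Edge (A : Matrix (Fin N) (Fin N) ℕ) where
  src : Fin N
  tgt : Fin N
  idx : ℕ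
  idx_lt : idx < A src tgt

variable {A : Matrix (Fin N) (Fin N) ℕ} (B : Matrix (Fin N) (Fin N) ℤ)

/-- The edge `κ_m(e_{i,j,n}) = e_{i,j,r}`, where `m B_{i,j} + n = q A_{i,j} + r`, `0 ≤ r < A_{i,j}`. -/
def kappaEdge (m : ℤ) (e : Edge A) : Edge A where
  src := e.src
  tgt := e.tgt
  idx := ((m * B e.src e.tgt + e.idx) % (A e.src e.tgt : ℤ)).toNat
  idx_lt := by
    have hpos : (0 : ℤ) < A e.src e.tgt := by have := e.idx_lt; omega
    have h1 := Int.emod_nonneg (m * B e.src e.tgt + e.idx) hpos.ne'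
    have h2 := Int.emod_lt_of_pos (m * B e.src e.tgt + e.idx) hpos
    omega

/-- The integer `φ(m, e_{i,j,n}) = q`, where `m B_{i,j} + n = q A_{i,j} + r`, `0 ≤ r < A_{i,j}`. -/
def phiEdge (m : ℤ) (e : Edge A) : ℤ := (m * B e.src e.tgt + e.idx) / (A e.src e.tgt : ℤ)

theorem edge_division (m : ℤ) (e : Edge A) :
    m * B e.src e.tgt + e.idx = phiEdge B m e * A e.src e.tgt + (kappaEdge B m e).idx := by
  have hpos : (0 : ℤ) < A e.src e.tgt := by have := e.idx_lt; omega
  have h1 := Int.emod_nonneg (m * B e.src e.tgt + e.idx) hpos.ne'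
  have h2 := Int.mul_ediv_add_emod (m * B e.src e.tgt + e.idx) (A e.src e.tgt : ℤ)
  simp only [phiEdge, kappaEdge, Int.toNat_of_nonneg h1]
  linarith

theorem edge_unique (m : ℤ) (e : Edge A) (q : ℤ) (r : ℕ) (hr : r < A e.src e.tgt)
    (h : m * B e.src e.tgt + e.idx = q * A e.src e.tgt + r) :
    phiEdge B m e = q ∧ (kappaEdge B m e).idx = r := by
  have hpos : (0 : ℤ) < A e.src e.tgt := by have := e.idx_lt; omega
  have h1 : (r : ℤ) < A e.src e.tgt := by exact_mod_cast hr
  constructor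
  · simp only [phiEdge, h]
    rw [add_comm, Int.add_mul_ediv_right _ _ hpos.ne', Int.ediv_eq_zero_of_lt (by omega) h1, zero_add]
  · simp only [kappaEdge, h]
    rw [add_comm, Int.add_mul_emod_self_right, Int.emod_eq_of_lt (by omega) h1]
    rfl

theorem edge_cocycle (m n : ℤ) (e : Edge A) :
    phiEdge B (m + n) e = phiEdge B m (kappaEdge B n e) + phiEdge B n e ∧
      kappaEdge B (m + n) e = kappaEdge B m (kappaEdge B n e) := by
  have h1 := edge_division B n e
  have h2 := edge_division B m (kappaEdge B n e)
  have h := edge_unique B (m + n) e (phiEdge B m (kappaEdge B n e) + phiEdge B n e)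
    (kappaEdge B m (kappaEdge B n e)).idx (kappaEdge B m (kappaEdge B n e)).idx_lt (by
      have e1 : (kappaEdge B n e).src = e.src := rfl
      have e2 : (kappaEdge B n e).tgt = e.tgt := rfl
      rw [e1, e2] at h2
      linarith)
  exact ⟨h.1, Edge.ext rfl rfl h.2⟩

theorem edge_zero (e : Edge A) : phiEdge B 0 e = 0 ∧ kappaEdge B 0 e = e := by
  have h := edge_unique B 0 e 0 e.idx e.idx_lt (by ring)
  exact ⟨h.1, Edge.ext rfl rfl h.2⟩

/-- The infinite path space `E_A^∞`. -/
def InfPath (A : Matrix (Fin N) (Fin N) ℕ) : Type := {x : ℕ → Edge A // ∀ k, (x k).tgt = (x (k + 1)).src}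

/-- The edge set is discrete. -/
instance : TopologicalSpace (Edge A) := ⊥

/-- The topology induced from the product topology; the sets `Z(μ)` are a basis of it. -/
instance : TopologicalSpace (InfPath A) :=
  inferInstanceAs (TopologicalSpace {x : ℕ → Edge A // ∀ k, (x k).tgt = (x (k + 1)).src})

/-- The source vertex `s(x)` of an infinite path. -/
def InfPath.start (x : InfPath A) : Fin N := (x.1 0).src

/-- The infinite path with the first edge removed. -/
def InfPath.tail (x : InfPath A) : InfPath A := ⟨fun k => x.1 (k + 1), fun k => x.2 (k + 1)⟩

/-- The integer `φ(m, x|_k)`, where `x|_k` is the initial subpath of length `k`. -/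
def phiSeq (m : ℤ) (x : InfPath A) : ℕ → ℤ
  | 0 => m
  | k + 1 => phiEdge B (phiSeq m x k) (x.1 k)

/-- The action `κ_m(x) = κ_m(x₁) κ_{φ(m, x|₁)}(x₂) κ_{φ(m, x|₂)}(x₃) ⋯` on infinite paths. -/
def kappa (m : ℤ) (x : InfPath A) : InfPath A :=
  ⟨fun k => kappaEdge B (phiSeq B m x k) (x.1 k), fun k => x.2 k⟩

theorem kappa_tail (m : ℤ) (x : InfPath A) :
    (kappa B m x).tail = kappa B (phiEdge B m (x.1 0)) x.tail := by
  have h : ∀ k, phiSeq B m x (k + 1) = phiSeq B (phiEdge B m (x.1 0)) x.tail k := by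
    intro k
    induction k with
    | zero => rfl
    | succ k ih => rw [phiSeq, ih]; rfl
  apply Subtype.ext
  funext k
  change kappaEdge B (phiSeq B m x (k + 1)) _ = kappaEdge B _ _
  rw [h]
  rfl

theorem kappa_add (m n : ℤ) (x : InfPath A) :
    kappa B (m + n) x = kappa B m (kappa B n x) := by
  have h : ∀ k, phiSeq B (m + n) x k = phiSeq B m (kappa B n x) k + phiSeq B n x k := by
    intro k
    induction k with
    | zero => rfl
    | succ k ih =>
      rw [phiSeq, ih, (edge_cocycle B _ _ _).1]
      rfl
  apply Subtype.ext
  funext k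
  change kappaEdge B (phiSeq B (m + n) x k) _ = _
  rw [h, (edge_cocycle B _ _ _).2]
  rfl

theorem kappa_zero (x : InfPath A) : kappa B 0 x = x := by
  have h : ∀ k, phiSeq B 0 x k = 0 := by
    intro k
    induction k with
    | zero => rfl
    | succ k ih => rw [phiSeq, ih, (edge_zero B _).1]
  apply Subtype.ext
  funext k
  change kappaEdge B (phiSeq B 0 x k) _ = _
  rw [h, (edge_zero B _).2]

/-- The list of edges is a path from `i` to `j`. -/
def IsWalk (i : Fin N) : List (Edge A) → Fin N → Prop
  | [], j => i = j
  | e :: l, j => e.src = i ∧ IsWalk e.tgt l j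

theorem IsWalk.snoc {i j : Fin N} {l : List (Edge A)} (h : IsWalk i l j) (e : Edge A)
    (he : j = e.src) : IsWalk i (l ++ [e]) e.tgt := by
  induction l generalizing i with
  | nil => exact ⟨(h.trans he).symm, rfl⟩
  | cons a l ih => exact ⟨h.1, ih h.2⟩

/-- A finite path in `E_A`; the paths of length zero are the vertices. -/
structure FinPath (A : Matrix (Fin N) (Fin N) ℕ) where
  src : Fin N
  tgt : Fin N
  edges : List (Edge A)
  isWalk : IsWalk src edges tgt

def FinPath.length (μ : FinPath A) : ℕ := μ.edges.length

/-- The path of length zero at the vertex `i`. -/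
def FinPath.nil (i : Fin N) : FinPath A := ⟨i, i, [], rfl⟩

/-- The path `μ e`. -/
def FinPath.snoc (μ : FinPath A) (e : Edge A) (h : μ.tgt = e.src) : FinPath A :=
  ⟨μ.src, e.tgt, μ.edges ++ [e], μ.isWalk.snoc e h⟩

theorem FinPath.snoc_congr {μ : FinPath A} {e f : Edge A} (h : e = f) (he : μ.tgt = e.src)
    (hf : μ.tgt = f.src) : μ.snoc e he = μ.snoc f hf := by
  subst h; rfl

/-- The concatenation of a list with a sequence. -/
def prepend : List (Edge A) → (ℕ → Edge A) → ℕ → Edge A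
  | [], x, k => x k
  | e :: _, _, 0 => e
  | _ :: l, x, k + 1 => prepend l x k

theorem prepend_isPath {i j : Fin N} {l : List (Edge A)} (h : IsWalk i l j) {x : ℕ → Edge A}
    (hj : j = (x 0).src) (hx : ∀ k, (x k).tgt = (x (k + 1)).src) :
    (prepend l x 0).src = i ∧ ∀ k, (prepend l x k).tgt = (prepend l x (k + 1)).src := by
  induction l generalizing i with
  | nil => exact ⟨(h.trans hj).symm, hx⟩
  | cons e l ih =>
    refine ⟨h.1, fun k => ?_⟩
    cases k with
    | zero => exact (ih h.2).1.symm
    | succ k => exact (ih h.2).2 k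

theorem prepend_snoc (l : List (Edge A)) (x : ℕ → Edge A) :
    prepend (l ++ [x 0]) (fun k => x (k + 1)) = prepend l x := by
  induction l with
  | nil => funext k; cases k <;> rfl
  | cons e l ih =>
    funext k
    cases k with
    | zero => rfl
    | succ k => exact congrFun ih k

theorem prepend_inj {l l' : List (Edge A)} {x x' : ℕ → Edge A} (hl : l.length = l'.length)
    (h : prepend l x = prepend l' x') : l = l' ∧ x = x' := by
  induction l generalizing l' with
  | nil =>
    obtain rfl : l' = [] := List.length_eq_zero_iff.1 hl.symm
    exact ⟨rfl, h⟩
  | cons e l ih =>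
    cases l' with
    | nil => simp at hl
    | cons e' l' =>
      have h0 : e = e' := congrFun h 0
      have h1 := ih (l' := l') (by simpa using hl) (funext fun k => congrFun h (k + 1))
      exact ⟨by rw [h0, h1.1], h1.2⟩

/-- The infinite path `μ y`. -/
def FinPath.append (μ : FinPath A) (y : InfPath A) (h : μ.tgt = y.start) : InfPath A :=
  ⟨prepend μ.edges y.1, (prepend_isPath μ.isWalk h y.2).2⟩

theorem FinPath.append_inj {μ ν : FinPath A} {y z : InfPath A} (hμ : μ.tgt = y.start)
    (hν : ν.tgt = z.start) (hl : μ.length = ν.length) (h : μ.append y hμ = ν.append z hν) :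
    μ = ν ∧ y = z := by
  have h' : prepend μ.edges y.1 = prepend ν.edges z.1 := congrArg Subtype.val h
  obtain ⟨h1, h2⟩ := prepend_inj hl h'
  have h3 : y = z := Subtype.ext h2
  have h4 : μ.src = ν.src := by
    rw [← (prepend_isPath μ.isWalk hμ y.2).1, ← (prepend_isPath ν.isWalk hν z.2).1, h']
  have h5 : μ.tgt = ν.tgt := by rw [hμ, hν, h3]
  refine ⟨?_, h3⟩
  cases μ; cases ν
  simp only at h1 h4 h5
  subst h1 h4 h5
  rfl

/-- A quadruple `(μ, m, ν; x)` with `r(μ) = r(ν)` and `x ∈ Z(ν)`; the infinite path `x = ν y` is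
recorded by `y`. -/
@[ext]
structure Quad (A : Matrix (Fin N) (Fin N) ℕ) where
  mu : FinPath A
  m : ℤ
  nu : FinPath A
  y : InfPath A
  mu_tgt : mu.tgt = y.start
  nu_tgt : nu.tgt = y.start

namespace Quad

/-- The path `x = ν y`. -/
def source (a : Quad A) : InfPath A := a.nu.append a.y a.nu_tgt

/-- The path `μ κ_m(y)`. -/
def range (a : Quad A) : InfPath A := a.mu.append (kappa B a.m a.y) a.mu_tgt

/-- The basic move `(μ, m, ν; ν e z) ↦ (μ κ_m(e), φ(m, e), ν e; ν e z)`. -/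
def expand (a : Quad A) : Quad A where
  mu := a.mu.snoc (kappaEdge B a.m (a.y.1 0)) a.mu_tgt
  m := phiEdge B a.m (a.y.1 0)
  nu := a.nu.snoc (a.y.1 0) a.nu_tgt
  y := a.y.tail
  mu_tgt := a.y.2 0
  nu_tgt := a.y.2 0

theorem source_expand (a : Quad A) : (a.expand B).source = a.source :=
  Subtype.ext (prepend_snoc a.nu.edges a.y.1)

theorem range_expand (a : Quad A) : (a.expand B).range B = a.range B := by
  have h := prepend_snoc a.mu.edges (kappa B a.m a.y).1
  apply Subtype.ext
  refine Eq.trans ?_ h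
  change prepend _ (kappa B (phiEdge B a.m (a.y.1 0)) a.y.tail).1 = _
  rw [← kappa_tail]
  rfl

theorem length_mu_expand (a : Quad A) : (a.expand B).mu.length = a.mu.length + 1 := by
  simp [expand, FinPath.snoc, FinPath.length]

theorem length_nu_expand (a : Quad A) : (a.expand B).nu.length = a.nu.length + 1 := by
  simp [expand, FinPath.snoc, FinPath.length]

theorem length_iterate (k : ℕ) (a : Quad A) :
    ((expand B)^[k] a).mu.length = a.mu.length + k ∧
      ((expand B)^[k] a).nu.length = a.nu.length + k := by
  induction k with
  | zero => exact ⟨rfl, rfl⟩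
  | succ k ih =>
    rw [Function.iterate_succ_apply', length_mu_expand, length_nu_expand, ih.1, ih.2]
    exact ⟨by ring, by ring⟩

theorem source_iterate (k : ℕ) (a : Quad A) : ((expand B)^[k] a).source = a.source := by
  induction k with
  | zero => rfl
  | succ k ih => rw [Function.iterate_succ_apply', source_expand, ih]

theorem range_iterate (k : ℕ) (a : Quad A) : ((expand B)^[k] a).range B = a.range B := by
  induction k with
  | zero => rfl
  | succ k ih => rw [Function.iterate_succ_apply', range_expand, ih]

/-- The quadruple `(s(x), 0, s(x); x)`. -/
def unit (x : InfPath A) : Quad A where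
  mu := FinPath.nil x.start
  m := 0
  nu := FinPath.nil x.start
  y := x
  mu_tgt := rfl
  nu_tgt := rfl

/-- The quadruple `(μ, 0, μ; μ y)`. -/
def diag (μ : FinPath A) (y : InfPath A) (h : μ.tgt = y.start) : Quad A := ⟨μ, 0, μ, y, h, h⟩

/-- The quadruple `(ν, -m, μ; μ κ_m(y))`. -/
def inv (a : Quad A) : Quad A where
  mu := a.nu
  m := -a.m
  nu := a.mu
  y := kappa B a.m a.y
  mu_tgt := a.nu_tgt
  nu_tgt := a.mu_tgt

theorem inv_expand (a : Quad A) : (a.expand B).inv B = (a.inv B).expand B := by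
  have h := edge_cocycle B (-a.m) a.m (a.y.1 0)
  rw [neg_add_cancel, (edge_zero B _).1, (edge_zero B _).2] at h
  have h1 : -phiEdge B a.m (a.y.1 0) = phiEdge B (-a.m) (kappaEdge B a.m (a.y.1 0)) := by
    linarith [h.1]
  apply Quad.ext
  · exact FinPath.snoc_congr h.2 a.nu_tgt a.nu_tgt
  · exact h1
  · rfl
  · exact (kappa_tail B a.m a.y).symm

/-- The pair of quadruples is in the standard form `(λ, n, μ; μ κ_m(y))`, `(μ, m, ν; ν y)`. -/
structure Matched (a b : Quad A) : Prop where
  path : a.nu = b.mu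
  tail : a.y = kappa B b.m b.y

/-- The product `(λ, n + m, ν; ν y)` of two quadruples in standard form. -/
def comp (a b : Quad A) (h : Matched B a b) : Quad A where
  mu := a.mu
  m := a.m + b.m
  nu := b.nu
  y := b.y
  mu_tgt := by rw [a.mu_tgt, ← a.nu_tgt, h.path, b.mu_tgt]
  nu_tgt := b.nu_tgt

variable {B}

theorem Matched.source_eq {a b : Quad A} (h : Matched B a b) : a.source = b.range B := by
  apply Subtype.ext
  change prepend a.nu.edges a.y.1 = prepend b.mu.edges _
  rw [h.path, h.tail]

theorem Matched.expand {a b : Quad A} (h : Matched B a b) :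
    Matched B (a.expand B) (b.expand B) := by
  refine ⟨?_, ?_⟩
  · cases a; cases b; cases h
    simp only at *
    subst_vars
    rfl
  · change a.y.tail = kappa B (phiEdge B b.m (b.y.1 0)) b.y.tail
    rw [h.tail, kappa_tail]

theorem comp_expand {a b : Quad A} (h : Matched B a b) :
    comp B (a.expand B) (b.expand B) h.expand = (comp B a b h).expand B := by
  have h0 : a.y.1 0 = kappaEdge B b.m (b.y.1 0) := by rw [h.tail]; rfl
  have hc := edge_cocycle B a.m b.m (b.y.1 0)
  apply Quad.ext
  · exact FinPath.snoc_congr ((congrArg (kappaEdge B a.m) h0).trans hc.2.symm) a.mu_tgt (comp B a b h).mu_tgt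
  · change phiEdge B a.m (a.y.1 0) + phiEdge B b.m (b.y.1 0) = phiEdge B (a.m + b.m) (b.y.1 0)
    rw [hc.1, h0]
  · rfl
  · rfl

theorem Matched.iterate {a b : Quad A} (h : Matched B a b) (k : ℕ) :
    Matched B ((Quad.expand B)^[k] a) ((Quad.expand B)^[k] b) := by
  induction k with
  | zero => exact h
  | succ k ih =>
    rw [Function.iterate_succ_apply', Function.iterate_succ_apply']
    exact ih.expand

theorem comp_iterate {a b : Quad A} (h : Matched B a b) (k : ℕ) :
    comp B _ _ (h.iterate k) = (Quad.expand B)^[k] (comp B a b h) := by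
  induction k with
  | zero => rfl
  | succ k ih =>
    simp only [Function.iterate_succ_apply']
    rw [comp_expand (h.iterate k), ih]

theorem matched_of_length {a b : Quad A} (h : a.source = b.range B)
    (hl : a.nu.length = b.mu.length) : Matched B a b := by
  obtain ⟨h1, h2⟩ := FinPath.append_inj a.nu_tgt (z := kappa B b.m b.y) b.mu_tgt hl h
  exact ⟨h1, h2⟩

theorem matched_iterate {a b : Quad A} (h : a.source = b.range B) :
    Matched B ((Quad.expand B)^[b.mu.length] a) ((Quad.expand B)^[a.nu.length] b) := by
  apply matched_of_length
  · rw [source_iterate, range_iterate, h]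
  · rw [(length_iterate B _ a).2, (length_iterate B _ b).1, add_comm]

end Quad

end Construction

section Groupoid

variable {N : ℕ} (A : Matrix (Fin N) (Fin N) ℕ) (B : Matrix (Fin N) (Fin N) ℤ)

/-- The set of arrows of `𝒢_{A,B}`: quadruples modulo the equivalence relation generated by
`(μ, m, ν; x) ∼ (μ κ_m(e), φ(m, e), ν e; x)`. -/
def Arrow : Type := Quot fun a b : Quad A => b = a.expand B

variable {A}

/-- The class `[μ, m, ν; x]`. -/
def Arrow.mk (a : Quad A) : Arrow A B := Quot.mk _ a

variable {B}

theorem Arrow.mk_expand (a : Quad A) : Arrow.mk B (a.expand B) = Arrow.mk B a :=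
  (Quot.sound (r := fun a b : Quad A => b = a.expand B) rfl).symm

theorem Arrow.exists_mk (g : Arrow A B) : ∃ a, Arrow.mk B a = g := Quot.exists_rep g

theorem Arrow.mk_iterate (k : ℕ) (a : Quad A) :
    Arrow.mk B ((Quad.expand B)^[k] a) = Arrow.mk B a := by
  induction k with
  | zero => rfl
  | succ k ih =>
    rw [Function.iterate_succ_apply', Arrow.mk_expand, ih]

theorem Arrow.mk_eq_mk {a b : Quad A} :
    Arrow.mk B a = Arrow.mk B b ↔ ∃ j l, (Quad.expand B)^[j] a = (Quad.expand B)^[l] b := by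
  constructor
  · intro h
    have h' := Quot.eqvGen_exact h
    clear h
    induction h' with
    | rel a b h => exact ⟨1, 0, h.symm⟩
    | refl a => exact ⟨0, 0, rfl⟩
    | symm a b _ ih =>
      obtain ⟨j, l, h⟩ := ih
      exact ⟨l, j, h.symm⟩
    | trans a b c _ _ ih1 ih2 =>
      obtain ⟨j, l, e1⟩ := ih1
      obtain ⟨j', l', e2⟩ := ih2
      refine ⟨j' + j, l + l', ?_⟩
      rw [Function.iterate_add_apply, e1, ← Function.iterate_add_apply, add_comm j' l,
        Function.iterate_add_apply, e2, ← Function.iterate_add_apply]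
  · rintro ⟨j, l, h⟩
    rw [← Arrow.mk_iterate j a, h, Arrow.mk_iterate]

/-- `s([μ, m, ν; x]) = x`. -/
def Arrow.src (g : Arrow A B) : InfPath A :=
  Quot.lift Quad.source (by rintro a _ rfl; exact (a.source_expand B).symm) g

/-- `r([μ, m, ν; ν y]) = μ κ_m(y)`. -/
def Arrow.rng (g : Arrow A B) : InfPath A :=
  Quot.lift (Quad.range B) (by rintro a _ rfl; exact (a.range_expand B).symm) g

/-- `[μ, m, ν; ν y]⁻¹ = [ν, -m, μ; μ κ_m(y)]`. -/
def Arrow.inv (g : Arrow A B) : Arrow A B :=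
  Quot.lift (fun a => Arrow.mk B (a.inv B))
    (by rintro a _ rfl; rw [Quad.inv_expand, Arrow.mk_expand]) g

/-- Every composable pair has representatives in standard form. -/
theorem Arrow.exists_matched (g h : Arrow A B) (p : g.src = h.rng) :
    ∃ ab : Quad A × Quad A,
      Arrow.mk B ab.1 = g ∧ Arrow.mk B ab.2 = h ∧ Quad.Matched B ab.1 ab.2 := by
  obtain ⟨a, rfl⟩ := g.exists_mk
  obtain ⟨b, rfl⟩ := h.exists_mk
  exact ⟨⟨_, _⟩, Arrow.mk_iterate _ _, Arrow.mk_iterate _ _, Quad.matched_iterate p⟩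

/-- `[λ, n, μ; μ κ_m(y)] · [μ, m, ν; ν y] = [λ, n + m, ν; ν y]`. By `Arrow.mul_mk` the product does not
depend on the representatives. -/
noncomputable def Arrow.mul (g h : Arrow A B) (p : g.src = h.rng) : Arrow A B :=
  Arrow.mk B (Quad.comp B (Arrow.exists_matched g h p).choose.1 (Arrow.exists_matched g h p).choose.2
    (Arrow.exists_matched g h p).choose_spec.2.2)

theorem Arrow.mk_comp_congr {a b a' b' : Quad A} (h : Quad.Matched B a b)
    (h' : Quad.Matched B a' b') (ha : Arrow.mk B a = Arrow.mk B a')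
    (hb : Arrow.mk B b = Arrow.mk B b') :
    Arrow.mk B (Quad.comp B a b h) = Arrow.mk B (Quad.comp B a' b' h') := by
  obtain ⟨i, j, e⟩ := Arrow.mk_eq_mk.1 ha
  obtain ⟨i', j', e'⟩ := Arrow.mk_eq_mk.1 hb
  have l1 := congrArg (fun q : Quad A => q.nu.length) e
  have l2 := congrArg (fun q : Quad A => q.mu.length) e'
  simp only [(Quad.length_iterate B _ _).1, (Quad.length_iterate B _ _).2] at l1 l2
  rw [h.path, h'.path] at l1
  have hij : j + i' = j' + i := by omega
  have e1 : (Quad.expand B)^[i + i'] a = (Quad.expand B)^[j + i'] a' := by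
    rw [add_comm, Function.iterate_add_apply, e, ← Function.iterate_add_apply, add_comm]
  have e2 : (Quad.expand B)^[i + i'] b = (Quad.expand B)^[j + i'] b' := by
    rw [Function.iterate_add_apply, e', ← Function.iterate_add_apply, hij, add_comm]
  have key : ∀ (p q p' q' : Quad A) (hpq : Quad.Matched B p q) (hpq' : Quad.Matched B p' q'),
      p = p' → q = q' → Quad.comp B p q hpq = Quad.comp B p' q' hpq' := by
    rintro p q _ _ _ _ rfl rfl; rfl
  rw [← Arrow.mk_iterate (i + i') (Quad.comp B a b h),
    ← Arrow.mk_iterate (j + i') (Quad.comp B a' b' h'), ← Quad.comp_iterate h,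
    ← Quad.comp_iterate h', key _ _ _ _ (h.iterate (i + i')) (h'.iterate (j + i')) e1 e2]

theorem Arrow.mul_mk {a b : Quad A} (h : Quad.Matched B a b)
    (p : (Arrow.mk B a).src = (Arrow.mk B b).rng) :
    Arrow.mul (Arrow.mk B a) (Arrow.mk B b) p = Arrow.mk B (Quad.comp B a b h) :=
  Arrow.mk_comp_congr _ h (Arrow.exists_matched _ _ p).choose_spec.1
    (Arrow.exists_matched _ _ p).choose_spec.2.1

theorem Arrow.mul_eq {g h : Arrow A B} {a b : Quad A} (hg : Arrow.mk B a = g)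
    (hh : Arrow.mk B b = h) (hab : Quad.Matched B a b) (p : g.src = h.rng) :
    Arrow.mul g h p = Arrow.mk B (Quad.comp B a b hab) := by
  subst hg hh
  exact Arrow.mul_mk hab p

theorem Arrow.mk_diag (μ : FinPath A) (y : InfPath A) (h : μ.tgt = y.start) :
    Arrow.mk B (Quad.diag μ y h) = Arrow.mk B (Quad.unit (μ.append y h)) := by
  have key : ∀ k, ((Quad.expand B)^[k] (Quad.unit (μ.append y h))).m = 0 ∧
      ((Quad.expand B)^[k] (Quad.unit (μ.append y h))).mu =
        ((Quad.expand B)^[k] (Quad.unit (μ.append y h))).nu := by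
    intro k
    induction k with
    | zero => exact ⟨rfl, rfl⟩
    | succ k ih =>
      rw [Function.iterate_succ_apply']
      generalize (Quad.expand B)^[k] (Quad.unit (μ.append y h)) = q at ih
      obtain ⟨mu, m, nu, z, h1, h2⟩ := q
      obtain ⟨hm, hmn⟩ := ih
      simp only at hm hmn
      subst hm hmn
      exact ⟨(edge_zero B _).1, FinPath.snoc_congr (edge_zero B _).2 h1 h1⟩
  rw [← Arrow.mk_iterate μ.length (Quad.unit _)]
  obtain ⟨hm, hmn⟩ := key μ.length
  have hl := (Quad.length_iterate B μ.length (Quad.unit (μ.append y h))).2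
  have hs := Quad.source_iterate B μ.length (Quad.unit (μ.append y h))
  generalize (Quad.expand B)^[μ.length] (Quad.unit (μ.append y h)) = q at hm hmn hl hs
  obtain ⟨h1, h2⟩ := FinPath.append_inj (y := q.y) (z := y) q.nu_tgt h
    (hl.trans (zero_add _)) hs
  congr 1
  exact (Quad.ext (hmn.trans h1) hm h1 h2).symm

theorem Arrow.exists_matched_three (g h k : Arrow A B) (p : g.src = h.rng) (q : h.src = k.rng) :
    ∃ a b c : Quad A, Arrow.mk B a = g ∧ Arrow.mk B b = h ∧ Arrow.mk B c = k ∧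
      Quad.Matched B a b ∧ Quad.Matched B b c := by
  obtain ⟨⟨a, b⟩, ha, hb, hab⟩ := Arrow.exists_matched g h p
  obtain ⟨⟨b', c⟩, hb', hc, hbc⟩ := Arrow.exists_matched h k q
  obtain ⟨i, j, e⟩ := Arrow.mk_eq_mk.1 (hb.trans hb'.symm)
  refine ⟨_, _, _, (Arrow.mk_iterate i a).trans ha, (Arrow.mk_iterate i b).trans hb,
    (Arrow.mk_iterate j c).trans hc, hab.iterate i, ?_⟩
  rw [e]
  exact hbc.iterate j

variable (A B)

/-- The Katsura--Exel--Pardo groupoid `𝒢_{A,B}`, with unit space `E_A^∞`. -/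
noncomputable def groupoid : AlgGroupoid (Arrow A B) (InfPath A) where
  src := Arrow.src
  rng := Arrow.rng
  unit x := Arrow.mk B (Quad.unit x)
  inv := Arrow.inv
  mul := Arrow.mul
  src_unit x := rfl
  rng_unit x := kappa_zero B x
  src_inv g := by obtain ⟨a, rfl⟩ := g.exists_mk; rfl
  rng_inv g := by
    obtain ⟨a, rfl⟩ := g.exists_mk
    apply Subtype.ext
    change prepend a.nu.edges (kappa B (-a.m) (kappa B a.m a.y)).1 = _
    rw [← kappa_add, neg_add_cancel, kappa_zero]
    rfl
  src_mul g h p := by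
    obtain ⟨⟨a, b⟩, ha, hb, hab⟩ := Arrow.exists_matched g h p
    rw [Arrow.mul_eq ha hb hab, ← hb]
    rfl
  rng_mul g h p := by
    obtain ⟨⟨a, b⟩, ha, hb, hab⟩ := Arrow.exists_matched g h p
    rw [Arrow.mul_eq ha hb hab, ← ha]
    apply Subtype.ext
    change prepend a.mu.edges (kappa B (a.m + b.m) b.y).1 = prepend a.mu.edges (kappa B a.m a.y).1
    rw [kappa_add, hab.tail]
  mul_assoc g h k p q := by
    obtain ⟨a, b, c, ha, hb, hc, hab, hbc⟩ := Arrow.exists_matched_three g h k p q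
    have h1 : Quad.Matched B (Quad.comp B a b hab) c := ⟨hbc.path, hbc.tail⟩
    have h2 : Quad.Matched B a (Quad.comp B b c hbc) := by
      refine ⟨hab.path, ?_⟩
      change a.y = kappa B (b.m + c.m) c.y
      rw [hab.tail, hbc.tail, kappa_add]
    rw [Arrow.mul_eq (Arrow.mul_eq ha hb hab p).symm hc h1,
      Arrow.mul_eq ha (Arrow.mul_eq hb hc hbc q).symm h2]
    congr 1
    apply Quad.ext
    · rfl
    · exact add_assoc _ _ _
    · rfl
    · rfl
  unit_mul g := by
    obtain ⟨a, rfl⟩ := g.exists_mk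
    have he : Arrow.mk B (Quad.diag a.mu (kappa B a.m a.y) a.mu_tgt)
      = Arrow.mk B (Quad.unit (a.range B)) := Arrow.mk_diag _ _ _
    have hm : Quad.Matched B (Quad.diag a.mu (kappa B a.m a.y) a.mu_tgt) a := ⟨rfl, rfl⟩
    refine (Arrow.mul_eq he rfl hm _).trans ?_
    congr 1
    exact Quad.ext rfl (zero_add _) rfl rfl
  mul_unit g := by
    obtain ⟨a, rfl⟩ := g.exists_mk
    have he : Arrow.mk B (Quad.diag a.nu a.y a.nu_tgt) = Arrow.mk B (Quad.unit a.source) :=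
      Arrow.mk_diag _ _ _
    have hm : Quad.Matched B a (Quad.diag a.nu a.y a.nu_tgt) := ⟨rfl, (kappa_zero B a.y).symm⟩
    refine (Arrow.mul_eq rfl he hm _).trans ?_
    congr 1
    exact Quad.ext rfl (add_zero _) rfl rfl
  inv_mul g := by
    obtain ⟨a, rfl⟩ := g.exists_mk
    have hm : Quad.Matched B (a.inv B) a := ⟨rfl, rfl⟩
    refine (Arrow.mul_eq rfl rfl hm _).trans (Eq.trans ?_ (Arrow.mk_diag a.nu a.y a.nu_tgt))
    congr 1
    exact Quad.ext rfl (neg_add_cancel _) rfl rfl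
  mul_inv g := by
    obtain ⟨a, rfl⟩ := g.exists_mk
    have hm : Quad.Matched B a (a.inv B) := by
      refine ⟨rfl, ?_⟩
      change a.y = kappa B (-a.m) (kappa B a.m a.y)
      rw [← kappa_add, neg_add_cancel, kappa_zero]
    refine (Arrow.mul_eq rfl rfl hm _).trans
      (Eq.trans ?_ (Arrow.mk_diag a.mu (kappa B a.m a.y) a.mu_tgt))
    congr 1
    exact Quad.ext rfl (add_neg_cancel _) rfl rfl

/-- The set `Z(μ, m, ν) = {[μ, m, ν; x] | x ∈ Z(ν)}`. -/
def basicBisection (μ : FinPath A) (m : ℤ) (ν : FinPath A) : Set (Arrow A B) :=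
  {g | ∃ a : Quad A, a.mu = μ ∧ a.m = m ∧ a.nu = ν ∧ Arrow.mk B a = g}

/-- The topology of `𝒢_{A,B}`, generated by the sets `Z(μ, m, ν)`. -/
instance : TopologicalSpace (Arrow A B) :=
  TopologicalSpace.generateFrom {S | ∃ (μ : FinPath A) (m : ℤ) (ν : FinPath A),
    μ.tgt = ν.tgt ∧ S = basicBisection A B μ m ν}

variable {A B} in
/-- The map `c([μ, m, ν; x]) = |μ| - |ν|`. -/
def Arrow.degree (g : Arrow A B) : ℤ :=
  Quot.lift (fun a : Quad A => (a.mu.length : ℤ) - a.nu.length)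
    (by
      rintro a _ rfl
      simp only [Quad.length_mu_expand, Quad.length_nu_expand]
      push_cast
      ring) g

/-- The canonical cocycle `c : 𝒢_{A,B} → ℤ`. -/
def canonicalCocycle : (groupoid A B).IntHom where
  toFun := Arrow.degree
  map_mul g h p := by
    obtain ⟨⟨a, b⟩, ha, hb, hab⟩ := Arrow.exists_matched g h p
    refine (congrArg Arrow.degree (Arrow.mul_eq ha hb hab p)).trans ?_
    rw [← ha, ← hb]
    change (a.mu.length : ℤ) - b.nu.length
      = ((a.mu.length : ℤ) - a.nu.length) + ((b.mu.length : ℤ) - b.nu.length)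
    rw [show a.nu = b.mu from hab.path]
    ring

/-- The kernel `ℋ_{A,B} = ker c` of the canonical cocycle, with the topology induced from `𝒢_{A,B}`. -/
noncomputable def kernelGroupoid :
    AlgGroupoid {g : Arrow A B // (canonicalCocycle A B).toFun g = 0} (InfPath A) :=
  (canonicalCocycle A B).kernel

/-- The matrix has no zero rows and no zero columns. -/
def IsEssential : Prop :=
  (∀ i, ∃ j, A i j ≠ 0) ∧ (∀ j, ∃ i, A i j ≠ 0)

/-- The AH criteria for (finite) matrices: `𝒢_{A,B}` is Hausdorff, effective and minimal. -/
structure AHCriteria : Prop where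
  t2Space : T2Space (Arrow A B)
  isEffective : (groupoid A B).IsEffective
  isMinimal : (groupoid A B).IsMinimal

end Groupoid

end KatsuraExelPardo

/-! The inclusion of 𝒯 in ker I holds for every effective ample Hausdorff groupoid with compact unit
space. The index is additive, and 1_V̂ is the sum of 1_V + 1_{V⁻¹} - 1_{s(V)}, of 1_{s(V)} and of
the indicator of the remaining units; each summand is δ₂ of the indicator of an explicit set of
composable pairs.

For the converse, a full bisection U of ℋ_{A,B} is a disjoint union of sets Z(μ, m, ν) with |μ| =
|ν| = n, one for each path ν of length n. Thus π_U permutes the paths of length n, preserving their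
ranges, and acts on the tail behind ν by κ_{m(ν)} (`exists_actsAs`). Adding up the integers m(ν)
over the ν with a given range yields a weight in ℤ^N. Expanding all triples by one edge describes
the same U at level n + 1 and changes the weight by a fixed additive endomorphism of ℤ^N,
`weightExpand`.

The weight is controlled by the index. The boundary of the indicator of Z(λ, n, μ) × Z(μ, m, ν) has
weight m - (n + m) + n = 0, and every boundary is a combination of such boundaries
(`exists_realize_eq_boundaryTwo`). Formal combinations of triples that define the same function on
ℋ_{A,B} agree after finitely many expansions (`exists_iterate_expandMap_eq_zero`); this is where the
Hausdorff property enters. Hence [1_U] = 0 forces the weight of U to vanish at all sufficiently deep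
levels.

At such a level π_U is a permutation of finitely many paths with integer labels, and the labels sum
to zero at every vertex. Sorting the permutation and cancelling the labels with transpositions
coming from the sets Z(μ, m, ν) reduces it to the identity (`ActsAs.mem_transpositionSubgroup`). -/

set_option linter.unusedSectionVars false

/-! ### Indicators of compact open sets and their pushforwards. -/

section IndicatorFunctions

open Set Topology CompactlySupported

/-- The indicator function of a compact open set. -/
noncomputable def compactOpenIndicator {Y : Type*} [TopologicalSpace Y] [T2Space Y] {W : Set Y}
    (hW : IsOpen W ∧ IsCompact W) : C_c(Y, ℤ) where
  toFun := W.indicator 1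
  continuous_toFun := continuous_one.indicator (by
    rw [IsClopen.frontier_eq ⟨hW.2.isClosed, hW.1⟩]; simp)
  hasCompactSupport' := HasCompactSupport.intro hW.2 fun _ hx => Set.indicator_of_notMem hx _

/-- Injectivity on `W` leaves at most one nonzero term in each fibre sum. In this way homological
identities below turn into identities between sets of arrows. -/
theorem pushforward_compactOpenIndicator {Y Z : Type*} [TopologicalSpace Y] [TopologicalSpace Z]
    [T2Space Y] [T2Space Z] {f : Y → Z} (hf : IsLocalHomeomorph f) {W : Set Y}
    (hW : IsOpen W ∧ IsCompact W) (hinj : InjOn f W) (z : Z) :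
    pushforward f hf (compactOpenIndicator hW) z = (f '' W).indicator 1 z := by
  classical
  change ∑ᶠ y ∈ f ⁻¹' {z}, W.indicator (1 : Y → ℤ) y = _
  by_cases hz : z ∈ f '' W
  · rw [indicator_of_mem hz]
    obtain ⟨y, hy, rfl⟩ := hz
    have h1 : ∑ᶠ x ∈ f ⁻¹' {f y}, W.indicator (1 : Y → ℤ) x
        = ∑ᶠ x ∈ ({y} : Set Y), W.indicator (1 : Y → ℤ) x := by
      refine finsum_mem_inter_support_eq' _ _ _ fun x hx => ?_
      have hxW : x ∈ W := by
        by_contra hn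
        exact hx (indicator_of_notMem hn _)
      simp only [mem_preimage, mem_singleton_iff]
      exact ⟨fun h => hinj hxW hy h, fun h => h ▸ rfl⟩
    rw [h1, finsum_mem_singleton, indicator_of_mem hy]; rfl
  · rw [indicator_of_notMem hz]
    refine finsum_mem_eq_zero_of_forall_eq_zero fun y hy => indicator_of_notMem ?_ _
    exact fun hyW => hz ⟨y, hyW, hy⟩

end IndicatorFunctions

namespace AlgGroupoid

/-! ### The index map of an effective ample groupoid. -/

section Bisections

open Set Topology CompactlySupported

variable {G X : Type*} {𝒢 : AlgGroupoid G X}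

theorem inv_injective : Function.Injective 𝒢.inv :=
  fun g h e => by rw [← 𝒢.inv_inv g, e, 𝒢.inv_inv]

theorem mul_congr {g g' h h' : G} (hg : g = g') (hh : h = h') (p : 𝒢.src g = 𝒢.rng h) :
    𝒢.mul g h p = 𝒢.mul g' h' (by rw [← hg, ← hh, p]) := by
  subst hg hh; rfl

variable (𝒢) in
/-- The composable pairs in `P × Q`. -/
def pairs (P Q : Set G) : Set 𝒢.Comp := {p | p.1.1 ∈ P ∧ p.1.2 ∈ Q}

variable [TopologicalSpace G] [TopologicalSpace X]

theorem IsAmple.continuous_src (h𝒢 : 𝒢.IsAmple) : Continuous 𝒢.src :=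
  h𝒢.isLocalHomeomorph_src.continuous

theorem IsAmple.continuous_rng (h𝒢 : 𝒢.IsAmple) : Continuous 𝒢.rng :=
  h𝒢.isLocalHomeomorph_rng.continuous

theorem pairs_isOpen_isCompact (h𝒢 : 𝒢.IsAmple) {P Q : Set G} (hP : IsOpen P ∧ IsCompact P)
    (hQ : IsOpen Q ∧ IsCompact Q) : IsOpen (𝒢.pairs P Q) ∧ IsCompact (𝒢.pairs P Q) := by
  have := h𝒢.t2Space_unit
  refine ⟨(hP.1.preimage (by fun_prop)).inter (hQ.1.preimage (by fun_prop)), ?_⟩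
  have hc : IsClosed {p : G × G | 𝒢.src p.1 = 𝒢.rng p.2} :=
    isClosed_eq (h𝒢.continuous_src.comp continuous_fst) (h𝒢.continuous_rng.comp continuous_snd)
  exact hc.isClosedEmbedding_subtypeVal.isCompact_preimage (hP.2.prod hQ.2)

/-- As `src` is injective on `P`, a composable pair is determined by its second entry; the
injectivity of `src` and `rng` on `Q` recovers that entry from the product and from the first entry.
So all three face maps are injective on `pairs P Q`. -/
theorem boundaryTwo_pairs (h𝒢 : 𝒢.IsAmple) [T2Space G] {P Q : Set G}
    (hW : IsOpen (𝒢.pairs P Q) ∧ IsCompact (𝒢.pairs P Q)) (hP : InjOn 𝒢.src P)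
    (hQs : InjOn 𝒢.src Q) (hQr : InjOn 𝒢.rng Q) (g : G) :
    boundaryTwo h𝒢 (compactOpenIndicator hW) g
      = ((fun p : 𝒢.Comp => p.1.2) '' 𝒢.pairs P Q).indicator 1 g
        - (𝒢.compMul '' 𝒢.pairs P Q).indicator 1 g
        + ((fun p : 𝒢.Comp => p.1.1) '' 𝒢.pairs P Q).indicator 1 g := by
  have key : ∀ p ∈ 𝒢.pairs P Q, ∀ q ∈ 𝒢.pairs P Q, p.1.2 = q.1.2 → p = q := by
    rintro p hp q hq h
    refine Subtype.ext (Prod.ext (hP hp.1 hq.1 ?_) h)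
    rw [p.2, q.2, h]
  change pushforward (fun p : 𝒢.Comp => p.1.2) h𝒢.isLocalHomeomorph_snd (compactOpenIndicator hW) g
    - pushforward 𝒢.compMul h𝒢.isLocalHomeomorph_mul (compactOpenIndicator hW) g
    + pushforward (fun p : 𝒢.Comp => p.1.1) h𝒢.isLocalHomeomorph_fst (compactOpenIndicator hW) g = _
  rw [pushforward_compactOpenIndicator _ hW fun p hp q hq h => key p hp q hq h,
    pushforward_compactOpenIndicator _ hW fun p hp q hq h => key p hp q hq ?_,
    pushforward_compactOpenIndicator _ hW fun p hp q hq h => key p hp q hq ?_]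
  · refine hQr hp.2 hq.2 ?_
    rw [← p.2, ← q.2]
    exact congrArg 𝒢.src h
  · refine hQs hp.2 hq.2 ?_
    rw [← 𝒢.src_mul _ _ p.2, ← 𝒢.src_mul _ _ q.2]
    exact congrArg 𝒢.src h

theorem IsFullBisection.open_compact {U : Set G} (hU : 𝒢.IsFullBisection U) :
    IsOpen U ∧ IsCompact U := ⟨hU.isOpen, hU.isCompact⟩

/-- The product of two full bisections is a full bisection. -/
theorem IsFullBisection.mul (h𝒢 : 𝒢.IsAmple) {U V : Set G} (hU : 𝒢.IsFullBisection U)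
    (hV : 𝒢.IsFullBisection V) : 𝒢.IsFullBisection (𝒢.compMul '' 𝒢.pairs U V) := by
  have hW := pairs_isOpen_isCompact h𝒢 hU.open_compact hV.open_compact
  refine ⟨h𝒢.isLocalHomeomorph_mul.isOpenMap _ hW.1, hW.2.image h𝒢.continuous_mul,
    ⟨fun _ _ => mem_univ _, ?_, ?_⟩, ⟨fun _ _ => mem_univ _, ?_, ?_⟩⟩
  · rintro _ ⟨p, hp, rfl⟩ _ ⟨q, hq, rfl⟩ h
    simp only [compMul, 𝒢.src_mul] at h
    have h2 := hV.src_bijOn.injOn hp.2 hq.2 h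
    have h1 := hU.src_bijOn.injOn hp.1 hq.1 (by rw [p.2, q.2, h2])
    exact mul_congr h1 h2 _
  · intro x _
    obtain ⟨h, hh, rfl⟩ := hV.src_bijOn.surjOn (mem_univ x)
    obtain ⟨g, hg, hgh⟩ := hU.src_bijOn.surjOn (mem_univ (𝒢.rng h))
    exact ⟨_, ⟨⟨(g, h), hgh⟩, ⟨hg, hh⟩, rfl⟩, 𝒢.src_mul _ _ _⟩
  · rintro _ ⟨p, hp, rfl⟩ _ ⟨q, hq, rfl⟩ h
    simp only [compMul, 𝒢.rng_mul] at h
    have h1 := hU.rng_bijOn.injOn hp.1 hq.1 h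
    have h2 := hV.rng_bijOn.injOn hp.2 hq.2 (by rw [← p.2, ← q.2, h1])
    exact mul_congr h1 h2 _
  · intro x _
    obtain ⟨g, hg, rfl⟩ := hU.rng_bijOn.surjOn (mem_univ x)
    obtain ⟨h, hh, hgh⟩ := hV.rng_bijOn.surjOn (mem_univ (𝒢.src g))
    exact ⟨_, ⟨⟨(g, h), hgh.symm⟩, ⟨hg, hh⟩, rfl⟩, 𝒢.rng_mul _ _ _⟩

theorem Implements.mul {U V : Set G} {α β : X ≃ₜ X} (hα : 𝒢.Implements U α)
    (hβ : 𝒢.Implements V β) : 𝒢.Implements (𝒢.compMul '' 𝒢.pairs U V) (α * β) := by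
  rintro _ ⟨p, hp, rfl⟩
  change α (β _) = _
  rw [compMul, 𝒢.src_mul, 𝒢.rng_mul, hβ _ hp.2, ← p.2, hα _ hp.1]

theorem inv_image_isOpen_isCompact (h𝒢 : 𝒢.IsAmple) {V : Set G} (hV : IsOpen V ∧ IsCompact V) :
    IsOpen (𝒢.inv '' V) ∧ IsCompact (𝒢.inv '' V) := by
  refine ⟨?_, hV.2.image h𝒢.continuous_inv⟩
  rw [image_eq_preimage_of_inverse 𝒢.inv_inv 𝒢.inv_inv]
  exact hV.1.preimage h𝒢.continuous_inv

theorem IsFullBisection.inv (h𝒢 : 𝒢.IsAmple) {U : Set G} (hU : 𝒢.IsFullBisection U) :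
    𝒢.IsFullBisection (𝒢.inv '' U) := by
  obtain ⟨ho, hc⟩ := inv_image_isOpen_isCompact h𝒢 hU.open_compact
  refine ⟨ho, hc, ⟨fun _ _ => mem_univ _, ?_, ?_⟩, ⟨fun _ _ => mem_univ _, ?_, ?_⟩⟩
  · rintro _ ⟨p, hp, rfl⟩ _ ⟨q, hq, rfl⟩ h
    rw [𝒢.src_inv, 𝒢.src_inv] at h
    rw [hU.rng_bijOn.injOn hp hq h]
  · intro x _
    obtain ⟨g, hg, rfl⟩ := hU.rng_bijOn.surjOn (mem_univ x)
    exact ⟨_, ⟨g, hg, rfl⟩, 𝒢.src_inv g⟩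
  · rintro _ ⟨p, hp, rfl⟩ _ ⟨q, hq, rfl⟩ h
    rw [𝒢.rng_inv, 𝒢.rng_inv] at h
    rw [hU.src_bijOn.injOn hp hq h]
  · intro x _
    obtain ⟨g, hg, rfl⟩ := hU.src_bijOn.surjOn (mem_univ x)
    exact ⟨_, ⟨g, hg, rfl⟩, 𝒢.rng_inv g⟩

theorem Implements.inv {U : Set G} {α : X ≃ₜ X} (hα : 𝒢.Implements U α) :
    𝒢.Implements (𝒢.inv '' U) α⁻¹ := by
  rintro _ ⟨g, hg, rfl⟩
  rw [𝒢.src_inv, 𝒢.rng_inv, ← hα g hg]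
  exact α.symm_apply_apply _

theorem isFullBisection_range_unit (h𝒢 : 𝒢.IsAmple) (he : 𝒢.IsEffective) [CompactSpace X] :
    𝒢.IsFullBisection (range 𝒢.unit) := by
  refine ⟨he ▸ isOpen_interior, isCompact_range h𝒢.continuous_unit,
    ⟨fun _ _ => mem_univ _, ?_, fun x _ => ⟨_, ⟨x, rfl⟩, 𝒢.src_unit x⟩⟩,
    ⟨fun _ _ => mem_univ _, ?_, fun x _ => ⟨_, ⟨x, rfl⟩, 𝒢.rng_unit x⟩⟩⟩
  · rintro _ ⟨x, rfl⟩ _ ⟨y, rfl⟩ h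
    rw [𝒢.src_unit, 𝒢.src_unit] at h
    rw [h]
  · rintro _ ⟨x, rfl⟩ _ ⟨y, rfl⟩ h
    rw [𝒢.rng_unit, 𝒢.rng_unit] at h
    rw [h]

theorem implements_range_unit : 𝒢.Implements (range 𝒢.unit) (1 : X ≃ₜ X) := by
  rintro _ ⟨x, rfl⟩
  rw [𝒢.src_unit, 𝒢.rng_unit]
  rfl

/-- The homeomorphism `r ∘ (s|_U)⁻¹` of a full bisection. -/
theorem IsFullBisection.exists_implements (h𝒢 : 𝒢.IsAmple) {U : Set G}
    (hU : 𝒢.IsFullBisection U) : ∃ α : X ≃ₜ X, 𝒢.Implements U α := by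
  have hom : ∀ f : G → X, IsLocalHomeomorph f → BijOn f U univ → ∃ e : U ≃ₜ X, ∀ u, e u = f u := by
    intro f hf hb
    have hbij : Function.Bijective (U.domRestrict f) := by
      constructor
      · intro a b h
        exact Subtype.ext (hb.injOn a.2 b.2 h)
      · intro x
        obtain ⟨g, hg, h⟩ := hb.surjOn (mem_univ x)
        exact ⟨⟨g, hg⟩, h⟩
    exact ⟨(Equiv.ofBijective _ hbij).toHomeomorphOfContinuousOpen
      (hf.continuous.comp continuous_subtype_val) (hf.isOpenMap.domRestrict hU.isOpen), fun _ => rfl⟩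
  obtain ⟨e, he⟩ := hom _ h𝒢.isLocalHomeomorph_src hU.src_bijOn
  obtain ⟨f, hf⟩ := hom _ h𝒢.isLocalHomeomorph_rng hU.rng_bijOn
  refine ⟨e.symm.trans f, fun g hg => ?_⟩
  change f (e.symm _) = _
  rw [← he ⟨g, hg⟩, e.symm_apply_apply, hf]

theorem bisectionClass_eq_zero_iff (h𝒢 : 𝒢.IsAmple) [T2Space G] {U : Set G}
    (hU : 𝒢.IsFullBisection U) :
    bisectionClass h𝒢 hU = 0 ↔ ∃ f, ∀ g, boundaryTwo h𝒢 f g = U.indicator 1 g := by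
  rw [bisectionClass, QuotientAddGroup.eq_zero_iff, AddSubgroup.mem_addSubgroupOf]
  constructor
  · rintro ⟨f, hf⟩
    exact ⟨f, fun g => DFunLike.congr_fun hf g⟩
  · rintro ⟨f, hf⟩
    exact ⟨f, DFunLike.ext _ _ hf⟩

theorem snd_image_pairs {P Q : Set G} (h : 𝒢.rng '' Q ⊆ 𝒢.src '' P) :
    (fun p : 𝒢.Comp => p.1.2) '' 𝒢.pairs P Q = Q := by
  ext g
  constructor
  · rintro ⟨p, hp, rfl⟩
    exact hp.2
  · intro hg
    obtain ⟨k, hk, e⟩ := h ⟨g, hg, rfl⟩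
    exact ⟨⟨(k, g), e⟩, ⟨hk, hg⟩, rfl⟩

theorem fst_image_pairs {P Q : Set G} (h : 𝒢.src '' P ⊆ 𝒢.rng '' Q) :
    (fun p : 𝒢.Comp => p.1.1) '' 𝒢.pairs P Q = P := by
  ext g
  constructor
  · rintro ⟨p, hp, rfl⟩
    exact hp.1
  · intro hg
    obtain ⟨k, hk, e⟩ := h ⟨g, hg, rfl⟩
    exact ⟨⟨(g, k), e.symm⟩, ⟨hg, hk⟩, rfl⟩

/-- The index of a product is the sum of the indices. -/
theorem bisectionClass_mul (h𝒢 : 𝒢.IsAmple) [T2Space G] {U V : Set G}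
    (hU : 𝒢.IsFullBisection U) (hV : 𝒢.IsFullBisection V) :
    bisectionClass h𝒢 (hU.mul h𝒢 hV) = bisectionClass h𝒢 hU + bisectionClass h𝒢 hV := by
  rw [bisectionClass, bisectionClass, bisectionClass, ← QuotientAddGroup.mk_add,
    QuotientAddGroup.eq, AddSubgroup.mem_addSubgroupOf]
  -- Both projections of `pairs U V` are onto because the bisections are full, so its boundary is
  -- 1_V - 1_{UV} + 1_U.
  refine ⟨compactOpenIndicator (pairs_isOpen_isCompact h𝒢 hU.open_compact hV.open_compact), ?_⟩
  ext g
  rw [boundaryTwo_pairs h𝒢 _ hU.src_bijOn.injOn hV.src_bijOn.injOn hV.rng_bijOn.injOn,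
    snd_image_pairs (by rw [hU.src_bijOn.image_eq]; exact subset_univ _),
    fst_image_pairs (by rw [hV.rng_bijOn.image_eq]; exact subset_univ _)]
  change _ = -((𝒢.compMul '' 𝒢.pairs U V).indicator (1 : G → ℤ) g)
    + (U.indicator (1 : G → ℤ) g + V.indicator (1 : G → ℤ) g)
  ring

theorem bisectionClass_congr (h𝒢 : 𝒢.IsAmple) [T2Space G] {U V : Set G}
    (hU : 𝒢.IsFullBisection U) (hV : 𝒢.IsFullBisection V) (h : U = V) :
    bisectionClass h𝒢 hU = bisectionClass h𝒢 hV := by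
  subst h; rfl

/-- The product of the unit bisection with itself implements the identity, hence equals the unit
bisection by effectiveness. Its class c therefore satisfies c = c + c. -/
theorem bisectionClass_range_unit (h𝒢 : 𝒢.IsAmple) [T2Space G] (he : 𝒢.IsEffective)
    [CompactSpace X] : bisectionClass h𝒢 (isFullBisection_range_unit h𝒢 he) = 0 := by
  have hu := isFullBisection_range_unit h𝒢 he
  have h := bisectionClass_mul h𝒢 hu hu
  have h2 : 𝒢.compMul '' 𝒢.pairs (range 𝒢.unit) (range 𝒢.unit) = range 𝒢.unit :=
    IsFullBisection.eq_of_implements h𝒢 he (hu.mul h𝒢 hu) hu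
      (Implements.mul implements_range_unit implements_range_unit)
      (by rw [one_mul]; exact implements_range_unit)
  rw [bisectionClass_congr h𝒢 _ hu h2] at h
  exact left_eq_add.1 h

/-! ### Transpositions have index zero. -/

section Transpositions

theorem hat_src_image (V : Set G) : 𝒢.src '' 𝒢.hat V = univ := by
  refine eq_univ_of_forall fun x => ?_
  by_cases h : x ∈ 𝒢.src '' V ∪ 𝒢.rng '' V
  · rcases h with ⟨g, hg, rfl⟩ | ⟨g, hg, rfl⟩
    · exact ⟨g, Or.inl (Or.inl hg), rfl⟩
    · exact ⟨_, Or.inl (Or.inr ⟨g, hg, rfl⟩), 𝒢.src_inv g⟩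
  · exact ⟨_, Or.inr ⟨x, h, rfl⟩, 𝒢.src_unit x⟩

/-- This symmetry transfers bijectivity on V̂ from `src` to `rng`. -/
theorem inv_mem_hat {V : Set G} {g : G} (hg : g ∈ 𝒢.hat V) : 𝒢.inv g ∈ 𝒢.hat V := by
  rcases hg with (hg | ⟨h, hh, rfl⟩) | ⟨x, hx, rfl⟩
  · exact Or.inl (Or.inr ⟨g, hg, rfl⟩)
  · rw [𝒢.inv_inv]
    exact Or.inl (Or.inl hh)
  · rw [𝒢.inv_unit]
    exact Or.inr ⟨x, hx, rfl⟩

/-- The three pieces of V̂ have the disjoint sources s(V), r(V) and the complement of their union,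
and `src` is injective on each piece. -/
theorem injOn_src_hat {V : Set G} (hs : InjOn 𝒢.src V) (hr : InjOn 𝒢.rng V)
    (hd : Disjoint (𝒢.src '' V) (𝒢.rng '' V)) : InjOn 𝒢.src (𝒢.hat V) := by
  have hd' := disjoint_left.1 hd
  rintro a ((ha | ⟨a, ha, rfl⟩) | ⟨x, hx, rfl⟩) b ((hb | ⟨b, hb, rfl⟩) | ⟨y, hy, rfl⟩) h
  · exact hs ha hb h
  · rw [𝒢.src_inv] at h
    exact (hd' ⟨a, ha, rfl⟩ ⟨b, hb, h.symm⟩).elim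
  · rw [𝒢.src_unit] at h
    exact (hy (Or.inl ⟨a, ha, h⟩)).elim
  · rw [𝒢.src_inv] at h
    exact (hd' ⟨b, hb, rfl⟩ ⟨a, ha, h⟩).elim
  · rw [𝒢.src_inv, 𝒢.src_inv] at h
    rw [hr ha hb h]
  · rw [𝒢.src_unit, 𝒢.src_inv] at h
    exact (hy (Or.inr ⟨a, ha, h⟩)).elim
  · rw [𝒢.src_unit] at h
    exact (hx (Or.inl ⟨b, hb, h.symm⟩)).elim
  · rw [𝒢.src_unit, 𝒢.src_inv] at h
    exact (hx (Or.inr ⟨b, hb, h.symm⟩)).elim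
  · rw [𝒢.src_unit, 𝒢.src_unit] at h
    rw [h]

/-- Effectiveness makes the set of units open, since it is then an interior. -/
theorem unit_image_isOpen_isCompact (h𝒢 : 𝒢.IsAmple) (he : 𝒢.IsEffective) {O : Set X}
    (hO : IsOpen O ∧ IsCompact O) : IsOpen (𝒢.unit '' O) ∧ IsCompact (𝒢.unit '' O) := by
  refine ⟨?_, hO.2.image h𝒢.continuous_unit⟩
  have h : 𝒢.unit '' O = range 𝒢.unit ∩ 𝒢.src ⁻¹' O := by
    ext g
    constructor
    · rintro ⟨x, hx, rfl⟩
      exact ⟨⟨x, rfl⟩, by rwa [mem_preimage, 𝒢.src_unit]⟩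
    · rintro ⟨⟨x, rfl⟩, hx⟩
      rw [mem_preimage, 𝒢.src_unit] at hx
      exact ⟨x, hx, rfl⟩
  rw [h, ← he]
  exact isOpen_interior.inter (hO.1.preimage h𝒢.continuous_src)

theorem compl_isOpen_isCompact (h𝒢 : 𝒢.IsAmple) [CompactSpace X] {V : Set G}
    (hV : IsOpen V ∧ IsCompact V) :
    IsOpen (𝒢.src '' V ∪ 𝒢.rng '' V)ᶜ ∧ IsCompact (𝒢.src '' V ∪ 𝒢.rng '' V)ᶜ := by
  have := h𝒢.t2Space_unit
  have h1 : IsCompact (𝒢.src '' V ∪ 𝒢.rng '' V) :=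
    (hV.2.image h𝒢.continuous_src).union (hV.2.image h𝒢.continuous_rng)
  have h2 : IsOpen (𝒢.src '' V ∪ 𝒢.rng '' V) :=
    (h𝒢.isLocalHomeomorph_src.isOpenMap _ hV.1).union (h𝒢.isLocalHomeomorph_rng.isOpenMap _ hV.1)
  exact ⟨h1.isClosed.isOpen_compl, h2.isClosed_compl.isCompact⟩

theorem isFullBisection_hat (h𝒢 : 𝒢.IsAmple) (he : 𝒢.IsEffective) [CompactSpace X] {V : Set G}
    (hV : IsOpen V ∧ IsCompact V) (hs : InjOn 𝒢.src V) (hr : InjOn 𝒢.rng V)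
    (hd : Disjoint (𝒢.src '' V) (𝒢.rng '' V)) : 𝒢.IsFullBisection (𝒢.hat V) := by
  have h1 := inv_image_isOpen_isCompact h𝒢 hV
  have h2 := unit_image_isOpen_isCompact h𝒢 he (compl_isOpen_isCompact h𝒢 hV)
  have hinj := injOn_src_hat hs hr hd
  refine ⟨(hV.1.union h1.1).union h2.1, (hV.2.union h1.2).union h2.2,
    ⟨fun _ _ => mem_univ _, hinj, (hat_src_image V).ge⟩, ⟨fun _ _ => mem_univ _, ?_, ?_⟩⟩
  · intro a ha b hb h
    refine inv_injective (hinj (inv_mem_hat ha) (inv_mem_hat hb) ?_)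
    rw [𝒢.src_inv, 𝒢.src_inv, h]
  · intro x _
    obtain ⟨g, hg, hx⟩ := (hat_src_image (𝒢 := 𝒢) V).ge (mem_univ x)
    exact ⟨_, inv_mem_hat hg, by rw [𝒢.rng_inv, hx]⟩

/-- A set of units is idempotent, so the boundary of its composable pairs is 1_O - 1_O + 1_O. -/
theorem exists_boundaryTwo_eq_unit (h𝒢 : 𝒢.IsAmple) [T2Space G] (he : 𝒢.IsEffective) {O : Set X}
    (hO : IsOpen O ∧ IsCompact O) :
    ∃ f, ∀ g, boundaryTwo h𝒢 f g = (𝒢.unit '' O).indicator 1 g := by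
  have hu := unit_image_isOpen_isCompact h𝒢 he hO
  have hs : 𝒢.src '' (𝒢.unit '' O) = O := by
    rw [image_image]
    simp only [𝒢.src_unit, image_id']
  have hr : 𝒢.rng '' (𝒢.unit '' O) = O := by
    rw [image_image]
    simp only [𝒢.rng_unit, image_id']
  refine ⟨compactOpenIndicator (pairs_isOpen_isCompact h𝒢 hu hu), fun g => ?_⟩
  have i1 : InjOn 𝒢.src (𝒢.unit '' O) := by
    rintro _ ⟨x, _, rfl⟩ _ ⟨y, _, rfl⟩ h
    rw [𝒢.src_unit, 𝒢.src_unit] at h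
    rw [h]
  have i2 : InjOn 𝒢.rng (𝒢.unit '' O) := by
    rintro _ ⟨x, _, rfl⟩ _ ⟨y, _, rfl⟩ h
    rw [𝒢.rng_unit, 𝒢.rng_unit] at h
    rw [h]
  have hm : 𝒢.compMul '' 𝒢.pairs (𝒢.unit '' O) (𝒢.unit '' O) = 𝒢.unit '' O := by
    have hxx : ∀ x (p), 𝒢.mul (𝒢.unit x) (𝒢.unit x) p = 𝒢.unit x := by
      intro x p
      have h := 𝒢.mul_unit (𝒢.unit x)
      rwa [mul_congr rfl (by rw [𝒢.src_unit] : 𝒢.unit (𝒢.src (𝒢.unit x)) = 𝒢.unit x)] at h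
    ext g
    constructor
    · rintro ⟨⟨⟨_, _⟩, hp⟩, ⟨⟨x, hx, rfl⟩, ⟨y, hy, rfl⟩⟩, rfl⟩
      have hp' : x = y := by
        have := hp
        simp only [𝒢.src_unit, 𝒢.rng_unit] at this
        exact this
      subst hp'
      exact ⟨x, hx, (hxx x _).symm⟩
    · rintro ⟨x, hx, rfl⟩
      exact ⟨⟨(𝒢.unit x, 𝒢.unit x), by rw [𝒢.src_unit, 𝒢.rng_unit]⟩, ⟨⟨x, hx, rfl⟩, ⟨x, hx, rfl⟩⟩,
        hxx x _⟩
  rw [boundaryTwo_pairs h𝒢 _ i1 i1 i2, snd_image_pairs (by rw [hs, hr]),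
    fst_image_pairs (by rw [hs, hr]), hm]
  ring

/-- This is the boundary of the composable pairs in V⁻¹ × V, because V⁻¹V consists of the units at
s(V). -/
theorem exists_boundaryTwo_eq_inv (h𝒢 : 𝒢.IsAmple) [T2Space G] {V : Set G}
    (hV : IsOpen V ∧ IsCompact V) (hs : InjOn 𝒢.src V) (hr : InjOn 𝒢.rng V) :
    ∃ f, ∀ g, boundaryTwo h𝒢 f g = V.indicator 1 g - (𝒢.unit '' (𝒢.src '' V)).indicator 1 g
      + (𝒢.inv '' V).indicator 1 g := by
  have hi := inv_image_isOpen_isCompact h𝒢 hV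
  have e : 𝒢.src '' (𝒢.inv '' V) = 𝒢.rng '' V := by
    rw [image_image]
    simp only [𝒢.src_inv]
  refine ⟨compactOpenIndicator (pairs_isOpen_isCompact h𝒢 hi hV), fun g => ?_⟩
  have i1 : InjOn 𝒢.src (𝒢.inv '' V) := by
    rintro _ ⟨x, hx, rfl⟩ _ ⟨y, hy, rfl⟩ h
    rw [𝒢.src_inv, 𝒢.src_inv] at h
    rw [hr hx hy h]
  have hm : 𝒢.compMul '' 𝒢.pairs (𝒢.inv '' V) V = 𝒢.unit '' (𝒢.src '' V) := by
    ext g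
    constructor
    · rintro ⟨⟨⟨_, v⟩, hp⟩, ⟨⟨w, hw, rfl⟩, hv⟩, rfl⟩
      have hwv : w = v := hr hw hv (by rw [← 𝒢.src_inv]; exact hp)
      subst hwv
      exact ⟨_, ⟨w, hw, rfl⟩, (𝒢.inv_mul w).symm⟩
    · rintro ⟨_, ⟨v, hv, rfl⟩, rfl⟩
      exact ⟨⟨(𝒢.inv v, v), 𝒢.src_inv v⟩, ⟨⟨v, hv, rfl⟩, hv⟩, 𝒢.inv_mul v⟩
  rw [boundaryTwo_pairs h𝒢 _ i1 hs hr, snd_image_pairs e.ge, fst_image_pairs e.le, hm]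

theorem bisectionClass_hat (h𝒢 : 𝒢.IsAmple) [T2Space G] (he : 𝒢.IsEffective) [CompactSpace X]
    {V : Set G} (hV : IsOpen V ∧ IsCompact V) (hs : InjOn 𝒢.src V) (hr : InjOn 𝒢.rng V)
    (hd : Disjoint (𝒢.src '' V) (𝒢.rng '' V)) :
    bisectionClass h𝒢 (isFullBisection_hat h𝒢 he hV hs hr hd) = 0 := by
  rw [bisectionClass_eq_zero_iff]
  have hsV : IsOpen (𝒢.src '' V) ∧ IsCompact (𝒢.src '' V) :=
    ⟨h𝒢.isLocalHomeomorph_src.isOpenMap _ hV.1, hV.2.image h𝒢.continuous_src⟩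
  obtain ⟨f1, h1⟩ := exists_boundaryTwo_eq_inv h𝒢 hV hs hr
  obtain ⟨f2, h2⟩ := exists_boundaryTwo_eq_unit h𝒢 he hsV
  obtain ⟨f3, h3⟩ := exists_boundaryTwo_eq_unit h𝒢 he (compl_isOpen_isCompact h𝒢 hV)
  -- The term -1_{s(V)} in the boundary of `f1` is cancelled by `f2`, and `f3` supplies the units
  -- outside s(V) ∪ r(V).
  refine ⟨f1 + f2 + f3, fun g => ?_⟩
  have e : boundaryTwo h𝒢 (f1 + f2 + f3) g
      = boundaryTwo h𝒢 f1 g + boundaryTwo h𝒢 f2 g + boundaryTwo h𝒢 f3 g := by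
    rw [map_add, map_add]; rfl
  have d1 : Disjoint V (𝒢.inv '' V) := by
    rw [disjoint_left]
    rintro _ hg ⟨v, hv, rfl⟩
    exact disjoint_left.1 hd ⟨_, hg, rfl⟩ ⟨v, hv, (𝒢.src_inv v).symm⟩
  have d2 : Disjoint (V ∪ 𝒢.inv '' V) (𝒢.unit '' (𝒢.src '' V ∪ 𝒢.rng '' V)ᶜ) := by
    rw [disjoint_left]
    rintro _ hg ⟨x, hx, rfl⟩
    rcases hg with hg | ⟨v, hv, hvx⟩
    · exact hx (Or.inl ⟨_, hg, 𝒢.src_unit x⟩)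
    · exact hx (Or.inr ⟨v, hv, by rw [← 𝒢.src_inv, hvx, 𝒢.src_unit]⟩)
  have i1 := congrFun (indicator_union_of_disjoint d2 (1 : G → ℤ)) g
  have i2 := congrFun (indicator_union_of_disjoint d1 (1 : G → ℤ)) g
  rw [e, h1, h2, h3, hat, i1, i2]
  ring

/-- The elements of `𝒯(𝒢)` are implemented by full bisections with index zero. -/
theorem exists_bisectionClass_eq_zero_of_mem_transpositionSubgroup (h𝒢 : 𝒢.IsAmple) [T2Space G]
    (he : 𝒢.IsEffective) [CompactSpace X] {α : X ≃ₜ X} (hα : α ∈ 𝒢.transpositionSubgroup) :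
    ∃ U, ∃ hU : 𝒢.IsFullBisection U, 𝒢.Implements U α ∧ bisectionClass h𝒢 hU = 0 := by
  induction hα using Subgroup.closure_induction with
  | mem τ hτ =>
    obtain ⟨V, ho, hc, hs, hr, hd, hi⟩ := hτ
    exact ⟨_, isFullBisection_hat h𝒢 he ⟨ho, hc⟩ hs hr hd, hi, 
      bisectionClass_hat h𝒢 he ⟨ho, hc⟩ hs hr hd⟩
  | one =>
    exact ⟨_, isFullBisection_range_unit h𝒢 he, implements_range_unit,
      bisectionClass_range_unit h𝒢 he⟩
  | mul α β _ _ ihα ihβ =>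
    obtain ⟨U, hU, hUi, hU0⟩ := ihα
    obtain ⟨V, hV, hVi, hV0⟩ := ihβ
    exact ⟨_, hU.mul h𝒢 hV, hUi.mul hVi, by
      rw [bisectionClass_mul h𝒢 hU hV, hU0, hV0, add_zero]⟩
  | inv α _ ihα =>
    obtain ⟨U, hU, hUi, hU0⟩ := ihα
    refine ⟨_, hU.inv h𝒢, hUi.inv, ?_⟩
    -- UU⁻¹ implements the identity, so it is the unit bisection and has class zero; additivity then
    -- gives the class of U⁻¹.
    have h1 := bisectionClass_mul h𝒢 hU (hU.inv h𝒢)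
    have h2 : 𝒢.compMul '' 𝒢.pairs U (𝒢.inv '' U) = range 𝒢.unit :=
      IsFullBisection.eq_of_implements h𝒢 he (hU.mul h𝒢 (hU.inv h𝒢))
        (isFullBisection_range_unit h𝒢 he) (hUi.mul hUi.inv)
        (by rw [mul_inv_cancel]; exact implements_range_unit)
    rw [bisectionClass_congr h𝒢 _ (isFullBisection_range_unit h𝒢 he) h2,
      bisectionClass_range_unit h𝒢 he, hU0, zero_add] at h1
    exact h1.symm

theorem transpositionSubgroup_subset_ker_indexMap (h𝒢 : 𝒢.IsAmple) [T2Space G]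
    (he : 𝒢.IsEffective) [CompactSpace X] :
    (𝒢.transpositionSubgroup : Set (X ≃ₜ X)) ⊆
      {α | ∃ hα : α ∈ 𝒢.fullGroup, indexMap h𝒢 ⟨α, hα⟩ = 0} := by
  intro α hα
  obtain ⟨U, hU, hUi, h0⟩ :=
    exists_bisectionClass_eq_zero_of_mem_transpositionSubgroup h𝒢 he hα
  exact ⟨⟨U, hU, hUi⟩, (indexMap_eq h𝒢 he hU hUi).trans h0⟩

/-- The transposition defined by a compact open bisection with disjoint source and range. -/
theorem exists_transposition (h𝒢 : 𝒢.IsAmple) (he : 𝒢.IsEffective) [CompactSpace X] {V : Set G}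
    (hV : IsOpen V ∧ IsCompact V) (hs : InjOn 𝒢.src V) (hr : InjOn 𝒢.rng V)
    (hd : Disjoint (𝒢.src '' V) (𝒢.rng '' V)) :
    ∃ τ ∈ 𝒢.transpositionSubgroup, (∀ g ∈ V, τ (𝒢.src g) = 𝒢.rng g ∧ τ (𝒢.rng g) = 𝒢.src g) ∧
      ∀ x, x ∉ 𝒢.src '' V → x ∉ 𝒢.rng '' V → τ x = x := by
  obtain ⟨τ, hτ⟩ := (isFullBisection_hat h𝒢 he hV hs hr hd).exists_implements h𝒢
  refine ⟨τ, Subgroup.subset_closure ⟨V, hV.1, hV.2, hs, hr, hd, hτ⟩, fun g hg => ⟨?_, ?_⟩, ?_⟩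
  · exact hτ g (Or.inl (Or.inl hg))
  · have := hτ _ (Or.inl (Or.inr ⟨g, hg, rfl⟩))
    rwa [𝒢.src_inv, 𝒢.rng_inv] at this
  · intro x h1 h2
    have := hτ _ (Or.inr ⟨x, fun h => h.elim h1 h2, rfl⟩)
    rwa [𝒢.src_unit, 𝒢.rng_unit] at this

end Transpositions

/-! ### Open kernels of cocycles inherit ampleness and effectiveness. -/

section Kernel

theorem IsAmple.kernel (h𝒢 : 𝒢.IsAmple) (c : 𝒢.IntHom) (hc : IsOpen {g | c.toFun g = 0}) :
    c.kernel.IsAmple where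
  continuous_mul := by
    refine Continuous.subtype_mk (h𝒢.continuous_mul.comp (f := fun p : c.kernel.Comp =>
      (⟨(p.1.1.1, p.1.2.1), p.2⟩ : 𝒢.Comp)) ?_) _
    fun_prop
  continuous_inv := (h𝒢.continuous_inv.comp continuous_subtype_val).subtype_mk _
  continuous_unit := h𝒢.continuous_unit.subtype_mk _
  isLocalHomeomorph_src :=
    h𝒢.isLocalHomeomorph_src.comp hc.isOpenEmbedding_subtypeVal.isLocalHomeomorph
  t2Space_unit := h𝒢.t2Space_unit
  locallyCompactSpace_unit := h𝒢.locallyCompactSpace_unit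
  totallyDisconnectedSpace_unit := h𝒢.totallyDisconnectedSpace_unit

/-- For an open subgroupoid the interior of the isotropy is the trace of the interior in the whole
groupoid. -/
theorem IsEffective.kernel (he : 𝒢.IsEffective) (c : 𝒢.IntHom)
    (hc : IsOpen {g | c.toFun g = 0}) : c.kernel.IsEffective := by
  have h1 : {g : {g // c.toFun g = 0} | c.kernel.src g = c.kernel.rng g}
      = Subtype.val ⁻¹' {g | 𝒢.src g = 𝒢.rng g} := rfl
  have hr : range c.kernel.unit = Subtype.val ⁻¹' range 𝒢.unit := by
    ext g
    constructor
    · rintro ⟨x, rfl⟩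
      exact ⟨x, rfl⟩
    · rintro ⟨x, hx⟩
      exact ⟨x, Subtype.ext hx⟩
  rw [IsEffective, hr, h1, ← he]
  exact (hc.isOpenMap_subtype_val.preimage_interior_eq_interior_preimage
    continuous_subtype_val _).symm

end Kernel

end Bisections

end AlgGroupoid

namespace KatsuraExelPardo

open Set Topology

/-! ### The space of infinite paths and its cylinder sets. -/

section PathSpace

variable {N : ℕ} {A : Matrix (Fin N) (Fin N) ℕ} (B : Matrix (Fin N) (Fin N) ℤ)

instance : DiscreteTopology (Edge A) := ⟨rfl⟩

instance : Finite (Edge A) := by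
  refine Set.finite_univ_iff.1 (((Set.finite_univ (α := Fin N × Fin N)).biUnion
    fun p _ => Set.finite_range fun n : Fin (A p.1 p.2) => (⟨p.1, p.2, n, n.2⟩ : Edge A)).subset ?_)
  rintro ⟨i, j, n, h⟩ -
  exact mem_biUnion (mem_univ (i, j)) ⟨⟨n, h⟩, rfl⟩

noncomputable instance : Fintype (Edge A) := Fintype.ofFinite _

instance : T2Space (InfPath A) :=
  inferInstanceAs (T2Space {x : ℕ → Edge A // ∀ k, (x k).tgt = (x (k + 1)).src})

instance : TotallyDisconnectedSpace (InfPath A) :=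
  inferInstanceAs (TotallyDisconnectedSpace {x : ℕ → Edge A // ∀ k, (x k).tgt = (x (k + 1)).src})

instance : CompactSpace (InfPath A) := by
  have hc : IsClosed {x : ℕ → Edge A | ∀ k, (x k).tgt = (x (k + 1)).src} := by
    rw [ofPred_forall]
    refine isClosed_iInter fun k => isClosed_eq ?_ ?_
    · exact (continuous_of_discreteTopology (f := Edge.tgt)).comp (continuous_apply k)
    · exact (continuous_of_discreteTopology (f := Edge.src)).comp (continuous_apply (k + 1))
  exact isCompact_iff_compactSpace.1 hc.isCompact

theorem continuous_coord (k : ℕ) : Continuous fun x : InfPath A => x.1 k :=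
  (continuous_apply k).comp continuous_subtype_val

theorem continuous_start : Continuous (InfPath.start : InfPath A → Fin N) :=
  (continuous_of_discreteTopology (f := Edge.src)).comp (continuous_coord 0)

/-- The paths with the same start and the same first `n` edges as `x`. -/
def InfPath.cylinder (x : InfPath A) (n : ℕ) : Set (InfPath A) :=
  {z | z.start = x.start ∧ ∀ k < n, z.1 k = x.1 k}

theorem InfPath.mem_cylinder (x : InfPath A) (n : ℕ) : x ∈ x.cylinder n := ⟨rfl, fun _ _ => rfl⟩

theorem InfPath.isOpen_cylinder (x : InfPath A) (n : ℕ) : IsOpen (x.cylinder n) := by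
  have h : x.cylinder n = (InfPath.start ⁻¹' {x.start}) ∩
      ⋂ k ∈ Finset.range n, (fun z : InfPath A => z.1 k) ⁻¹' {x.1 k} := by
    ext z
    simp [InfPath.cylinder]
  rw [h]
  exact ((isOpen_discrete _).preimage continuous_start).inter
    (isOpen_biInter_finset fun k _ => (isOpen_discrete _).preimage (continuous_coord k))

theorem InfPath.exists_cylinder_subset {O : Set (InfPath A)} (hO : IsOpen O) {x : InfPath A}
    (hx : x ∈ O) : ∃ n, x.cylinder n ⊆ O := by
  obtain ⟨O', hO', rfl⟩ := isOpen_induced_iff.1 hO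
  obtain ⟨_, ⟨y, n, rfl⟩, hxy, hsub⟩ :=
    (PiNat.isTopologicalBasis_cylinders fun _ : ℕ => Edge A).exists_subset_of_mem_open hx hO'
  refine ⟨n, fun z hz => hsub ?_⟩
  rw [PiNat.mem_cylinder_iff] at hxy ⊢
  intro i hi
  rw [hz.2 i hi, hxy i hi]

theorem InfPath.cylinder_anti (x : InfPath A) {m n : ℕ} (h : m ≤ n) :
    x.cylinder n ⊆ x.cylinder m := fun _ hz => ⟨hz.1, fun k hk => hz.2 k (hk.trans_le h)⟩

/-- The infinite path `e y`. -/
def InfPath.cons (e : Edge A) (y : InfPath A) (h : e.tgt = y.start) : InfPath A :=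
  ⟨fun k => match k with
    | 0 => e
    | k + 1 => y.1 k, fun k => match k with
    | 0 => h
    | k + 1 => y.2 k⟩

theorem kappa_neg_kappa (m : ℤ) (x : InfPath A) : kappa B (-m) (kappa B m x) = x := by
  rw [← kappa_add, neg_add_cancel, kappa_zero]

theorem kappa_kappa_neg (m : ℤ) (x : InfPath A) : kappa B m (kappa B (-m) x) = x := by
  rw [← kappa_add, add_neg_cancel, kappa_zero]

theorem IsWalk.tgt_unique {i j j' : Fin N} {l : List (Edge A)} (h : IsWalk i l j)
    (h' : IsWalk i l j') : j = j' := by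
  induction l generalizing i with
  | nil => exact h.symm.trans h'
  | cons e l ih => exact ih h.2 h'.2

theorem FinPath.ext_edges {μ ν : FinPath A} (hs : μ.src = ν.src) (he : μ.edges = ν.edges) :
    μ = ν := by
  obtain ⟨i, j, l, h⟩ := μ
  obtain ⟨i', j', l', h'⟩ := ν
  simp only at hs he
  subst hs he
  obtain rfl := h.tgt_unique h'
  rfl

theorem prepend_of_lt (l : List (Edge A)) (x x' : ℕ → Edge A) {k : ℕ} (hk : k < l.length) :
    prepend l x k = prepend l x' k := by
  induction l generalizing k with
  | nil => simp at hk
  | cons e l ih =>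
    cases k with
    | zero => rfl
    | succ k => exact ih (by simpa using hk)

theorem eq_of_prepend_eq {l l' : List (Edge A)} {x x' : ℕ → Edge A} (hl : l.length = l'.length)
    (h : ∀ k < l.length, prepend l x k = prepend l' x' k) : l = l' := by
  induction l generalizing l' with
  | nil => exact (List.length_eq_zero_iff.1 hl.symm).symm
  | cons e l ih =>
    cases l' with
    | nil => simp at hl
    | cons e' l' =>
      have h0 : e = e' := h 0 (by simp)
      rw [h0, ih (l' := l') (by simpa using hl) fun k hk => h (k + 1) (by simpa using hk)]

theorem FinPath.start_append (μ : FinPath A) (y : InfPath A) (h : μ.tgt = y.start) :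
    (μ.append y h).start = μ.src := (prepend_isPath μ.isWalk h y.2).1

/-- The cylinder set `Z(μ) = {μ y}`. -/
def FinPath.cylinder (μ : FinPath A) : Set (InfPath A) := {x | ∃ y h, μ.append y h = x}

theorem InfPath.exists_append (x : InfPath A) (n : ℕ) :
    ∃ (μ : FinPath A) (y : InfPath A) (h : μ.tgt = y.start), μ.length = n ∧ μ.append y h = x :=
  -- The matrix 0 is a dummy: the component `nu` of an expansion does not depend on `B`.
  ⟨((Quad.expand 0)^[n] (Quad.unit x)).nu, _, ((Quad.expand 0)^[n] (Quad.unit x)).nu_tgt,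
    ((Quad.length_iterate 0 n (Quad.unit x)).2.trans (zero_add n)), Quad.source_iterate 0 n _⟩

/-- The condition on `start` in `InfPath.cylinder` matters for a path of length zero, whose only
datum is its vertex. -/
theorem FinPath.cylinder_eq (μ : FinPath A) (y : InfPath A) (h : μ.tgt = y.start) :
    μ.cylinder = (μ.append y h).cylinder μ.length := by
  ext z
  constructor
  · rintro ⟨y', h', rfl⟩
    exact ⟨by rw [start_append, start_append], fun k hk => prepend_of_lt _ _ _ hk⟩
  · rintro ⟨h1, h2⟩
    obtain ⟨ν, y', h', hl, rfl⟩ := z.exists_append μ.length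
    have : ν = μ := by
      refine FinPath.ext_edges (by rwa [start_append, start_append] at h1) ?_
      exact eq_of_prepend_eq hl fun k hk => h2 k (hl ▸ hk)
    subst this
    exact ⟨y', h', rfl⟩

theorem FinPath.append_mem_cylinder (μ : FinPath A) {y y' : InfPath A} (h : μ.tgt = y.start)
    (h' : μ.tgt = y'.start) {n : ℕ} (hn : n ≤ μ.length) :
    μ.append y h ∈ (μ.append y' h').cylinder n := by
  refine InfPath.cylinder_anti _ hn ?_
  rw [← FinPath.cylinder_eq]
  exact ⟨y, h, rfl⟩

theorem FinPath.isOpen_cylinder (μ : FinPath A) : IsOpen μ.cylinder := by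
  rw [isOpen_iff_mem_nhds]
  rintro _ ⟨y, h, rfl⟩
  rw [μ.cylinder_eq y h]
  exact (InfPath.isOpen_cylinder _ _).mem_nhds (InfPath.mem_cylinder _ _)

theorem isClopen_start (v : Fin N) : IsClopen {y : InfPath A | v = y.start} :=
  (isClopen_discrete {w : Fin N | v = w}).preimage continuous_start

instance (v : Fin N) : CompactSpace {y : InfPath A // v = y.start} :=
  isCompact_iff_compactSpace.1 (isClopen_start v).1.isCompact

end PathSpace

/-! ### The sets Z(μ, m, ν) as compact open bisections; ampleness of 𝒢_{A,B}. -/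

section Symbols

variable {N : ℕ}

/-- A triple `(μ, m, ν)` with `r(μ) = r(ν)`. -/
@[ext]
structure Symbol (A : Matrix (Fin N) (Fin N) ℕ) where
  mu : FinPath A
  m : ℤ
  nu : FinPath A
  tgt_eq : mu.tgt = nu.tgt

variable {A : Matrix (Fin N) (Fin N) ℕ} (B : Matrix (Fin N) (Fin N) ℤ)

/-- The triple `(μ, m, ν)` of a quadruple `(μ, m, ν; x)`. -/
def Quad.symbol (a : Quad A) : Symbol A := ⟨a.mu, a.m, a.nu, a.mu_tgt.trans a.nu_tgt.symm⟩

/-- The quadruple `(μ, m, ν; ν y)`. -/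
def Symbol.quad (t : Symbol A) (y : InfPath A) (h : t.nu.tgt = y.start) : Quad A :=
  ⟨t.mu, t.m, t.nu, y, t.tgt_eq.trans h, h⟩

/-- The triple `(μ κ_m(e), φ(m, e), ν e)`. -/
def Symbol.step (t : Symbol A) (e : Edge A) (h : t.nu.tgt = e.src) : Symbol A :=
  ⟨t.mu.snoc (kappaEdge B t.m e) (t.tgt_eq.trans h), phiEdge B t.m e, t.nu.snoc e h, rfl⟩

theorem Quad.symbol_expand (a : Quad A) :
    (a.expand B).symbol = a.symbol.step B (a.y.1 0) a.nu_tgt := rfl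

theorem Symbol.step_congr {t t' : Symbol A} {e e' : Edge A} (ht : t = t') (he : e = e')
    (h : t.nu.tgt = e.src) :
    t.step B e h = t'.step B e' (by rw [← ht, ← he, h]) := by
  subst ht he; rfl

theorem Quad.eq_of_symbol {a b : Quad A} (h : a.symbol = b.symbol) (hy : a.y = b.y) : a = b :=
  Quad.ext (congrArg Symbol.mu h) (congrArg Symbol.m h) (congrArg Symbol.nu h) hy

/-- Expansion can be undone once the last edge is known: putting `e` back in front of the tail gives
the preimage. -/
theorem Symbol.exists_expand {t : Symbol A} {e : Edge A} {h : t.nu.tgt = e.src} {c : Quad A}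
    (hc : c.symbol = t.step B e h) :
    ∃ a : Quad A, a.symbol = t ∧ a.y.1 0 = e ∧ a.expand B = c := by
  have h1 : e.tgt = c.y.start := by
    have : c.symbol.nu.tgt = e.tgt := by rw [hc]; rfl
    exact this.symm.trans c.nu_tgt
  exact ⟨t.quad (InfPath.cons e c.y h1) h, rfl, rfl, Quad.eq_of_symbol hc.symm rfl⟩

/-- Iterated contraction. It yields that Z of an expanded triple is contained in Z of the original
one. -/
theorem Quad.exists_iterate {k : ℕ} {a c : Quad A}
    (h : c.symbol = ((Quad.expand B)^[k] a).symbol) :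
    ∃ a' : Quad A, a'.symbol = a.symbol ∧ (∀ i < k, a'.y.1 i = a.y.1 i) ∧
      (Quad.expand B)^[k] a' = c := by
  induction k generalizing a with
  | zero => exact ⟨c, h, by simp, rfl⟩
  | succ k ih =>
    rw [Function.iterate_succ_apply] at h
    obtain ⟨b, hb, hi, hbc⟩ := ih h
    rw [Quad.symbol_expand] at hb
    obtain ⟨a', ha', h0, hab⟩ := Symbol.exists_expand B hb
    refine ⟨a', ha', fun i hi' => ?_, by rw [Function.iterate_succ_apply, hab, hbc]⟩
    cases i with
    | zero => exact h0
    | succ i =>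
      have := hi i (by omega)
      rw [← hab] at this
      exact this

/-- The first `k` expansions read only the first `k` edges of the tail, so the resulting triple is
locally constant in the tail. The continuity of `unit` and of y ↦ [μ, m, ν; νy] rests on this. -/
theorem Quad.symbol_iterate_congr {k : ℕ} {a b : Quad A} (h : a.symbol = b.symbol)
    (hy : ∀ i < k, a.y.1 i = b.y.1 i) :
    ((Quad.expand B)^[k] a).symbol = ((Quad.expand B)^[k] b).symbol := by
  induction k generalizing a b with
  | zero => exact h
  | succ k ih =>
    rw [Function.iterate_succ_apply, Function.iterate_succ_apply]
    refine ih ?_ fun i hi => hy (i + 1) (by omega)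
    rw [Quad.symbol_expand, Quad.symbol_expand]
    exact Symbol.step_congr B h (hy 0 (by omega)) _

/-- The set `Z(μ, m, ν)`. -/
def Symbol.bisection (t : Symbol A) : Set (Arrow A B) :=
  {g | ∃ a : Quad A, a.symbol = t ∧ Arrow.mk B a = g}

variable {B}

theorem Symbol.bisection_eq (t : Symbol A) :
    t.bisection B = basicBisection A B t.mu t.m t.nu := by
  ext g
  constructor
  · rintro ⟨a, rfl, rfl⟩
    exact ⟨a, rfl, rfl, rfl, rfl⟩
  · rintro ⟨a, h1, h2, h3, rfl⟩
    exact ⟨a, Symbol.ext h1 h2 h3, rfl⟩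

theorem Quad.mem_bisection (a : Quad A) : Arrow.mk B a ∈ a.symbol.bisection B := ⟨a, rfl, rfl⟩

theorem Quad.mem_bisection_iterate (a : Quad A) (k : ℕ) :
    Arrow.mk B a ∈ ((Quad.expand B)^[k] a).symbol.bisection B :=
  ⟨_, rfl, Arrow.mk_iterate k a⟩

theorem Quad.bisection_iterate_subset (a : Quad A) (k : ℕ) :
    ((Quad.expand B)^[k] a).symbol.bisection B ⊆ a.symbol.bisection B := by
  rintro _ ⟨c, hc, rfl⟩
  obtain ⟨a', ha', -, rfl⟩ := Quad.exists_iterate B hc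
  exact ⟨a', ha', (Arrow.mk_iterate k a').symm⟩

theorem Quad.bisection_iterate_anti (a : Quad A) {k l : ℕ} (h : k ≤ l) :
    ((Quad.expand B)^[l] a).symbol.bisection B ⊆ ((Quad.expand B)^[k] a).symbol.bisection B := by
  obtain ⟨d, rfl⟩ := Nat.exists_eq_add_of_le h
  rw [add_comm, Function.iterate_add_apply]
  exact Quad.bisection_iterate_subset _ _

theorem Symbol.isOpen_bisection (t : Symbol A) : IsOpen (t.bisection B) :=
  TopologicalSpace.isOpen_generateFrom_of_mem ⟨t.mu, t.m, t.nu, t.tgt_eq, t.bisection_eq⟩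

/-- The sets `Z` of the expansions of `a` are a neighbourhood basis at the class of `a`. -/
theorem Quad.exists_bisection_subset {O : Set (Arrow A B)} (hO : IsOpen O) {a : Quad A}
    (ha : Arrow.mk B a ∈ O) : ∃ k, ((Quad.expand B)^[k] a).symbol.bisection B ⊆ O := by
  induction hO with
  | basic s hs =>
    obtain ⟨μ, m, ν, ht, rfl⟩ := hs
    obtain ⟨b, rfl, rfl, rfl, hab⟩ := ha
    -- Two representatives of one arrow have a common expansion, so Z of the `l`-th expansion of `a`
    -- is Z of an expansion of `b`.
    obtain ⟨j, l, h⟩ := Arrow.mk_eq_mk.1 hab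
    refine ⟨l, ?_⟩
    rw [← h]
    exact (b.bisection_iterate_subset j).trans b.symbol.bisection_eq.le
  | univ => exact ⟨0, subset_univ _⟩
  | inter s t _ _ ihs iht =>
    obtain ⟨k, hk⟩ := ihs ha.1
    obtain ⟨l, hl⟩ := iht ha.2
    exact ⟨max k l, subset_inter ((a.bisection_iterate_anti (le_max_left k l)).trans hk)
      ((a.bisection_iterate_anti (le_max_right k l)).trans hl)⟩
  | sUnion S _ ih =>
    obtain ⟨s, hs, has⟩ := ha
    obtain ⟨k, hk⟩ := ih s hs has
    exact ⟨k, hk.trans (subset_sUnion_of_mem hs)⟩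

theorem Arrow.mem_nhds_bisection_iterate (a : Quad A) (k : ℕ) :
    ((Quad.expand B)^[k] a).symbol.bisection B ∈ 𝓝 (Arrow.mk B a) :=
  (Symbol.isOpen_bisection _).mem_nhds (a.mem_bisection_iterate k)

theorem Symbol.injOn_src (t : Symbol A) : InjOn Arrow.src (t.bisection B) := by
  rintro _ ⟨a, rfl, rfl⟩ _ ⟨b, hb, rfl⟩ h
  have hnu : a.nu = b.nu := (congrArg Symbol.nu hb).symm
  have h2 := (FinPath.append_inj a.nu_tgt b.nu_tgt (by rw [hnu]) h).2
  rw [Quad.eq_of_symbol hb.symm h2]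

theorem Symbol.injOn_rng (t : Symbol A) : InjOn Arrow.rng (t.bisection B) := by
  rintro _ ⟨a, rfl, rfl⟩ _ ⟨b, hb, rfl⟩ h
  have hmu : a.mu = b.mu := (congrArg Symbol.mu hb).symm
  have hm : a.m = b.m := (congrArg Symbol.m hb).symm
  have h2 := (FinPath.append_inj (y := kappa B a.m a.y) (z := kappa B b.m b.y) a.mu_tgt b.mu_tgt
    (by rw [hmu]) h).2
  rw [hm] at h2
  have h3 : a.y = b.y := by
    rw [← kappa_neg_kappa B b.m a.y, h2, kappa_neg_kappa]
  rw [Quad.eq_of_symbol hb.symm h3]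

theorem Symbol.src_image (t : Symbol A) : Arrow.src '' t.bisection B = t.nu.cylinder := by
  ext x
  constructor
  · rintro ⟨_, ⟨a, rfl, rfl⟩, rfl⟩
    exact ⟨a.y, a.nu_tgt, rfl⟩
  · rintro ⟨y, h, rfl⟩
    exact ⟨_, ⟨t.quad y h, rfl, rfl⟩, rfl⟩

theorem Symbol.rng_image (t : Symbol A) : Arrow.rng '' t.bisection B = t.mu.cylinder := by
  ext x
  constructor
  · rintro ⟨_, ⟨a, rfl, rfl⟩, rfl⟩
    exact ⟨kappa B a.m a.y, a.mu_tgt, rfl⟩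
  · rintro ⟨y, h, rfl⟩
    refine ⟨_, ⟨t.quad (kappa B (-t.m) y) (t.tgt_eq.symm.trans h), rfl, rfl⟩, Subtype.ext ?_⟩
    change prepend t.mu.edges (kappa B t.m (kappa B (-t.m) y)).1 = _
    rw [kappa_kappa_neg]
    rfl

/-- After `n` expansions |ν| ≥ n, so all arrows in the expanded Z have sources with the same first
`n` edges. -/
theorem Arrow.continuous_src : Continuous (Arrow.src : Arrow A B → InfPath A) := by
  refine continuous_def.2 fun O hO => isOpen_iff_mem_nhds.2 fun g hg => ?_
  obtain ⟨a, rfl⟩ := g.exists_mk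
  obtain ⟨n, hn⟩ := InfPath.exists_cylinder_subset hO hg
  refine Filter.mem_of_superset (Arrow.mem_nhds_bisection_iterate a n) ?_
  rintro _ ⟨b, hb, rfl⟩
  refine hn ?_
  have e : (Arrow.mk B a).src = ((Quad.expand B)^[n] a).source := (Quad.source_iterate B n a).symm
  have hnu : b.nu = ((Quad.expand B)^[n] a).nu := congrArg Symbol.nu hb
  have hl := (Quad.length_iterate B n a).2
  rw [e]
  generalize (Quad.expand B)^[n] a = c at hnu hl
  obtain ⟨mu, m, nu, y, h1, h2⟩ := b
  simp only at hnu
  subst hnu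
  exact FinPath.append_mem_cylinder _ h2 _ (by omega)

theorem Arrow.isOpenMap_src : IsOpenMap (Arrow.src : Arrow A B → InfPath A) := by
  intro O hO
  rw [isOpen_iff_mem_nhds]
  rintro _ ⟨g, hg, rfl⟩
  obtain ⟨a, rfl⟩ := g.exists_mk
  obtain ⟨k, hk⟩ := Quad.exists_bisection_subset hO hg
  refine Filter.mem_of_superset ?_ (image_mono hk)
  rw [Symbol.src_image]
  refine (FinPath.isOpen_cylinder _).mem_nhds ?_
  rw [← Symbol.src_image]
  exact ⟨_, a.mem_bisection_iterate k, rfl⟩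

theorem Arrow.isLocalHomeomorph_src : IsLocalHomeomorph (Arrow.src : Arrow A B → InfPath A) := by
  rw [isLocalHomeomorph_iff_isOpenEmbedding_restrict]
  intro g
  obtain ⟨a, rfl⟩ := g.exists_mk
  refine ⟨a.symbol.bisection B, a.symbol.isOpen_bisection.mem_nhds a.mem_bisection,
    IsOpenEmbedding.of_continuous_injective_isOpenMap
      (Arrow.continuous_src.comp continuous_subtype_val) ?_
      (Arrow.isOpenMap_src.domRestrict a.symbol.isOpen_bisection)⟩
  exact (injOn_iff_injective.1 a.symbol.injOn_src)

/-- This parametrizes Z(μ, m, ν) by a compact space. In the Hausdorff case it also shows that two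
such sections agree on a closed set. -/
theorem Symbol.continuous_mk_quad (t : Symbol A) :
    Continuous fun y : {y : InfPath A // t.nu.tgt = y.start} => Arrow.mk B (t.quad y.1 y.2) := by
  refine continuous_def.2 fun O hO => isOpen_iff_mem_nhds.2 fun y hy => ?_
  obtain ⟨k, hk⟩ := Quad.exists_bisection_subset hO hy
  refine Filter.mem_of_superset (((InfPath.isOpen_cylinder y.1 k).preimage
    continuous_subtype_val).mem_nhds (InfPath.mem_cylinder _ _)) ?_
  intro z hz
  refine hk ⟨_, ?_, Arrow.mk_iterate k _⟩
  exact Quad.symbol_iterate_congr B rfl hz.2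

theorem Symbol.isCompact_bisection (t : Symbol A) : IsCompact (t.bisection B) := by
  have h : t.bisection B = range fun y : {y : InfPath A // t.nu.tgt = y.start} =>
      Arrow.mk B (t.quad y.1 y.2) := by
    ext g
    constructor
    · rintro ⟨a, rfl, rfl⟩
      exact ⟨⟨a.y, a.nu_tgt⟩, rfl⟩
    · rintro ⟨y, rfl⟩
      exact ⟨_, rfl, rfl⟩
  rw [h]
  exact isCompact_range t.continuous_mk_quad

theorem Arrow.continuous_inv : Continuous (Arrow.inv : Arrow A B → Arrow A B) := by
  refine continuous_generateFrom_iff.2 ?_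
  rintro _ ⟨μ, m, ν, h, rfl⟩
  have e : Arrow.inv ⁻¹' basicBisection A B μ m ν = (⟨ν, -m, μ, h.symm⟩ : Symbol A).bisection B := by
    ext g
    constructor
    · rintro ⟨a, rfl, rfl, rfl, ha⟩
      refine ⟨a.inv B, rfl, ?_⟩
      exact (congrArg Arrow.inv ha).trans ((groupoid A B).inv_inv g)
    · rintro ⟨a, ha, rfl⟩
      obtain ⟨rfl, h2, rfl⟩ : a.mu = ν ∧ a.m = -m ∧ a.nu = μ :=
        ⟨congrArg Symbol.mu ha, congrArg Symbol.m ha, congrArg Symbol.nu ha⟩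
      exact ⟨a.inv B, rfl, by change -a.m = m; omega, rfl, rfl⟩
  rw [e]
  exact Symbol.isOpen_bisection _

theorem Arrow.continuous_unit :
    Continuous fun x : InfPath A => Arrow.mk B (Quad.unit x) := by
  refine continuous_def.2 fun O hO => isOpen_iff_mem_nhds.2 fun x hx => ?_
  obtain ⟨k, hk⟩ := Quad.exists_bisection_subset hO hx
  refine Filter.mem_of_superset ((InfPath.isOpen_cylinder x k).mem_nhds
    (InfPath.mem_cylinder _ _)) ?_
  intro z hz
  refine hk ⟨_, ?_, Arrow.mk_iterate k _⟩
  refine Quad.symbol_iterate_congr B ?_ hz.2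
  have h : (Quad.unit z).nu = (Quad.unit x).nu := congrArg FinPath.nil hz.1
  exact Symbol.ext h rfl h

/-- Matched representatives stay matched under simultaneous expansion, and the product of Z(λ, n, μ)
and Z(μ, m, ν) lies in Z(λ, n + m, ν), which is as small as desired after enough expansions. -/
theorem Arrow.continuous_mul : Continuous (groupoid A B).compMul := by
  refine continuous_def.2 fun O hO => isOpen_iff_mem_nhds.2 ?_
  rintro ⟨⟨g, h⟩, p⟩ hgh
  obtain ⟨⟨a, b⟩, rfl, rfl, hab⟩ := Arrow.exists_matched g h p
  simp only at hab
  have e : (groupoid A B).compMul ⟨(Arrow.mk B a, Arrow.mk B b), p⟩ = Arrow.mk B (Quad.comp B a b hab) :=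
    Arrow.mul_mk hab p
  rw [mem_preimage, e] at hgh
  obtain ⟨k, hk⟩ := Quad.exists_bisection_subset hO hgh
  have hn : (((Quad.expand B)^[k] a).symbol.bisection B) ×ˢ
      (((Quad.expand B)^[k] b).symbol.bisection B) ∈ 𝓝 (Arrow.mk B a, Arrow.mk B b) :=
    prod_mem_nhds (Arrow.mem_nhds_bisection_iterate a k) (Arrow.mem_nhds_bisection_iterate b k)
  refine Filter.mem_of_superset (continuous_subtype_val.continuousAt.preimage_mem_nhds hn) ?_
  rintro ⟨⟨g', h'⟩, p'⟩ ⟨⟨a', ha', rfl⟩, ⟨b', hb', rfl⟩⟩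
  have hpath := (hab.iterate k).path
  have hab' : Quad.Matched B a' b' := by
    refine Quad.matched_of_length p' ?_
    rw [show a'.nu = ((Quad.expand B)^[k] a).nu from congrArg Symbol.nu ha',
      show b'.mu = ((Quad.expand B)^[k] b).mu from congrArg Symbol.mu hb', hpath]
  refine hk ⟨Quad.comp B a' b' hab', ?_, (Arrow.mul_mk hab' p').symm⟩
  rw [← Quad.comp_iterate hab]
  have hmu : a'.mu = ((Quad.expand B)^[k] a).mu := congrArg Symbol.mu ha'
  have hnu : b'.nu = ((Quad.expand B)^[k] b).nu := congrArg Symbol.nu hb'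
  have hm : a'.m + b'.m = ((Quad.expand B)^[k] a).m + ((Quad.expand B)^[k] b).m :=
    congrArg₂ (fun s t : Symbol A => s.m + t.m) ha' hb'
  exact Symbol.ext hmu hm hnu

variable (A B)

/-- The groupoid `𝒢_{A,B}` is ample. -/
theorem isAmple_groupoid : (groupoid A B).IsAmple where
  continuous_mul := Arrow.continuous_mul
  continuous_inv := Arrow.continuous_inv
  continuous_unit := Arrow.continuous_unit
  isLocalHomeomorph_src := Arrow.isLocalHomeomorph_src
  t2Space_unit := inferInstance
  locallyCompactSpace_unit := inferInstance
  totallyDisconnectedSpace_unit := inferInstance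

/-- The cocycle is constant on every set Z(μ, m, ν). -/
theorem isOpen_degree_eq_zero : IsOpen {g : Arrow A B | (canonicalCocycle A B).toFun g = 0} := by
  rw [isOpen_iff_mem_nhds]
  intro g hg
  obtain ⟨a, rfl⟩ := g.exists_mk
  refine Filter.mem_of_superset (a.symbol.isOpen_bisection.mem_nhds a.mem_bisection) ?_
  rintro _ ⟨b, hb, rfl⟩
  have h1 : b.mu = a.mu := congrArg Symbol.mu hb
  have h2 : b.nu = a.nu := congrArg Symbol.nu hb
  change (b.mu.length : ℤ) - b.nu.length = 0
  rw [h1, h2]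
  exact hg

theorem isAmple_kernelGroupoid : (kernelGroupoid A B).IsAmple :=
  (isAmple_groupoid A B).kernel _ (isOpen_degree_eq_zero A B)

end Symbols

end KatsuraExelPardo

namespace KatsuraExelPardo

open Set Topology

/-! ### Formal combinations of triples: functions, weights and expansion. -/

section FreeModule

variable {N : ℕ} {A : Matrix (Fin N) (Fin N) ℕ} (B : Matrix (Fin N) (Fin N) ℤ)

/-- With one outgoing edge chosen at every vertex, a path never gets stuck. Consequently no Z(μ, m,
ν) is empty, so a triple can be tested on actual arrows. -/
theorem exists_infPath_start (hA : ∀ i, ∃ j, A i j ≠ 0) (v : Fin N) :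
    ∃ y : InfPath A, v = y.start := by
  choose f hf using hA
  let e : Fin N → Edge A := fun i => ⟨i, f i, 0, Nat.pos_of_ne_zero (hf i)⟩
  exact ⟨⟨fun k => e (f^[k] v), fun k => (Function.iterate_succ_apply' f k v).symm⟩, rfl⟩

/-- The linear map on formal combinations of triples that expands every triple `(μ, m, ν)` to the sum of the
triples `(μ κ_m(e), φ(m, e), ν e)`. -/
noncomputable def expandMap : (Symbol A →₀ ℤ) →ₗ[ℤ] (Symbol A →₀ ℤ) :=
  Finsupp.linearCombination ℤ fun t =>
    ∑ e : {e : Edge A // t.nu.tgt = e.src}, Finsupp.single (t.step B e.1 e.2) 1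

/-- The function on arrows given by a formal combination of triples. -/
noncomputable def realize : (Symbol A →₀ ℤ) →ₗ[ℤ] (Arrow A B → ℤ) :=
  Finsupp.linearCombination ℤ fun t => (t.bisection B).indicator 1

/-- The map `(μ, m, ν) ↦ m` with values in the copy of `ℤ` at the vertex `r(ν)`. -/
noncomputable def weight : (Symbol A →₀ ℤ) →ₗ[ℤ] (Fin N → ℤ) :=
  Finsupp.linearCombination ℤ fun t => Pi.single t.nu.tgt t.m

/-- The permutation of the edges that acts on the edges with source `v` as `κ_{m_v}`. -/
def kappaPerm (m : Fin N → ℤ) : Equiv.Perm (Edge A) where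
  toFun e := kappaEdge B (m e.src) e
  invFun e := kappaEdge B (-m e.src) e
  left_inv e := by
    change kappaEdge B (-m e.src) (kappaEdge B (m e.src) e) = e
    rw [← (edge_cocycle B _ _ _).2, neg_add_cancel, (edge_zero B e).2]
  right_inv e := by
    change kappaEdge B (m e.src) (kappaEdge B (-m e.src) e) = e
    rw [← (edge_cocycle B _ _ _).2, add_neg_cancel, (edge_zero B e).2]

variable (A) in
/-- The endomorphism of `ℤ^N` induced by expansion. -/
noncomputable def weightExpand : (Fin N → ℤ) →+ (Fin N → ℤ) where
  toFun m w := ∑ e : Edge A, if e.tgt = w then phiEdge B (m e.src) e else 0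
  map_zero' := by
    funext w
    simp [(edge_zero B _).1]
  map_add' m n := by
    funext w
    -- The permutation preserves the source and the target of each edge. Reindexing by it turns the
    -- cocycle identity φ(m + n, e) = φ(m, κ_n(e)) + φ(n, e) into additivity, although φ( · , e)
    -- itself need not be additive.
    have h := Equiv.sum_comp (kappaPerm (A := A) B n)
      fun e => if e.tgt = w then phiEdge B (m e.src) e else 0
    simp only [Pi.add_apply, (edge_cocycle B _ _ _).1]
    rw [← h, ← Finset.sum_add_distrib]
    refine Finset.sum_congr rfl fun e _ => ?_
    change _ = (if e.tgt = w then phiEdge B (m e.src) (kappaEdge B (n e.src) e) else 0) + _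
    split_ifs <;> simp

/-- The left side is the weight of the one-step expansion of a triple with label `m` and range `v`.
On the right, edges with another source contribute φ(0, e) = 0. -/
theorem sum_single_phiEdge (v : Fin N) (m : ℤ) :
    ∑ e : {e : Edge A // v = e.src}, (Pi.single e.1.tgt (phiEdge B m e.1) : Fin N → ℤ)
      = weightExpand A B (Pi.single v m) := by
  funext w
  rw [Finset.sum_apply]
  have hF : ∀ e : Edge A, (if e.tgt = w then
      phiEdge B ((Pi.single v m : Fin N → ℤ) e.src) e else 0)
      = if v = e.src then (Pi.single e.tgt (phiEdge B m e) : Fin N → ℤ) w else 0 := by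
    intro e
    by_cases h1 : v = e.src
    · rw [if_pos h1, h1, Pi.single_eq_same]
      by_cases h2 : e.tgt = w
      · rw [if_pos h2, ← h2, Pi.single_eq_same]
      · rw [if_neg h2, Pi.single_eq_of_ne' h2]
    · rw [if_neg h1, Pi.single_eq_of_ne' h1, (edge_zero B e).1, ite_self]
  refine Eq.trans ?_ (Finset.sum_congr rfl fun e _ => (hF e).symm)
  rw [← Finset.sum_filter]
  exact (Finset.sum_subtype _ (by simp)
    fun e : Edge A => (Pi.single e.tgt (phiEdge B m e) : Fin N → ℤ) w).symm

/-- By linearity a single triple suffices. Together with `realize_expandMap`: expansion keeps the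
function and moves the weight by a fixed endomorphism. -/
theorem weight_expandMap (x : Symbol A →₀ ℤ) :
    weight (expandMap B x) = weightExpand A B (weight x) := by
  have h : weight.comp (expandMap (A := A) B)
      = (weightExpand A B).toIntLinearMap.comp weight := by
    refine Finsupp.lhom_ext' fun t => LinearMap.ext_ring ?_
    simp only [LinearMap.comp_apply, Finsupp.lsingle_apply, expandMap, weight,
      Finsupp.linearCombination_single, one_smul, map_sum, AddMonoidHom.coe_toIntLinearMap]
    exact sum_single_phiEdge B t.nu.tgt t.m
  exact LinearMap.congr_fun h x

variable {B}

theorem Symbol.bisection_step_subset (t : Symbol A) (e : Edge A) (h : t.nu.tgt = e.src) :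
    (t.step B e h).bisection B ⊆ t.bisection B := by
  rintro _ ⟨c, hc, rfl⟩
  obtain ⟨a, ha, -, rfl⟩ := Symbol.exists_expand B hc
  exact ⟨a, ha, (Arrow.mk_expand a).symm⟩

/-- The one-step expansions of a triple partition its set Z according to the first edge behind ν. -/
theorem Symbol.mem_bisection_step_iff (a : Quad A) (e : Edge A) (h : a.symbol.nu.tgt = e.src) :
    Arrow.mk B a ∈ (a.symbol.step B e h).bisection B ↔ e = a.y.1 0 := by
  constructor
  · rintro ⟨c, hc, hca⟩
    obtain ⟨b, hb, rfl, rfl⟩ := Symbol.exists_expand B hc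
    rw [Arrow.mk_expand] at hca
    have hs : b.source = a.source := congrArg Arrow.src hca
    have hnu : b.nu = a.nu := congrArg Symbol.nu hb
    rw [(FinPath.append_inj b.nu_tgt a.nu_tgt (by rw [hnu]) hs).2]
  · rintro rfl
    exact ⟨a.expand B, rfl, Arrow.mk_expand a⟩

theorem realize_expandMap (x : Symbol A →₀ ℤ) : realize B (expandMap B x) = realize B x := by
  classical
  have h : (realize (A := A) B).comp (expandMap B) = realize B := by
    refine Finsupp.lhom_ext' fun t => LinearMap.ext_ring ?_
    funext g
    simp only [LinearMap.comp_apply, Finsupp.lsingle_apply, expandMap, realize,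
      Finsupp.linearCombination_single, one_smul, map_sum]
    rw [Finset.sum_apply]
    by_cases hg : g ∈ t.bisection B
    · obtain ⟨a, rfl, rfl⟩ := hg
      rw [Finset.sum_eq_single (⟨a.y.1 0, a.nu_tgt⟩ : {e : Edge A // a.symbol.nu.tgt = e.src}),
        indicator_of_mem ((Symbol.mem_bisection_step_iff a _ _).2 rfl),
        indicator_of_mem a.mem_bisection]
      · intro e _ he
        refine indicator_of_notMem (fun hm => he (Subtype.ext ?_)) _
        exact (Symbol.mem_bisection_step_iff a _ _).1 hm
      · simp
    · rw [indicator_of_notMem hg]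
      exact Finset.sum_eq_zero fun e _ =>
        indicator_of_notMem (fun hm => hg (t.bisection_step_subset _ _ hm)) _
  exact LinearMap.congr_fun h x

theorem realize_iterate (k : ℕ) (x : Symbol A →₀ ℤ) :
    realize B ((expandMap B)^[k] x) = realize B x := by
  induction k with
  | zero => rfl
  | succ k ih => rw [Function.iterate_succ_apply', realize_expandMap, ih]

theorem weight_iterate (k : ℕ) (x : Symbol A →₀ ℤ) :
    weight ((expandMap B)^[k] x) = (weightExpand A B)^[k] (weight x) := by
  induction k with
  | zero => rfl
  | succ k ih => rw [Function.iterate_succ_apply', Function.iterate_succ_apply', weight_expandMap, ih]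

theorem realize_apply (x : Symbol A →₀ ℤ) (g : Arrow A B) :
    realize B x g = ∑ t ∈ x.support, x t * (t.bisection B).indicator 1 g := by
  rw [realize, Finsupp.linearCombination_apply, Finsupp.sum, Finset.sum_apply]
  rfl

theorem exists_step_of_mem_support {x : Symbol A →₀ ℤ} {t' : Symbol A}
    (h : t' ∈ (expandMap B x).support) :
    ∃ t ∈ x.support, ∃ e he, t' = t.step B e he := by
  rw [Finsupp.mem_support_iff, expandMap, Finsupp.linearCombination_apply, Finsupp.sum,
    Finsupp.finsetSum_apply] at h
  obtain ⟨t, ht, hne⟩ := Finset.exists_ne_zero_of_sum_ne_zero h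
  rw [Finsupp.smul_apply, Finsupp.finsetSum_apply] at hne
  obtain ⟨e, -, hne'⟩ := Finset.exists_ne_zero_of_sum_ne_zero (right_ne_zero_of_smul hne)
  refine ⟨t, ht, e.1, e.2, ?_⟩
  by_contra hc
  exact hne' (Finsupp.single_eq_of_ne hc)

/-- A triple `(μ, m, ν)` with `|μ| = |ν| = n`. -/
def Symbol.HasLevel (n : ℕ) (t : Symbol A) : Prop := t.mu.length = n ∧ t.nu.length = n

theorem Symbol.HasLevel.step {n : ℕ} {t : Symbol A} (h : t.HasLevel n) (e : Edge A)
    (he : t.nu.tgt = e.src) : (t.step B e he).HasLevel (n + 1) := by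
  constructor
  · rw [← h.1]; simp [Symbol.step, FinPath.snoc, FinPath.length]
  · rw [← h.2]; simp [Symbol.step, FinPath.snoc, FinPath.length]

theorem hasLevel_iterate {n : ℕ} {x : Symbol A →₀ ℤ} (hx : ∀ t ∈ x.support, t.HasLevel n) (k : ℕ) :
    ∀ t ∈ ((expandMap B)^[k] x).support, t.HasLevel (n + k) := by
  induction k with
  | zero => exact hx
  | succ k ih =>
    intro t ht
    rw [Function.iterate_succ_apply'] at ht
    obtain ⟨t, ht', e, he, rfl⟩ := exists_step_of_mem_support ht
    exact (ih t ht').step e he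

/-- Coefficients may cancel under expansion, so only this direction is available: a surviving triple
comes from a triple in the support. -/
theorem exists_iterate_of_mem_support {k : ℕ} {x : Symbol A →₀ ℤ} {c : Quad A}
    (h : c.symbol ∈ ((expandMap B)^[k] x).support) :
    ∃ a : Quad A, a.symbol ∈ x.support ∧ (Quad.expand B)^[k] a = c := by
  induction k generalizing c with
  | zero => exact ⟨c, h, rfl⟩
  | succ k ih =>
    rw [Function.iterate_succ_apply'] at h
    obtain ⟨t, ht, e, he, htc⟩ := exists_step_of_mem_support h
    obtain ⟨b, rfl, -, rfl⟩ := Symbol.exists_expand B htc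
    obtain ⟨a, ha, rfl⟩ := ih ht
    exact ⟨a, ha, Function.iterate_succ_apply' _ _ _⟩

theorem Quad.y_iterate (k : ℕ) (a : Quad A) :
    ((Quad.expand B)^[k] a).y = InfPath.tail^[k] a.y := by
  induction k generalizing a with
  | zero => rfl
  | succ k ih => rw [Function.iterate_succ_apply, Function.iterate_succ_apply, ih]; rfl

theorem Quad.iterate_eq_of_le {a b : Quad A} {k l : ℕ} (hkl : k ≤ l)
    (h : (Quad.expand B)^[k] a = (Quad.expand B)^[k] b) :
    (Quad.expand B)^[l] a = (Quad.expand B)^[l] b := by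
  obtain ⟨d, rfl⟩ := Nat.exists_eq_add_of_le hkl
  rw [add_comm, Function.iterate_add_apply, h, ← Function.iterate_add_apply]

/-- In the Hausdorff case two triples that represent the same arrow do so after a bounded number
of expansions. -/
theorem Symbol.exists_forall_iterate_eq [T2Space (Arrow A B)] {n : ℕ} {t t' : Symbol A}
    (ht : t.HasLevel n) (ht' : t'.HasLevel n) :
    ∃ k, ∀ a b : Quad A, a.symbol = t → b.symbol = t' → Arrow.mk B a = Arrow.mk B b →
      (Quad.expand B)^[k] a = (Quad.expand B)^[k] b := by
  -- Different paths ν of equal length have disjoint cylinder sets, so in that case no arrow is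
  -- shared.
  by_cases hnu : t.nu = t'.nu
  swap
  · refine ⟨0, ?_⟩
    rintro a b rfl rfl hab
    exact (hnu (FinPath.append_inj a.nu_tgt b.nu_tgt (ht.2.trans ht'.2.symm)
      (congrArg Arrow.src hab)).1).elim
  have hsrc : ∀ y : {y : InfPath A // t.nu.tgt = y.start}, t'.nu.tgt = y.1.start :=
    fun y => by rw [← hnu]; exact y.2
  have hloc : ∀ y : {y : InfPath A // t.nu.tgt = y.start}, ∃ k, ∃ U ∈ 𝓝 y, ∀ z ∈ U,
      Arrow.mk B (t.quad z.1 z.2) = Arrow.mk B (t'.quad z.1 (hsrc z)) →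
      (Quad.expand B)^[k] (t.quad z.1 z.2) = (Quad.expand B)^[k] (t'.quad z.1 (hsrc z)) := by
    intro y
    -- If the two arrows over `y` agree, a common expansion after `j` steps persists on all tails
    -- with the same first `j` edges. If they differ, then by the Hausdorff property they differ on
    -- a neighbourhood and nothing has to be checked there.
    by_cases hy : Arrow.mk B (t.quad y.1 y.2) = Arrow.mk B (t'.quad y.1 (hsrc y))
    · obtain ⟨j, l, h⟩ := Arrow.mk_eq_mk.1 hy
      have hl := congrArg (fun q : Quad A => q.nu.length) h
      simp only [(Quad.length_iterate B _ _).2] at hl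
      -- Both triples have level `n`, so comparing the lengths of ν after expansion forces equal
      -- numbers of steps.
      have hjl : j = l := by
        have h1 : (t.quad y.1 y.2).nu.length = n := ht.2
        have h2 : (t'.quad y.1 (hsrc y)).nu.length = n := ht'.2
        omega
      subst hjl
      refine ⟨j, _, ((InfPath.isOpen_cylinder y.1 j).preimage
        continuous_subtype_val).mem_nhds (InfPath.mem_cylinder _ _), fun z hz _ => ?_⟩
      refine Quad.eq_of_symbol ?_ (by rw [Quad.y_iterate, Quad.y_iterate]; rfl)
      rw [Quad.symbol_iterate_congr B (a := t.quad z.1 z.2) (b := t.quad y.1 y.2) rfl hz.2, h]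
      exact Quad.symbol_iterate_congr B rfl fun i hi => (hz.2 i hi).symm
    · have hc : Continuous fun z : {y : InfPath A // t.nu.tgt = y.start} =>
          Arrow.mk B (t'.quad z.1 (hsrc z)) :=
        t'.continuous_mk_quad.comp (f := fun z : {y : InfPath A // t.nu.tgt = y.start} =>
          (⟨z.1, hsrc z⟩ : {y : InfPath A // t'.nu.tgt = y.start}))
          (continuous_subtype_val.subtype_mk _)
      exact ⟨0, _, (isClosed_eq t.continuous_mk_quad hc).isOpen_compl.mem_nhds hy,
        fun z hz h => (hz h).elim⟩
  choose k U hU hk using hloc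
  obtain ⟨F, hF⟩ := CompactSpace.elim_nhds_subcover U hU
  refine ⟨F.sup k, ?_⟩
  rintro a b rfl rfl hab
  have hy : a.y = b.y := (FinPath.append_inj a.nu_tgt b.nu_tgt (ht.2.trans ht'.2.symm)
      (congrArg Arrow.src hab)).2
  have hmem : (⟨a.y, a.nu_tgt⟩ : {y : InfPath A // a.symbol.nu.tgt = y.start}) ∈ ⋃ x ∈ F, U x := by
    rw [hF]; trivial
  simp only [mem_iUnion] at hmem
  obtain ⟨x, hx, hm⟩ := hmem
  have hb : b = b.symbol.quad a.y (hsrc ⟨a.y, a.nu_tgt⟩) := Quad.eq_of_symbol rfl hy.symm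
  refine Quad.iterate_eq_of_le (Finset.le_sup hx) ?_
  have := hk x _ hm
  rw [← hb] at this
  exact this hab

theorem exists_forall_iterate_eq [T2Space (Arrow A B)] {n : ℕ} {S : Set (Symbol A)} (hfin : S.Finite)
    (hS : ∀ t ∈ S, t.HasLevel n) :
    ∃ k, ∀ a b : Quad A, a.symbol ∈ S → b.symbol ∈ S → Arrow.mk B a = Arrow.mk B b →
      (Quad.expand B)^[k] a = (Quad.expand B)^[k] b := by
  classical
  -- The membership condition sits behind the existential so that `k` can be chosen as a function of
  -- all pairs.
  have h : ∀ p : Symbol A × Symbol A, ∃ k, p ∈ S ×ˢ S → ∀ a b : Quad A, a.symbol = p.1 →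
      b.symbol = p.2 → Arrow.mk B a = Arrow.mk B b →
      (Quad.expand B)^[k] a = (Quad.expand B)^[k] b := by
    intro p
    by_cases hp : p ∈ S ×ˢ S
    · obtain ⟨k, hk⟩ := Symbol.exists_forall_iterate_eq (B := B) (hS _ hp.1) (hS _ hp.2)
      exact ⟨k, fun _ => hk⟩
    · exact ⟨0, fun h => (hp h).elim⟩
  choose k hk using h
  have hfin2 := hfin.prod hfin
  refine ⟨hfin2.toFinset.sup k, fun a b ha hb hab => ?_⟩
  have hp : (a.symbol, b.symbol) ∈ S ×ˢ S := ⟨ha, hb⟩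
  exact Quad.iterate_eq_of_le (Finset.le_sup (hfin2.mem_toFinset.2 hp)) (hk _ hp a b rfl rfl hab)

/-- A formal combination of triples of level `n` that gives the zero function vanishes after
finitely many expansions. -/
theorem exists_iterate_expandMap_eq_zero [T2Space (Arrow A B)] (hA : ∀ i, ∃ j, A i j ≠ 0) {n : ℕ}
    {x : Symbol A →₀ ℤ} (hx : ∀ t ∈ x.support, t.HasLevel n)
    (h : ∀ g : Arrow A B, g.degree = 0 → realize B x g = 0) : ∃ k, (expandMap B)^[k] x = 0 := by
  obtain ⟨k, hk⟩ := exists_forall_iterate_eq (B := B) x.support.finite_toSet hx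
  refine ⟨k, ?_⟩
  by_contra hne
  obtain ⟨t, ht⟩ := Finsupp.support_nonempty_iff.2 hne
  obtain ⟨y, hy⟩ := exists_infPath_start hA t.nu.tgt
  have hdeg : (Arrow.mk B (t.quad y hy)).degree = 0 := by
    have hl := hasLevel_iterate hx k t ht
    change (t.mu.length : ℤ) - t.nu.length = 0
    rw [hl.1, hl.2, sub_self]
  have h0 := h _ hdeg
  -- The function is evaluated at an arrow of Z(t). Any other expanded triple whose Z contains this
  -- arrow has an ancestor that merges with that of `t` after `k` steps, hence is `t`; only the
  -- nonzero coefficient of `t` remains.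
  rw [← realize_iterate k, realize_apply, Finset.sum_eq_single t] at h0
  · have hmem : Arrow.mk B (t.quad y hy) ∈ t.bisection B := ⟨_, rfl, rfl⟩
    rw [indicator_of_mem hmem, Pi.one_apply, mul_one] at h0
    exact Finsupp.mem_support_iff.1 ht h0
  · intro s hs hst
    rw [indicator_of_notMem, mul_zero]
    rintro ⟨c, rfl, hc⟩
    obtain ⟨a, ha, hac⟩ := exists_iterate_of_mem_support hs
    obtain ⟨b, hb, hbt⟩ := exists_iterate_of_mem_support (c := t.quad y hy) ht
    refine hst ?_
    have : c = t.quad y hy := by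
      rw [← hac, ← hbt]
      refine hk a b ha hb ?_
      rw [← Arrow.mk_iterate k a, hac, ← Arrow.mk_iterate k b, hbt, hc]
    rw [this]
    rfl
  · intro hn
    exact (hn ht).elim

end FreeModule

end KatsuraExelPardo

namespace KatsuraExelPardo

open Set Topology CompactlySupported AlgGroupoid

/-! ### Boundaries in ℋ_{A,B} have weight zero. -/

section Boundary

variable {N : ℕ} {A : Matrix (Fin N) (Fin N) ℕ} {B : Matrix (Fin N) (Fin N) ℤ}

variable (B) in
/-- The set `Z(μ, m, ν)` as a set of arrows of `ℋ_{A,B}`. -/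
def Symbol.kernelBisection (t : Symbol A) :
    Set {g : Arrow A B // (canonicalCocycle A B).toFun g = 0} :=
  Subtype.val ⁻¹' t.bisection B

theorem Symbol.HasLevel.degree_eq_zero {n : ℕ} {t : Symbol A} (ht : t.HasLevel n) {g : Arrow A B}
    (hg : g ∈ t.bisection B) : (canonicalCocycle A B).toFun g = 0 := by
  obtain ⟨a, rfl, rfl⟩ := hg
  change (a.mu.length : ℤ) - a.nu.length = 0
  rw [show a.mu.length = n from ht.1, show a.nu.length = n from ht.2, sub_self]

theorem Symbol.HasLevel.isOpen_isCompact {n : ℕ} {t : Symbol A} (ht : t.HasLevel n) :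
    IsOpen (t.kernelBisection B) ∧ IsCompact (t.kernelBisection B) := by
  refine ⟨t.isOpen_bisection.preimage continuous_subtype_val, ?_⟩
  have h : Subtype.val '' t.kernelBisection B = t.bisection B := by
    refine (image_preimage_eq_iff).2 fun g hg => ?_
    exact ⟨⟨g, ht.degree_eq_zero hg⟩, rfl⟩
  rw [Subtype.isCompact_iff, h]
  exact t.isCompact_bisection

theorem Symbol.injOn_src_kernel (t : Symbol A) :
    InjOn (kernelGroupoid A B).src (t.kernelBisection B) :=
  fun _ hg _ hh e => Subtype.ext (t.injOn_src hg hh e)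

theorem Symbol.injOn_rng_kernel (t : Symbol A) :
    InjOn (kernelGroupoid A B).rng (t.kernelBisection B) :=
  fun _ hg _ hh e => Subtype.ext (t.injOn_rng hg hh e)

theorem Symbol.HasLevel.src_image_kernel {n : ℕ} {t : Symbol A} (ht : t.HasLevel n) :
    (kernelGroupoid A B).src '' t.kernelBisection B = t.nu.cylinder := by
  rw [← t.src_image (B := B)]
  ext x
  constructor
  · rintro ⟨g, hg, rfl⟩
    exact ⟨g.1, hg, rfl⟩
  · rintro ⟨g, hg, rfl⟩
    exact ⟨⟨g, ht.degree_eq_zero hg⟩, hg, rfl⟩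

theorem Symbol.HasLevel.rng_image_kernel {n : ℕ} {t : Symbol A} (ht : t.HasLevel n) :
    (kernelGroupoid A B).rng '' t.kernelBisection B = t.mu.cylinder := by
  rw [← t.rng_image (B := B)]
  ext x
  constructor
  · rintro ⟨g, hg, rfl⟩
    exact ⟨g.1, hg, rfl⟩
  · rintro ⟨g, hg, rfl⟩
    exact ⟨⟨g, ht.degree_eq_zero hg⟩, hg, rfl⟩

/-- The triple `(λ, n + m, ν)` for triples `(λ, n, μ)` and `(μ, m, ν)`. -/
def Symbol.comp (t s : Symbol A) (h : t.nu = s.mu) : Symbol A :=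
  ⟨t.mu, t.m + s.m, s.nu, by rw [t.tgt_eq, h, s.tgt_eq]⟩

theorem Symbol.matched {a b : Quad A} (h : a.symbol.nu = b.symbol.mu)
    (p : (Arrow.mk B a).src = (Arrow.mk B b).rng) : Quad.Matched B a b :=
  Quad.matched_of_length p (congrArg FinPath.length h)

/-- Equality of the middle paths makes every composable pair of representatives matched. Conversely,
an element of Z(λ, n + m, ν) with tail y factors through the arrow with label n and tail κ_m(y). -/
theorem Symbol.compMul_image {n : ℕ} {t s : Symbol A} (h : t.nu = s.mu) (ht : t.HasLevel n)
    (hs : s.HasLevel n) :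
    (kernelGroupoid A B).compMul ''
        (kernelGroupoid A B).pairs (t.kernelBisection B) (s.kernelBisection B)
      = (t.comp s h).kernelBisection B := by
  ext g
  constructor
  · rintro ⟨⟨⟨⟨_, _⟩, ⟨_, _⟩⟩, p⟩, ⟨⟨a, rfl, rfl⟩, ⟨b, rfl, rfl⟩⟩, rfl⟩
    have hab := Symbol.matched h p
    exact ⟨Quad.comp B a b hab, rfl, (Arrow.mul_mk hab p).symm⟩
  · intro hg
    obtain ⟨g, hg0⟩ := g
    obtain ⟨c, hc, rfl⟩ : g ∈ (t.comp s h).bisection B := hg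
    have hnu : s.nu.tgt = c.y.start := by
      have : c.nu = s.nu := congrArg Symbol.nu hc
      rw [← this]; exact c.nu_tgt
    let b : Quad A := s.quad c.y hnu
    let a : Quad A := t.quad (kappa B s.m c.y) ((by rw [h, s.tgt_eq]; exact hnu))
    have hab : Quad.Matched B a b := ⟨h, rfl⟩
    have hcc : Quad.comp B a b hab = c := Quad.eq_of_symbol hc.symm rfl
    have p : (Arrow.mk B a).src = (Arrow.mk B b).rng := hab.source_eq
    refine ⟨⟨(⟨Arrow.mk B a, ht.degree_eq_zero ⟨a, rfl, rfl⟩⟩,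
      ⟨Arrow.mk B b, hs.degree_eq_zero ⟨b, rfl, rfl⟩⟩), p⟩, ⟨⟨a, rfl, rfl⟩, ⟨b, rfl, rfl⟩⟩, ?_⟩
    refine Subtype.ext ?_
    change Arrow.mul _ _ p = _
    rw [Arrow.mul_mk hab p, hcc]

theorem realize_single (t : Symbol A) (g : {g : Arrow A B // (canonicalCocycle A B).toFun g = 0}) :
    realize B (Finsupp.single t 1) g.1 = (t.kernelBisection B).indicator 1 g := by
  rw [realize, Finsupp.linearCombination_single, one_smul]
  rfl

/-- The labels enter as m - (n + m) + n at one common range vertex, so this formal combination has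
weight zero. -/
theorem boundaryTwo_symbol [T2Space (Arrow A B)] {n : ℕ} {t s : Symbol A} (h : t.nu = s.mu)
    (ht : t.HasLevel n) (hs : s.HasLevel n)
    (hW : IsOpen ((kernelGroupoid A B).pairs (t.kernelBisection B) (s.kernelBisection B)) ∧
      IsCompact ((kernelGroupoid A B).pairs (t.kernelBisection B) (s.kernelBisection B)))
    (g : {g : Arrow A B // (canonicalCocycle A B).toFun g = 0}) :
    boundaryTwo (isAmple_kernelGroupoid A B) (compactOpenIndicator hW) g
      = realize B (Finsupp.single s 1 - Finsupp.single (t.comp s h) 1 + Finsupp.single t 1) g.1 := by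
  have e : (kernelGroupoid A B).src '' t.kernelBisection B
      = (kernelGroupoid A B).rng '' s.kernelBisection B := by
    rw [ht.src_image_kernel, hs.rng_image_kernel, h]
  rw [boundaryTwo_pairs (isAmple_kernelGroupoid A B) hW t.injOn_src_kernel s.injOn_src_kernel
    s.injOn_rng_kernel, snd_image_pairs e.ge, fst_image_pairs e.le, Symbol.compMul_image h ht hs,
    map_add, map_sub, Pi.add_apply, Pi.sub_apply, realize_single, realize_single, realize_single]

theorem isInducing_comp : IsInducing fun p : (kernelGroupoid A B).Comp => (p.1.1.1, p.1.2.1) :=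
  (IsInducing.subtypeVal.prodMap IsInducing.subtypeVal).comp IsInducing.subtypeVal

/-- `p` lies in a basic set `Z(t) × Z(s)` of level `n` contained in `O`. -/
def HasBasicNhd (n : ℕ) (O : Set (kernelGroupoid A B).Comp) (p : (kernelGroupoid A B).Comp) : Prop :=
  ∃ t s : Symbol A, t.nu = s.mu ∧ t.HasLevel n ∧ s.HasLevel n ∧
    p ∈ (kernelGroupoid A B).pairs (t.kernelBisection B) (s.kernelBisection B) ∧
    (kernelGroupoid A B).pairs (t.kernelBisection B) (s.kernelBisection B) ⊆ O

/-- Monotonicity in the level makes the cover by levels directed, so compactness yields one level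
for a whole support. -/
theorem HasBasicNhd.succ {n : ℕ} {O : Set (kernelGroupoid A B).Comp} {p : (kernelGroupoid A B).Comp}
    (h : HasBasicNhd n O p) : HasBasicNhd (n + 1) O p := by
  obtain ⟨t, s, hts, ht, hs, ⟨⟨a, rfl, ha⟩, ⟨b, rfl, hb⟩⟩, hO⟩ := h
  have hab : Quad.Matched B a b := Symbol.matched hts (by rw [ha, hb]; exact p.2)
  refine ⟨(a.expand B).symbol, (b.expand B).symbol, hab.expand.path, ht.step _ a.nu_tgt,
    hs.step _ b.nu_tgt,
    ⟨⟨_, rfl, (Arrow.mk_expand a).trans ha⟩, ⟨_, rfl, (Arrow.mk_expand b).trans hb⟩⟩,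
    Subset.trans ?_ hO⟩
  rintro q ⟨h1, h2⟩
  exact ⟨a.bisection_iterate_subset 1 h1, b.bisection_iterate_subset 1 h2⟩

/-- Expanding both matched representatives by the same number of steps keeps them matched. Degree
zero and matching make the four path lengths equal. -/
theorem exists_hasBasicNhd {O : Set (kernelGroupoid A B).Comp} (hO : IsOpen O)
    {p : (kernelGroupoid A B).Comp} (hp : p ∈ O) : ∃ n, HasBasicNhd n O p := by
  obtain ⟨O', hO', rfl⟩ := isInducing_comp.isOpen_iff.1 hO
  obtain ⟨⟨⟨g, hg⟩, ⟨h, hh⟩⟩, p⟩ := p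
  obtain ⟨P, Q, hP, hQ, hgP, hhQ, hPQ⟩ := isOpen_prod_iff.1 hO' g h hp
  obtain ⟨⟨a, b⟩, rfl, rfl, hab⟩ := Arrow.exists_matched g h p
  simp only at hab
  obtain ⟨k, hk⟩ := Quad.exists_bisection_subset hP hgP
  obtain ⟨l, hl⟩ := Quad.exists_bisection_subset hQ hhQ
  have ha : (a.mu.length : ℤ) - a.nu.length = 0 := hg
  have hb : (b.mu.length : ℤ) - b.nu.length = 0 := hh
  have hab' : a.nu.length = b.mu.length := congrArg FinPath.length hab.path
  have h1 := Quad.length_iterate B (max k l) a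
  have h2 := Quad.length_iterate B (max k l) b
  refine ⟨a.nu.length + max k l, _, _, (hab.iterate (max k l)).path, ⟨?_, ?_⟩, ⟨?_, ?_⟩,
    ⟨a.mem_bisection_iterate _, b.mem_bisection_iterate _⟩, ?_⟩
  · exact h1.1.trans (by omega)
  · exact h1.2
  · exact h2.1.trans (by omega)
  · exact h2.2.trans (by omega)
  · rintro q ⟨q1, q2⟩
    exact hPQ ⟨hk (a.bisection_iterate_anti (le_max_left k l) q1),
      hl (b.bisection_iterate_anti (le_max_right k l) q2)⟩

variable (B) in
/-- The triples obtained from those in `S` by `k` expansions. -/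
def expansions (S : Set (Symbol A)) (k : ℕ) : Set (Symbol A) :=
  {t | ∃ a : Quad A, a.symbol ∈ S ∧ ((Quad.expand B)^[k] a).symbol = t}

theorem finite_expansions {S : Set (Symbol A)} (hS : S.Finite) (k : ℕ) :
    (expansions B S k).Finite := by
  induction k with
  | zero =>
    refine hS.subset ?_
    rintro _ ⟨a, ha, rfl⟩
    exact ha
  | succ k ih =>
    refine (ih.biUnion fun t _ => Set.finite_range
      fun e : {e : Edge A // t.nu.tgt = e.src} => t.step B e.1 e.2).subset ?_
    rintro _ ⟨a, ha, rfl⟩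
    rw [Function.iterate_succ_apply']
    exact mem_biUnion (x := ((Quad.expand B)^[k] a).symbol) ⟨a, ha, rfl⟩
      ⟨⟨_, Quad.nu_tgt _⟩, rfl⟩

/-- A compactly supported function on composable pairs is constant on each of finitely many pairwise
disjoint basic sets of the same level, and zero elsewhere. -/
theorem exists_decomposition [T2Space (Arrow A B)] (f : C_c((kernelGroupoid A B).Comp, ℤ)) :
    ∃ (n : ℕ) (Q : Set (Symbol A × Symbol A)) (c : Symbol A × Symbol A → ℤ), Q.Finite ∧
      (∀ q ∈ Q, q.1.nu = q.2.mu ∧ q.1.HasLevel n ∧ q.2.HasLevel n ∧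
        ∀ p ∈ (kernelGroupoid A B).pairs (q.1.kernelBisection B) (q.2.kernelBisection B),
          f p = c q) ∧
      (∀ p, f p ≠ 0 → ∃ q ∈ Q,
        p ∈ (kernelGroupoid A B).pairs (q.1.kernelBisection B) (q.2.kernelBisection B)) ∧
      ∀ q ∈ Q, ∀ q' ∈ Q, ∀ p,
        p ∈ (kernelGroupoid A B).pairs (q.1.kernelBisection B) (q.2.kernelBisection B) →
        p ∈ (kernelGroupoid A B).pairs (q'.1.kernelBisection B) (q'.2.kernelBisection B) →
        q = q' := by
  have hK : IsCompact (tsupport f) := f.hasCompactSupport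
  have hopen : ∀ z : ℤ, IsOpen (f ⁻¹' {z}) := fun z =>
    (isOpen_discrete _).preimage (map_continuous f)
  have hWo : ∀ {n : ℕ} {t s : Symbol A}, t.HasLevel n → s.HasLevel n →
      IsOpen ((kernelGroupoid A B).pairs (t.kernelBisection B) (s.kernelBisection B)) :=
    fun ht hs => (pairs_isOpen_isCompact (isAmple_kernelGroupoid A B) ht.isOpen_isCompact
      hs.isOpen_isCompact).1
  -- A common level `n` for basic neighbourhoods on which `f` is constant, valid on the whole
  -- support.
  obtain ⟨n, hn⟩ := hK.elim_directed_cover (fun n => {p | HasBasicNhd n (f ⁻¹' {f p}) p})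
    (fun n => by
      rw [isOpen_iff_mem_nhds]
      rintro p ⟨t, s, hts, ht, hs, hp, hO⟩
      refine Filter.mem_of_superset ((hWo ht hs).mem_nhds hp) fun q hq => ?_
      have hqp : f q = f p := hO hq
      refine ⟨t, s, hts, ht, hs, hq, ?_⟩
      rw [hqp]
      exact hO)
    (fun p _ => mem_iUnion.2 (exists_hasBasicNhd (hopen (f p)) rfl))
    (directed_of_isDirected_le (monotone_nat_of_le_succ fun n p hp => HasBasicNhd.succ hp))
  let I : Set (Symbol A × Symbol A) := {q | q.1.nu = q.2.mu ∧ q.1.HasLevel n ∧ q.2.HasLevel n ∧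
    ∃ z, (kernelGroupoid A B).pairs (q.1.kernelBisection B) (q.2.kernelBisection B) ⊆ f ⁻¹' {z}}
  obtain ⟨Q0, hQ0I, hQ0, hcov⟩ := hK.elim_finite_subcover_image (b := I)
    (c := fun q => (kernelGroupoid A B).pairs (q.1.kernelBisection B) (q.2.kernelBisection B))
    (fun q hq => hWo hq.2.1 hq.2.2.1)
    (fun p hp => by
      obtain ⟨t, s, hts, ht, hs, hp', hO⟩ := hn hp
      exact mem_biUnion (x := (t, s)) ⟨hts, ht, hs, _, hO⟩ hp')
  let S : Set (Symbol A) := Prod.fst '' Q0 ∪ Prod.snd '' Q0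
  have hSfin : S.Finite := (hQ0.image _).union (hQ0.image _)
  have hS : ∀ t ∈ S, t.HasLevel n := by
    rintro _ (⟨q, hq, rfl⟩ | ⟨q, hq, rfl⟩)
    · exact (hQ0I hq).2.1
    · exact (hQ0I hq).2.2.1
  -- The finite subcover may overlap. After `k` further expansions, triples whose sets Z meet are
  -- equal, so the refined basic sets are disjoint.
  obtain ⟨k, hk⟩ := exists_forall_iterate_eq (B := B) hSfin hS
  let Q : Set (Symbol A × Symbol A) := {q | ∃ a b : Quad A, Quad.Matched B a b ∧
    (a.symbol, b.symbol) ∈ Q0 ∧ q = (((Quad.expand B)^[k] a).symbol, ((Quad.expand B)^[k] b).symbol)}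
  have hQconst : ∀ q : Symbol A × Symbol A, ∃ z, q ∈ Q →
      ∀ p ∈ (kernelGroupoid A B).pairs (q.1.kernelBisection B) (q.2.kernelBisection B), f p = z := by
    intro q
    by_cases hq : q ∈ Q
    · obtain ⟨a, b, hab, habQ, rfl⟩ := hq
      obtain ⟨-, -, -, z, hz⟩ := hQ0I habQ
      exact ⟨z, fun _ p hp => hz ⟨a.bisection_iterate_subset k hp.1, b.bisection_iterate_subset k hp.2⟩⟩
    · exact ⟨0, fun h => (hq h).elim⟩
  choose c hc using hQconst
  have hlev : ∀ a : Quad A, a.symbol.HasLevel n → ((Quad.expand B)^[k] a).symbol.HasLevel (n + k) := by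
    intro a ha
    have h := Quad.length_iterate B k a
    exact ⟨h.1.trans (congrArg (· + k) ha.1), h.2.trans (congrArg (· + k) ha.2)⟩
  have hdisj : ∀ t ∈ expansions B S k, ∀ s ∈ expansions B S k, ∀ g : Arrow A B,
      g ∈ t.bisection B → g ∈ s.bisection B → t = s := by
    rintro _ ⟨a, ha, rfl⟩ _ ⟨b, hb, rfl⟩ _ ⟨a', ha', rfl⟩ ⟨b', hb', hab⟩
    obtain ⟨a1, h1, -, rfl⟩ := Quad.exists_iterate B ha'
    obtain ⟨b1, h2, -, rfl⟩ := Quad.exists_iterate B hb'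
    rw [Arrow.mk_iterate, Arrow.mk_iterate] at hab
    rw [← ha', ← hb', hk b1 a1 (h2 ▸ hb) (h1 ▸ ha) hab]
  refine ⟨n + k, Q, c, ?_, ?_, ?_, ?_⟩
  · refine ((finite_expansions (B := B) hSfin k).prod
      (finite_expansions (B := B) hSfin k)).subset ?_
    rintro _ ⟨a, b, -, hq, rfl⟩
    exact ⟨⟨a, Or.inl ⟨_, hq, rfl⟩, rfl⟩, ⟨b, Or.inr ⟨_, hq, rfl⟩, rfl⟩⟩
  · rintro q hq
    refine ⟨?_, ?_, ?_, hc q hq⟩ <;> obtain ⟨a, b, hab, habQ, rfl⟩ := hq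
    · exact (hab.iterate k).path
    · exact hlev a (hQ0I habQ).2.1
    · exact hlev b (hQ0I habQ).2.2.1
  · intro p hp
    have h := hcov (subset_tsupport _ hp)
    simp only [mem_iUnion] at h
    obtain ⟨⟨t, s⟩, hq, ⟨⟨a, rfl, ha⟩, ⟨b, rfl, hb⟩⟩⟩ := h
    have hab : Quad.Matched B a b := Symbol.matched (hQ0I hq).1 (by rw [ha, hb]; exact p.2)
    refine ⟨_, ⟨a, b, hab, hq, rfl⟩, ?_, ?_⟩
    · exact ⟨_, rfl, (Arrow.mk_iterate k a).trans ha⟩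
    · exact ⟨_, rfl, (Arrow.mk_iterate k b).trans hb⟩
  · rintro _ ⟨a, b, -, hq, rfl⟩ _ ⟨a', b', -, hq', rfl⟩ p hp hp'
    exact Prod.ext
      (hdisj _ ⟨a, Or.inl ⟨_, hq, rfl⟩, rfl⟩ _ ⟨a', Or.inl ⟨_, hq', rfl⟩, rfl⟩ _ hp.1 hp'.1)
      (hdisj _ ⟨b, Or.inr ⟨_, hq, rfl⟩, rfl⟩ _ ⟨b', Or.inr ⟨_, hq', rfl⟩, rfl⟩ _ hp.2 hp'.2)

/-- Boundaries are given by formal combinations of triples of weight zero. -/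
theorem exists_realize_eq_boundaryTwo [T2Space (Arrow A B)]
    (f : C_c((kernelGroupoid A B).Comp, ℤ)) :
    ∃ (n : ℕ) (x : Symbol A →₀ ℤ), (∀ t ∈ x.support, t.HasLevel n) ∧ weight x = 0 ∧
      ∀ g, boundaryTwo (isAmple_kernelGroupoid A B) f g = realize B x g.1 := by
  classical
  obtain ⟨n, Q, c, hfin, hQ, hcov, hdisj⟩ := exists_decomposition f
  have hW : ∀ q : Q, _ := fun q =>
    pairs_isOpen_isCompact (isAmple_kernelGroupoid A B) (hQ q q.2).2.1.isOpen_isCompact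
      (hQ q q.2).2.2.1.isOpen_isCompact
  have := hfin.fintype
  have hf : f = ∑ q : Q, c q • compactOpenIndicator (hW q) := by
    ext p
    rw [CompactlySupportedContinuousMap.coe_sum, Finset.sum_apply]
    change f p = ∑ q : Q, c q * ((kernelGroupoid A B).pairs (q.1.1.kernelBisection B)
      (q.1.2.kernelBisection B)).indicator (1 : (kernelGroupoid A B).Comp → ℤ) p
    by_cases hp : ∃ q ∈ Q, p ∈ (kernelGroupoid A B).pairs (q.1.kernelBisection B)
        (q.2.kernelBisection B)
    · obtain ⟨q, hq, hpq⟩ := hp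
      rw [Finset.sum_eq_single (⟨q, hq⟩ : Q), indicator_of_mem hpq, Pi.one_apply, mul_one]
      · exact (hQ q hq).2.2.2 p hpq
      · intro q' _ hne
        rw [indicator_of_notMem, mul_zero]
        exact fun hpq' => hne (Subtype.ext (hdisj q' q'.2 q hq p hpq' hpq))
      · simp
    · have h0 : f p = 0 := by
        by_contra hne
        exact hp (hcov p hne)
      rw [h0]
      refine (Finset.sum_eq_zero fun q _ => ?_).symm
      rw [indicator_of_notMem, mul_zero]
      exact fun hpq => hp ⟨q, q.2, hpq⟩
  -- The formal boundary of one basic set, as in `boundaryTwo_symbol`.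
  let z : Q → (Symbol A →₀ ℤ) := fun q => Finsupp.single q.1.2 1
    - Finsupp.single (q.1.1.comp q.1.2 (hQ q q.2).1) 1 + Finsupp.single q.1.1 1
  refine ⟨n, ∑ q : Q, c q • z q, ?_, ?_, fun g => ?_⟩
  · have hmem : ∑ q : Q, c q • z q ∈ Finsupp.supported ℤ ℤ {t : Symbol A | t.HasLevel n} := by
      refine Submodule.sum_mem _ fun q _ => Submodule.smul_mem _ _ ?_
      refine Submodule.add_mem _ (Submodule.sub_mem _ ?_ ?_) ?_ <;>
        refine Finsupp.single_mem_supported _ _ ?_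
      · exact (hQ q q.2).2.2.1
      · exact ⟨(hQ q q.2).2.1.1, (hQ q q.2).2.2.1.2⟩
      · exact (hQ q q.2).2.1
    exact fun t ht => (Finsupp.mem_supported _ _).1 hmem ht
  · rw [map_sum]
    refine Finset.sum_eq_zero fun q _ => ?_
    have h1 : q.1.1.nu.tgt = q.1.2.nu.tgt := by rw [(hQ q q.2).1, q.1.2.tgt_eq]
    rw [map_smul, map_add, map_sub, weight, Finsupp.linearCombination_single,
      Finsupp.linearCombination_single, Finsupp.linearCombination_single, one_smul, one_smul,
      one_smul, h1]
    change c q • (Pi.single q.1.2.nu.tgt q.1.2.m - Pi.single q.1.2.nu.tgt (q.1.1.m + q.1.2.m)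
      + Pi.single q.1.2.nu.tgt q.1.1.m : Fin N → ℤ) = 0
    rw [Pi.single_add]
    abel_nf
  · have h1 : ∀ q : Q, boundaryTwo (isAmple_kernelGroupoid A B) (compactOpenIndicator (hW q)) g
        = realize B (z q) g.1 :=
      fun q => boundaryTwo_symbol (hQ q q.2).1 (hQ q q.2).2.1 (hQ q q.2).2.2.1 (hW q) g
    rw [hf, map_sum, map_sum, CompactlySupportedContinuousMap.coe_sum, Finset.sum_apply,
      Finset.sum_apply]
    refine Finset.sum_congr rfl fun q _ => ?_
    rw [map_zsmul, map_smul, Pi.smul_apply, ← h1]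
    rfl

end Boundary

end KatsuraExelPardo

namespace KatsuraExelPardo

open Set Topology AlgGroupoid

/-! ### Labelled permutations of paths as products of transpositions. -/

section PathPermutations

variable {N : ℕ} {A : Matrix (Fin N) (Fin N) ℕ} {B : Matrix (Fin N) (Fin N) ℤ}

variable (A) in
/-- The paths of length `n`. -/
abbrev PathOfLength (n : ℕ) : Type := {μ : FinPath A // μ.length = n}

instance (n : ℕ) : Finite (PathOfLength A n) := by
  have : Finite {l : List (Edge A) // l.length = n} := (List.finite_length_eq (Edge A) n).to_subtype
  refine Finite.of_injective (β := Fin N × {l : List (Edge A) // l.length = n})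
    (fun μ => (μ.1.src, ⟨μ.1.edges, μ.2⟩)) fun μ ν h => ?_
  simp only [Prod.mk.injEq] at h
  exact Subtype.ext (FinPath.ext_edges h.1 (congrArg Subtype.val h.2))

noncomputable instance (n : ℕ) : Fintype (PathOfLength A n) := Fintype.ofFinite _

noncomputable instance (n : ℕ) : DecidableEq (PathOfLength A n) := Classical.decEq _

theorem FinPath.append_congr {μ ν : FinPath A} {y z : InfPath A} (h : μ = ν) (hy : y = z)
    (hμ : μ.tgt = y.start) :
    μ.append y hμ = ν.append z (by rw [← h, ← hy, hμ]) := by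
  subst h hy; rfl

variable (B) in
/-- The homeomorphism `α` maps `ν y` to `s(ν) κ_{m(ν)}(y)` for all paths `ν` of length `n`. -/
structure ActsAs (n : ℕ) (s : PathOfLength A n → PathOfLength A n) (m : PathOfLength A n → ℤ)
    (α : InfPath A ≃ₜ InfPath A) : Prop where
  tgt_eq : ∀ ν, (s ν).1.tgt = ν.1.tgt
  apply : ∀ ν y (h : ν.1.tgt = y.start),
    α (ν.1.append y h) = (s ν).1.append (kappa B (m ν) y) ((tgt_eq ν).trans h)

/-- The sums of the integers `m(ν)` over the paths `ν` with a given range. -/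
noncomputable def totalWeight {n : ℕ} (m : PathOfLength A n → ℤ) : Fin N → ℤ :=
  ∑ ν, Pi.single ν.1.tgt (m ν)

/-- If ν and ν' had the same image, a point s(ν)z would have preimages under `α` in both Z(ν) and
Z(ν'). -/
theorem ActsAs.injective (hA : ∀ i, ∃ j, A i j ≠ 0) {n : ℕ}
    {s : PathOfLength A n → PathOfLength A n} {m : PathOfLength A n → ℤ}
    {α : InfPath A ≃ₜ InfPath A} (h : ActsAs B n s m α) : Function.Injective s := by
  intro ν ν' hs
  obtain ⟨z, hz⟩ := exists_infPath_start hA (s ν).1.tgt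
  have h1 := h.apply ν (kappa B (-m ν) z) ((h.tgt_eq ν).symm.trans hz)
  have h2 := h.apply ν' (kappa B (-m ν') z) ((h.tgt_eq ν').symm.trans ((by rw [← hs]; exact hz)))
  have h3 := α.injective (h1.trans (Eq.trans (FinPath.append_congr (congrArg Subtype.val hs)
    (by rw [kappa_kappa_neg, kappa_kappa_neg]) _) h2.symm))
  exact Subtype.ext (FinPath.append_inj _ _ (ν.2.trans ν'.2.symm) h3).1

theorem FinPath.snoc_inj {μ ν : FinPath A} {e f : Edge A} {he : μ.tgt = e.src} {hf : ν.tgt = f.src}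
    (h : μ.snoc e he = ν.snoc f hf) : μ = ν ∧ e = f := by
  have h1 : μ.edges ++ [e] = ν.edges ++ [f] := congrArg FinPath.edges h
  have h2 : (μ.snoc e he).src = (ν.snoc f hf).src := by rw [h]
  obtain ⟨h3, h4⟩ := List.append_inj' h1 rfl
  exact ⟨FinPath.ext_edges h2 h3, by simpa using h4⟩

/-- The path is prolonged to an infinite one, which is cut after `n` edges; uniqueness of prefixes
identifies the next edge as the last edge of `μ`. -/
theorem PathOfLength.exists_snoc (hA : ∀ i, ∃ j, A i j ≠ 0) {n : ℕ} (μ : PathOfLength A (n + 1)) :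
    ∃ (ν : PathOfLength A n) (e : Edge A) (h : ν.1.tgt = e.src), μ.1 = ν.1.snoc e h := by
  obtain ⟨y, hy⟩ := exists_infPath_start hA μ.1.tgt
  obtain ⟨ν, z, hz, hl, hν⟩ := (μ.1.append y hy).exists_append n
  refine ⟨⟨ν, hl⟩, z.1 0, hz, ?_⟩
  have h : μ.1.append y hy = (ν.snoc (z.1 0) hz).append z.tail (z.2 0) := by
    rw [← hν]
    exact (Subtype.ext (prepend_snoc ν.edges z.1)).symm
  refine (FinPath.append_inj _ _ ?_ h).1
  rw [μ.2, ← hl]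
  simp [FinPath.snoc, FinPath.length]

/-- The same `α` is described one level deeper: νe goes to s(ν) κ_{m(ν)}(e), with label φ(m(ν), e)
for the rest. -/
theorem ActsAs.exists_succ (hA : ∀ i, ∃ j, A i j ≠ 0) {n : ℕ}
    {s : PathOfLength A n → PathOfLength A n} {m : PathOfLength A n → ℤ}
    {α : InfPath A ≃ₜ InfPath A} (h : ActsAs B n s m α) :
    ∃ s' m', ActsAs B (n + 1) s' m' α ∧ totalWeight m' = weightExpand A B (totalWeight m) := by
  choose ν e he hμ using fun μ : PathOfLength A (n + 1) => μ.exists_snoc hA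
  have hlen : ∀ (μ : PathOfLength A n) (e : Edge A) (he : μ.1.tgt = e.src),
      (μ.1.snoc e he).length = n + 1 := by
    rintro ⟨μ, rfl⟩ e he
    simp [FinPath.snoc, FinPath.length]
  let s' : PathOfLength A (n + 1) → PathOfLength A (n + 1) := fun μ =>
    ⟨(s (ν μ)).1.snoc (kappaEdge B (m (ν μ)) (e μ)) ((h.tgt_eq _).trans (he μ)), hlen _ _ _⟩
  let m' : PathOfLength A (n + 1) → ℤ := fun μ => phiEdge B (m (ν μ)) (e μ)
  have htgt : ∀ μ, (s' μ).1.tgt = μ.1.tgt := fun μ => by rw [hμ μ]; rfl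
  refine ⟨s', m', ⟨htgt, fun μ y hy => ?_⟩, ?_⟩
  · have hy' : (e μ).tgt = y.start := by rw [← hy, hμ μ]; rfl
    let a : Quad A := ⟨(s (ν μ)).1, m (ν μ), (ν μ).1, InfPath.cons (e μ) y hy',
      (h.tgt_eq _).trans (he μ), he μ⟩
    have h1 : α a.source = a.range B := h.apply (ν μ) (InfPath.cons (e μ) y hy') (he μ)
    rw [← Quad.source_expand B, ← Quad.range_expand B] at h1
    exact Eq.trans (congrArg α (FinPath.append_congr (hμ μ) rfl _)) h1
  -- Paths of length n + 1 correspond to pairs of a path of length n and a following edge, so the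
  -- new weight is computed path by path.
  · let F : (Σ μ : PathOfLength A n, {e : Edge A // μ.1.tgt = e.src}) → PathOfLength A (n + 1) :=
      fun p => ⟨p.1.1.snoc p.2.1 p.2.2, hlen _ _ _⟩
    have hF : Function.Bijective F := by
      constructor
      · rintro ⟨μ, f, hf⟩ ⟨μ', f', hf'⟩ hp
        obtain ⟨h1, h2⟩ := FinPath.snoc_inj (he := hf) (hf := hf') (congrArg Subtype.val hp)
        obtain rfl : μ = μ' := Subtype.ext h1
        subst h2
        rfl
      · intro μ
        exact ⟨⟨ν μ, e μ, he μ⟩, Subtype.ext (hμ μ).symm⟩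
    have hsum := Fintype.sum_bijective F hF
      (fun p => (Pi.single p.2.1.tgt (phiEdge B (m p.1) p.2.1) : Fin N → ℤ))
      (fun μ => Pi.single μ.1.tgt (m' μ)) (fun p => by
        obtain ⟨h1, h2⟩ := FinPath.snoc_inj (he := p.2.2) (hμ (F p))
        have h3 : m' (F p) = phiEdge B (m p.1) p.2.1 := by
          change phiEdge B (m (ν (F p))) (e (F p)) = _
          rw [← h2, ← Subtype.ext h1]
        rw [h3]
        rfl)
    rw [totalWeight, ← hsum, Fintype.sum_sigma, totalWeight, map_sum]
    exact Finset.sum_congr rfl fun μ _ => sum_single_phiEdge B μ.1.tgt (m μ)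

theorem ActsAs.exists_add (hA : ∀ i, ∃ j, A i j ≠ 0) {n : ℕ}
    {s : PathOfLength A n → PathOfLength A n} {m : PathOfLength A n → ℤ}
    {α : InfPath A ≃ₜ InfPath A} (h : ActsAs B n s m α) (k : ℕ) :
    ∃ s' m', ActsAs B (n + k) s' m' α ∧
      totalWeight m' = (weightExpand A B)^[k] (totalWeight m) := by
  induction k with
  | zero => exact ⟨s, m, h, rfl⟩
  | succ k ih =>
    obtain ⟨s', m', h', hw⟩ := ih
    obtain ⟨s'', m'', h'', hw'⟩ := h'.exists_succ hA
    exact ⟨s'', m'', h'', by rw [hw', hw, Function.iterate_succ_apply']⟩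

/-- Composition with the transposition defined by `Z(μ, m₀, ν)`. -/
theorem ActsAs.exists_transposition_mul (hA : ∀ i, ∃ j, A i j ≠ 0)
    (he : (kernelGroupoid A B).IsEffective) {n : ℕ}
    {s : PathOfLength A n → PathOfLength A n} {m : PathOfLength A n → ℤ}
    {α : InfPath A ≃ₜ InfPath A} (h : ActsAs B n s m α) {μ ν : PathOfLength A n} (hne : μ ≠ ν)
    (ht : μ.1.tgt = ν.1.tgt) (m₀ : ℤ) :
    ∃ τ ∈ (kernelGroupoid A B).transpositionSubgroup, ∃ s' m', ActsAs B n s' m' (τ * α) ∧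
      (∀ ρ, s ρ = ν → s' ρ = μ ∧ m' ρ = m₀ + m ρ) ∧
      (∀ ρ, s ρ = μ → s' ρ = ν ∧ m' ρ = -m₀ + m ρ) ∧
      (∀ ρ, s ρ ≠ ν → s ρ ≠ μ → s' ρ = s ρ ∧ m' ρ = m ρ) ∧
      totalWeight m' = totalWeight m := by
  let t : Symbol A := ⟨μ.1, m₀, ν.1, ht⟩
  have hlev : t.HasLevel n := ⟨μ.2, ν.2⟩
  have hcyl : ∀ {ρ ρ' : PathOfLength A n} {x : InfPath A}, x ∈ ρ.1.cylinder → x ∈ ρ'.1.cylinder →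
      ρ = ρ' := by
    rintro ρ ρ' x ⟨y, hy, rfl⟩ ⟨z, hz, e⟩
    exact Subtype.ext (FinPath.append_inj hy hz (ρ.2.trans ρ'.2.symm) e.symm).1
  obtain ⟨τ, hτ, hτV, hτ1⟩ := exists_transposition (isAmple_kernelGroupoid A B) he
    hlev.isOpen_isCompact t.injOn_src_kernel t.injOn_rng_kernel (by
      rw [hlev.src_image_kernel, hlev.rng_image_kernel, disjoint_left]
      exact fun x h1 h2 => hne (hcyl h2 h1))
  rw [hlev.src_image_kernel, hlev.rng_image_kernel] at hτ1
  have hν : ∀ y (hy : ν.1.tgt = y.start),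
      τ (ν.1.append y hy) = μ.1.append (kappa B m₀ y) (ht.trans hy) := fun y hy =>
    (hτV ⟨Arrow.mk B (t.quad y hy), hlev.degree_eq_zero ⟨_, rfl, rfl⟩⟩ ⟨_, rfl, rfl⟩).1
  have hμ : ∀ y (hy : μ.1.tgt = y.start),
      τ (μ.1.append y hy) = ν.1.append (kappa B (-m₀) y) (ht.symm.trans hy) := by
    intro y hy
    have h1 : τ (μ.1.append (kappa B m₀ (kappa B (-m₀) y)) hy)
        = ν.1.append (kappa B (-m₀) y) (ht.symm.trans hy) :=
      (hτV ⟨Arrow.mk B (t.quad (kappa B (-m₀) y) (ht.symm.trans hy)),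
        hlev.degree_eq_zero ⟨_, rfl, rfl⟩⟩ ⟨_, rfl, rfl⟩).2
    rw [← h1]
    exact congrArg τ (FinPath.append_congr rfl (kappa_kappa_neg B m₀ y).symm _)
  let s' : PathOfLength A n → PathOfLength A n := fun ρ =>
    if s ρ = ν then μ else if s ρ = μ then ν else s ρ
  -- The label contributed by the transposition, indexed by the path to which it is applied, that
  -- is, by `s ρ`. Its two nonzero values are opposite and sit at the same vertex.
  let d : PathOfLength A n → ℤ := fun ρ => if ρ = ν then m₀ else if ρ = μ then -m₀ else 0
  let m' : PathOfLength A n → ℤ := fun ρ => d (s ρ) + m ρ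
  have e1 : ∀ ρ, s ρ = ν → s' ρ = μ ∧ m' ρ = m₀ + m ρ := fun ρ hρ =>
    ⟨if_pos hρ, congrArg (· + m ρ) (if_pos hρ)⟩
  have e2 : ∀ ρ, s ρ = μ → s' ρ = ν ∧ m' ρ = -m₀ + m ρ := fun ρ hρ => by
    have hn : s ρ ≠ ν := by rw [hρ]; exact hne
    exact ⟨(if_neg hn).trans (if_pos hρ), congrArg (· + m ρ) ((if_neg hn).trans (if_pos hρ))⟩
  have e3 : ∀ ρ, s ρ ≠ ν → s ρ ≠ μ → s' ρ = s ρ ∧ m' ρ = m ρ := fun ρ h1 h2 =>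
    ⟨(if_neg h1).trans (if_neg h2),
      (congrArg (· + m ρ) ((if_neg h1).trans (if_neg h2))).trans (zero_add _)⟩
  have htgt : ∀ ρ, (s' ρ).1.tgt = ρ.1.tgt := by
    intro ρ
    by_cases h1 : s ρ = ν
    · rw [(e1 ρ h1).1, ht, ← h1, h.tgt_eq]
    · by_cases h2 : s ρ = μ
      · rw [(e2 ρ h2).1, ← ht, ← h2, h.tgt_eq]
      · rw [(e3 ρ h1 h2).1, h.tgt_eq]
  refine ⟨τ, hτ, s', m', ⟨htgt, fun ρ y hy => ?_⟩, e1, e2, e3, ?_⟩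
  · change τ (α _) = _
    rw [h.apply ρ y hy]
    by_cases h1 : s ρ = ν
    · have hy' : ν.1.tgt = (kappa B (m ρ) y).start := by rw [← h1, h.tgt_eq]; exact hy
      rw [FinPath.append_congr (congrArg Subtype.val h1) rfl, hν _ hy']
      refine FinPath.append_congr (congrArg Subtype.val (e1 ρ h1).1.symm) ?_ _
      rw [(e1 ρ h1).2, kappa_add]
    · by_cases h2 : s ρ = μ
      · have hy' : μ.1.tgt = (kappa B (m ρ) y).start := by rw [← h2, h.tgt_eq]; exact hy
        rw [FinPath.append_congr (congrArg Subtype.val h2) rfl, hμ _ hy']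
        refine FinPath.append_congr (congrArg Subtype.val (e2 ρ h2).1.symm) ?_ _
        rw [(e2 ρ h2).2, kappa_add]
      · rw [hτ1 _ (fun hc => h1 (hcyl ⟨_, _, rfl⟩ hc)) (fun hc => h2 (hcyl ⟨_, _, rfl⟩ hc))]
        exact FinPath.append_congr (congrArg Subtype.val (e3 ρ h1 h2).1.symm)
          (by rw [(e3 ρ h1 h2).2]) _
  -- Since `s` is a permutation, the contributions d(s(ρ)) can be summed over ρ instead of s(ρ),
  -- where the two values cancel.
  · have hbij : Function.Bijective s := Finite.injective_iff_bijective.1 (h.injective hA)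
    have h1 : totalWeight m' = (∑ ρ, Pi.single (s ρ).1.tgt (d (s ρ)) : Fin N → ℤ) + totalWeight m := by
      rw [totalWeight, totalWeight, ← Finset.sum_add_distrib]
      refine Finset.sum_congr rfl fun ρ _ => ?_
      rw [h.tgt_eq, ← Pi.single_add]
    have h2 : (∑ ρ, Pi.single (s ρ).1.tgt (d (s ρ)) : Fin N → ℤ)
        = ∑ ρ : PathOfLength A n, Pi.single ρ.1.tgt (d ρ) :=
      Fintype.sum_bijective s hbij _ _ fun _ => rfl
    have h3 : (∑ ρ : PathOfLength A n, Pi.single ρ.1.tgt (d ρ) : Fin N → ℤ) = 0 := by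
      rw [Fintype.sum_eq_add ν μ hne.symm]
      · change (Pi.single _ (if ν = ν then m₀ else _) + Pi.single _ (if μ = ν then m₀ else
          if μ = μ then -m₀ else 0) : Fin N → ℤ) = 0
        rw [if_pos rfl, if_neg hne, if_pos rfl, ht, ← Pi.single_add, add_neg_cancel, Pi.single_zero]
      · rintro ρ ⟨hρ1, hρ2⟩
        change Pi.single _ (if ρ = ν then m₀ else if ρ = μ then -m₀ else 0) = (0 : Fin N → ℤ)
        rw [if_neg hρ1, if_neg hρ2, Pi.single_zero]
    rw [h1, h2, h3, zero_add]

/-- The paths that are not fixed by `(s, m)`. -/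
noncomputable def movedPaths {n : ℕ} (s : PathOfLength A n → PathOfLength A n)
    (m : PathOfLength A n → ℤ) : Finset (PathOfLength A n) :=
  Finset.univ.filter fun ρ => s ρ ≠ ρ ∨ m ρ ≠ 0

/-- The transposition that sends Z(s(ρ₀)) back to Z(ρ₀) with label -m(ρ₀) makes ρ₀ unmoved. A path
that was already unmoved is sent neither to s(ρ₀), by injectivity, nor to ρ₀, and stays unmoved. -/
theorem ActsAs.exists_movedPaths_ssubset (hA : ∀ i, ∃ j, A i j ≠ 0)
    (he : (kernelGroupoid A B).IsEffective) {n : ℕ}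
    {s : PathOfLength A n → PathOfLength A n} {m : PathOfLength A n → ℤ}
    {α : InfPath A ≃ₜ InfPath A} (h : ActsAs B n s m α) {ρ₀ : PathOfLength A n} (hρ : s ρ₀ ≠ ρ₀) :
    ∃ τ ∈ (kernelGroupoid A B).transpositionSubgroup, ∃ s' m', ActsAs B n s' m' (τ * α) ∧
      movedPaths s' m' ⊂ movedPaths s m ∧ totalWeight m' = totalWeight m := by
  obtain ⟨τ, hτ, s', m', hact, h1, -, h3, hw⟩ :=
    h.exists_transposition_mul hA he hρ.symm (h.tgt_eq ρ₀).symm (-m ρ₀)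
  refine ⟨τ, hτ, s', m', hact, ?_, hw⟩
  have h0 := h1 ρ₀ rfl
  rw [neg_add_cancel] at h0
  refine (Finset.ssubset_iff_of_subset fun ρ hm => ?_).2 ⟨ρ₀, ?_, ?_⟩
  · by_contra hc
    simp only [movedPaths, Finset.mem_filter, Finset.mem_univ, true_and, not_or, not_not] at hm hc
    have hne : ρ ≠ ρ₀ := by
      rintro rfl
      exact hρ hc.1
    have h3' := h3 ρ (fun e => hne (h.injective hA e)) (by rw [hc.1]; exact hne)
    rw [h3'.1, h3'.2, hc.1, hc.2] at hm
    simp at hm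
  · simp [movedPaths, hρ]
  · simp [movedPaths, h0.1, h0.2]

/-- A homeomorphism that permutes the cylinder sets of level `n` up to the action of `ℤ` is a
product of transpositions if its total weight vanishes. -/
theorem ActsAs.mem_transpositionSubgroup (hA : ∀ i, ∃ j, A i j ≠ 0)
    (he : (kernelGroupoid A B).IsEffective) {n : ℕ}
    {s : PathOfLength A n → PathOfLength A n} {m : PathOfLength A n → ℤ}
    {α : InfPath A ≃ₜ InfPath A} (h : ActsAs B n s m α) (hw : totalWeight m = 0) :
    α ∈ (kernelGroupoid A B).transpositionSubgroup := by
  induction hM : movedPaths s m using Finset.strongInduction generalizing s m α with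
  | H M ih =>
    subst hM
    by_cases hs : ∃ ρ₀, s ρ₀ ≠ ρ₀
    · obtain ⟨ρ₀, hρ⟩ := hs
      obtain ⟨τ, hτ, s', m', hact, hM, hw'⟩ := h.exists_movedPaths_ssubset hA he hρ
      exact (Subgroup.mul_mem_cancel_left _ hτ).1 (ih _ hM hact (hw'.trans hw) rfl)
    · push Not at hs
      by_cases hm : ∃ ρ₀, m ρ₀ ≠ 0
      · obtain ⟨ρ₀, hρ⟩ := hm
        -- The labels with range r(ρ₀) sum to zero, so one nonzero label forces another.
        obtain ⟨ρ₁, hne, ht, hρ₁⟩ : ∃ ρ₁ ≠ ρ₀, ρ₁.1.tgt = ρ₀.1.tgt ∧ m ρ₁ ≠ 0 := by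
          by_contra hc
          push Not at hc
          refine hρ ?_
          have h1 := congrFun hw ρ₀.1.tgt
          rw [totalWeight, Finset.sum_apply, Finset.sum_eq_single ρ₀, Pi.single_eq_same] at h1
          · exact h1
          · intro ρ _ hne
            by_cases ht : ρ.1.tgt = ρ₀.1.tgt
            · rw [hc ρ hne ht, Pi.single_zero]; rfl
            · rw [Pi.single_eq_of_ne' ht]
          · simp
        -- Once the permutation is trivial, ρ₀ and ρ₁ are swapped with label 0. Both were moved
        -- already, so the moved set does not grow, and the strict decrease for nontrivial
        -- permutations applies again.
        obtain ⟨τ, hτ, s', m', hact, h1, h2, h3, hw'⟩ :=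
          h.exists_transposition_mul hA he hne ht 0
        have hs0 : s' ρ₀ ≠ ρ₀ := by
          rw [(h1 ρ₀ (hs ρ₀)).1]
          exact hne
        obtain ⟨τ', hτ', s'', m'', hact', hM, hw''⟩ := hact.exists_movedPaths_ssubset hA he hs0
        have hsub : movedPaths s' m' ⊆ movedPaths s m := by
          intro ρ hmem
          by_contra hc
          simp only [movedPaths, Finset.mem_filter, Finset.mem_univ, true_and, not_or,
            not_not] at hmem hc
          have hn0 : s ρ ≠ ρ₀ := by
            rw [hc.1]
            rintro rfl
            exact hρ hc.2
          have hn1 : s ρ ≠ ρ₁ := by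
            rw [hc.1]
            rintro rfl
            exact hρ₁ hc.2
          rw [(h3 ρ hn0 hn1).1, (h3 ρ hn0 hn1).2, hc.1, hc.2] at hmem
          simp at hmem
        have := ih _ (hM.trans_subset hsub) hact' (hw''.trans (hw'.trans hw)) rfl
        exact (Subgroup.mul_mem_cancel_left _ hτ).1 ((Subgroup.mul_mem_cancel_left _ hτ').1 this)
      · push Not at hm
        have h1 : α = 1 := by
          ext x
          obtain ⟨μ, y, hy, hl, rfl⟩ := x.exists_append n
          refine (h.apply ⟨μ, hl⟩ y hy).trans ?_
          exact FinPath.append_congr (congrArg Subtype.val (hs ⟨μ, hl⟩))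
            (by rw [hm, kappa_zero]) _
        rw [h1]
        exact Subgroup.one_mem _

/-- Every full bisection is a disjoint union of basic bisections of the same level. -/
theorem exists_actsAs (hA : ∀ i, ∃ j, A i j ≠ 0)
    {U : Set {g : Arrow A B // (canonicalCocycle A B).toFun g = 0}}
    (hU : (kernelGroupoid A B).IsFullBisection U) {α : InfPath A ≃ₜ InfPath A}
    (hα : (kernelGroupoid A B).Implements U α) :
    ∃ n s m, ActsAs B n s m α ∧ ∃ x : Symbol A →₀ ℤ, (∀ t ∈ x.support, t.HasLevel n) ∧
      weight x = totalWeight m ∧ ∀ g, U.indicator 1 g = realize B x g.1 := by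
  classical
  -- Compactness gives a single level at which every arrow of `U` lies in a basic bisection
  -- contained in `U`.
  obtain ⟨n, hn⟩ := hU.isCompact.elim_directed_cover
    (fun n => {g | ∃ t : Symbol A, t.HasLevel n ∧ g ∈ t.kernelBisection B ∧ t.kernelBisection B ⊆ U})
    (fun n => by
      rw [isOpen_iff_mem_nhds]
      rintro g ⟨t, ht, hg, hO⟩
      exact Filter.mem_of_superset (ht.isOpen_isCompact.1.mem_nhds hg) fun h hh => ⟨t, ht, hh, hO⟩)
    (by
      rintro ⟨g, hg0⟩ hg
      obtain ⟨O, hO, rfl⟩ := isOpen_induced_iff.1 hU.isOpen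
      obtain ⟨a, rfl⟩ := g.exists_mk
      obtain ⟨k, hk⟩ := Quad.exists_bisection_subset hO hg
      have ha : (a.mu.length : ℤ) - a.nu.length = 0 := hg0
      have hl := Quad.length_iterate B k a
      exact mem_iUnion.2 ⟨a.nu.length + k, _, ⟨hl.1.trans (by omega), hl.2⟩,
        a.mem_bisection_iterate k, preimage_mono hk⟩)
    (directed_of_isDirected_le (monotone_nat_of_le_succ fun n g hg => by
      obtain ⟨t, ht, hgt, hO⟩ := hg
      obtain ⟨a, rfl, ha⟩ := hgt
      exact ⟨(a.expand B).symbol, ht.step (a.y.1 0) a.nu_tgt, ⟨_, rfl, (Arrow.mk_expand a).trans ha⟩,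
        Subset.trans (preimage_mono (a.bisection_iterate_subset 1)) hO⟩))
  have hex : ∀ ν : PathOfLength A n, ∃ t : Symbol A, t.HasLevel n ∧ t.nu = ν.1 ∧
      t.kernelBisection B ⊆ U := by
    intro ν
    obtain ⟨y, hy⟩ := exists_infPath_start hA ν.1.tgt
    obtain ⟨g, hg, hgs⟩ := hU.src_bijOn.surjOn (mem_univ (ν.1.append y hy))
    obtain ⟨t, ht, hgt, hO⟩ := hn hg
    refine ⟨t, ht, ?_, hO⟩
    obtain ⟨a, rfl, ha⟩ := hgt
    have hs : a.source = ν.1.append y hy := (congrArg Arrow.src ha).trans hgs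
    exact (FinPath.append_inj a.nu_tgt hy (ht.2.trans ν.2.symm) hs).1
  choose t ht hν hO using hex
  have htgt : ∀ ν, (t ν).mu.tgt = ν.1.tgt := fun ν => by rw [(t ν).tgt_eq, hν]
  refine ⟨n, fun ν => ⟨(t ν).mu, (ht ν).1⟩, fun ν => (t ν).m, ⟨htgt, fun ν y hy => ?_⟩,
    ∑ ν, Finsupp.single (t ν) 1, ?_, ?_, fun g => ?_⟩
  · have hy' : (t ν).nu.tgt = y.start := by rw [hν]; exact hy
    have h1 := hα ⟨Arrow.mk B ((t ν).quad y hy'), (ht ν).degree_eq_zero ⟨_, rfl, rfl⟩⟩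
      (hO ν ⟨_, rfl, rfl⟩)
    exact Eq.trans (congrArg α (FinPath.append_congr (hν ν).symm rfl _)) h1
  · have hmem : ∑ ν, Finsupp.single (t ν) (1 : ℤ) ∈
        Finsupp.supported ℤ ℤ {t : Symbol A | t.HasLevel n} :=
      Submodule.sum_mem _ fun ν _ => Finsupp.single_mem_supported _ _ (ht ν)
    exact fun s hs => (Finsupp.mem_supported _ _).1 hmem hs
  · rw [map_sum, totalWeight]
    refine Finset.sum_congr rfl fun ν _ => ?_
    rw [weight, Finsupp.linearCombination_single, one_smul, hν]
  · rw [map_sum, Finset.sum_apply]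
    simp only [realize_single]
    by_cases hg : g ∈ U
    · rw [indicator_of_mem hg]
      obtain ⟨ν, y, hy, hl, hx⟩ := ((kernelGroupoid A B).src g).exists_append n
      have hsrc : (kernelGroupoid A B).src g ∈ (t ⟨ν, hl⟩).nu.cylinder := by
        rw [hν]; exact ⟨y, hy, hx⟩
      rw [← (ht ⟨ν, hl⟩).src_image_kernel (B := B)] at hsrc
      obtain ⟨g', hg', he⟩ := hsrc
      -- Injectivity of the source on `U` shows that the chosen Z(t(ν)) exhaust `U`; they are
      -- disjoint because their sources are.
      obtain rfl := hU.src_bijOn.injOn (hO _ hg') hg he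
      rw [Finset.sum_eq_single (⟨ν, hl⟩ : PathOfLength A n), indicator_of_mem hg']
      · intro ν' _ hne
        refine indicator_of_notMem (fun hm => hne ?_) _
        have h1 : (kernelGroupoid A B).src g' ∈ ν'.1.cylinder := by
          rw [← hν ν', ← (ht ν').src_image_kernel (B := B)]
          exact ⟨_, hm, rfl⟩
        obtain ⟨z, hz, hzx⟩ := h1
        exact Subtype.ext (FinPath.append_inj hz hy (ν'.2.trans hl.symm) (hzx.trans hx.symm)).1
      · simp
    · rw [indicator_of_notMem hg]
      exact (Finset.sum_eq_zero fun ν _ => indicator_of_notMem (fun hm => hg (hO ν hm)) _).symm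

end PathPermutations

end KatsuraExelPardo

/-! ### The kernel of the index map consists of products of transpositions. -/

open KatsuraExelPardo AlgGroupoid in
theorem mainTheorem5 {N : ℕ} (A : Matrix (Fin N) (Fin N) ℕ) (B : Matrix (Fin N) (Fin N) ℤ)
    (hA : KatsuraExelPardo.IsEssential A) (hAB : KatsuraExelPardo.AHCriteria A B) :
    (KatsuraExelPardo.kernelGroupoid A B).HasPropertyTR := by
  have := hAB.t2Space
  have he : (kernelGroupoid A B).IsEffective :=
    hAB.isEffective.kernel _ (isOpen_degree_eq_zero A B)
  refine ⟨isAmple_kernelGroupoid A B, inferInstance, he, Set.Subset.antisymm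
    (transpositionSubgroup_subset_ker_indexMap (isAmple_kernelGroupoid A B) he) ?_⟩
  rintro α ⟨⟨U, hU, hα⟩, h0⟩
  rw [indexMap_eq (isAmple_kernelGroupoid A B) he hU hα, bisectionClass_eq_zero_iff] at h0
  obtain ⟨f, hf⟩ := h0
  obtain ⟨n₁, s, m, hact, x₁, hx₁, hw₁, hr₁⟩ := exists_actsAs hA.1 hU hα
  obtain ⟨n₂, x₂, hx₂, hw₂, hr₂⟩ := exists_realize_eq_boundaryTwo f
  -- The combinations for `U` and for the boundary have levels `n₁` and `n₂`; both are expanded to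
  -- level n₁ + n₂ before they are compared.
  obtain ⟨k, hk⟩ := exists_iterate_expandMap_eq_zero (B := B) hA.1 (n := n₁ + n₂)
    (x := (expandMap B)^[n₂] x₁ - (expandMap B)^[n₁] x₂)
    (fun t ht => by
      classical
      rcases Finset.mem_union.1 (Finsupp.support_sub ht) with ht | ht
      · exact hasLevel_iterate hx₁ n₂ t ht
      · rw [add_comm]
        exact hasLevel_iterate hx₂ n₁ t ht)
    (fun g hg => by
      have h1 := (hf ⟨g, hg⟩).symm.trans (hr₂ ⟨g, hg⟩)
      rw [hr₁] at h1
      rw [map_sub, realize_iterate, realize_iterate, Pi.sub_apply, sub_eq_zero]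
      exact h1)
  have h1 := congrArg weight hk
  rw [weight_iterate, map_sub, weight_iterate, weight_iterate, hw₂, iterate_map_zero, sub_zero,
    ← Function.iterate_add_apply, hw₁, map_zero] at h1
  -- The boundary part has weight zero, so the weight of `U` dies after k + n₂ expansions, and `α`
  -- is read at that level.
  obtain ⟨s', m', hact', hw'⟩ := hact.exists_add hA.1 (k + n₂)
  exact hact'.mem_transpositionSubgroup hA.1 he (hw'.trans h1)
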